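/- **Conventions.** A $1$-manifold is a compact, second countable, Hausdorff topological $1$-manifold $M$ with boundary, oriented by a maximal oriented atlas of its interior. A boundary point is positive if some chart to $[0,\infty)$ around it restricts on the interior to an orientation chart, and negative otherwise. The objects of $1\mathrm{Cob}$ are pairs $(n,\varepsilon)$ with $n\in\mathbb N$ and $\varepsilon:\{0,\dots,n-1\}\to\{1,-1\}$. A cobordism $(n,\varepsilon_0)\to(m,\varepsilon_1)$ is a triple $(M,f_0,f_1)$, where $M$ is a $1$-manifold, $f_0:\{0,\dots,n-1\}\to\partial M$ and $f_1:\{0,\dots,m-1\}\to\partial M$ are injective, $\partial M$ is the disjoint union of their images, $f_0$ preserves signs and $f_1$ reverses them. Arrows of $1\mathrm{Cob}$ are cobordisms up to orientation preserving homeomorphisms commuting with $f_0$ and $f_1$. Identities are the cylinders $(n,\varepsilon)\times[0,1]$, composition is gluing along the common boundary, the tensor product is "putting side by side" (the unit is the empty object), and the symmetry is the cylinder exchanging two blocks of points. Let $\mathcal F$ be a field of characteristic $0$ and $p\ge 2$ an integer. The category $\mathbf{Mat}_{\mathcal F}$ has the spaces $\mathcal F^n$ ($n\ge 0$) as objects and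 $m\times n$ matrices as arrows $\mathcal F^n\to\mathcal F^m$; its tensor product is multiplication of dimensions and the Kronecker product of matrices, and its symmetry is given by the permutation matrices of $e_i\otimes f_j\mapsto f_j\otimes e_i$. A functor between symmetric strict monoidal categories is symmetric monoidal if it preserves tensor, unit and symmetry on the nose; a $1$TQFT is such a functor from $1\mathrm{Cob}$ to a symmetric strict monoidal category that is equivalent, as a category, to the category of finite-dimensional vector spaces. For a cobordism $K:(n,\varepsilon_0)\to(m,\varepsilon_1)$ let $A(K)$ be the $p^m\times p^n$ matrix over $\mathcal F$ whose $(a_1,a_0)$ entry is defined as follows: write $a_0$ with $n$ digits and $a_1$ with $m$ digits in base $p$ (most significant digit first), and label the $i$-th ingoing (outgoing) boundary point by the $i$-th digit of $a_0$ (of $a_1$). The entry is $1$ if any two boundary points in the same connected component of $K$ have equal labels, and $0$ otherwise. Put $B(n,\varepsilon)=\mathcal F^{p^n}$ and $B(K)=p^{c}\cdot A(K)$, where $c$ is the number of components of $K$ homeomorphic to the circle. **Theorem.** (1) $1\mathrm{Cob}$ and $\mathbf{Mat}_{\mathcal F}$, with the operations above, are symmetric strict monoidal categories, $\mathbf{Mat}_{\mathcal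 F}$ is equivalent to the category of finite-dimensional vector spaces over $\mathcal F$, and $B:1\mathrm{Cob}\to\mathbf{Mat}_{\mathcal F}$ is a faithful symmetric monoidal functor; in particular, it is a $1$TQFT. (2) Let $S^0=(2,(+,-))$. Let $\eta:\emptyset\to S^0$ and $\epsilon:S^0\to\emptyset$ be given by a closed interval $D$, and let $\mu:S^0\otimes S^0\to S^0$ and $\delta:S^0\to S^0\otimes S^0$ be given by $D$ with the interiors of two disjoint closed intervals $D_1$ (left) and $D_2$ (right) in the interior of $D$ removed, where the boundary spheres of $D_1,D_2$ are the two copies of $S^0$ in $S^0\otimes S^0$, that of $D$ is the remaining $S^0$, and left end points are positive, right end points negative points of these $S^0$. Then $(S^0,\mu,\eta,\delta,\epsilon)$ is a symmetric Frobenius object of $1\mathrm{Cob}$, and its image under $B$ is a symmetric Frobenius object of $\mathbf{Mat}_{\mathcal F}$. (3) This image is the matrix Frobenius algebra $\mathcal M_{p\times p}(\mathcal F)$. Namely, let $H:\mathcal F^{p^2}\to\mathcal M_{p\times p}$ and $H_2:\mathcal F^{p^4}\to\mathcal M_{p^2\times p^2}$ be the isomorphisms $H(v)_{i,j}=v_{ip+j}$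 and $H_2(v)_{i,j}=v_{ip^2+j}$. For all $X,Y\in\mathcal M_{p\times p}$, $$H\bigl(B(\mu)\,H_2^{-1}(X\otimes Y)\bigr)=XY=H\bigl(B(\mu)\,(H^{-1}(X)\otimes H^{-1}(Y))\bigr),\qquad H(B(\eta))=I_p,\qquad B(\epsilon)\,H^{-1}(X)=\operatorname{tr}(X).$$ -/

import Mathlib

open CategoryTheory Topology
open scoped Kronecker

universe u v u₁ v₁ u₂ v₂

/-! ### Symmetric strict monoidal categories -/

/-- The operations of a symmetric strict monoidal category on a quiver `C` whose objects form a
monoid (the tensor product of objects is `*`, the unit object is `1`). Composition is written in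
diagrammatic order: `comp f g` is `g ∘ f`. No law on arrows is included. -/
structure MonoidalOps (C : Type u) [Quiver.{v} C] [Monoid C] where
  id (X : C) : X ⟶ X
  comp {X Y Z : C} (f : X ⟶ Y) (g : Y ⟶ Z) : X ⟶ Z
  tensor {X Y X' Y' : C} (f : X ⟶ Y) (g : X' ⟶ Y') : X * X' ⟶ Y * Y'
  symm (X Y : C) : X * Y ⟶ Y * X

namespace MonoidalOps

/-- The laws of a symmetric strict monoidal category. Equations between arrows whose types agree
only up to associativity and unitality of `*` are stated with `HEq`, or by transporting along
those equalities of objects. -/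
structure IsSymmetricStrictMonoidal {C : Type u} [Quiver.{v} C] [Monoid C]
    (D : MonoidalOps C) : Prop where
  id_comp {X Y : C} (f : X ⟶ Y) : D.comp (D.id X) f = f
  comp_id {X Y : C} (f : X ⟶ Y) : D.comp f (D.id Y) = f
  comp_assoc {X Y Z W : C} (f : X ⟶ Y) (g : Y ⟶ Z) (h : Z ⟶ W) :
    D.comp (D.comp f g) h = D.comp f (D.comp g h)
  tensor_id (X Y : C) : D.tensor (D.id X) (D.id Y) = D.id (X * Y)
  tensor_comp {X Y Z X' Y' Z' : C} (f : X ⟶ Y) (g : Y ⟶ Z) (f' : X' ⟶ Y') (g' : Y' ⟶ Z') :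
    D.tensor (D.comp f g) (D.comp f' g') = D.comp (D.tensor f f') (D.tensor g g')
  tensor_assoc {X Y X' Y' X'' Y'' : C} (f : X ⟶ Y) (f' : X' ⟶ Y') (f'' : X'' ⟶ Y'') :
    HEq (D.tensor (D.tensor f f') f'') (D.tensor f (D.tensor f' f''))
  one_tensor {X Y : C} (f : X ⟶ Y) : HEq (D.tensor (D.id 1) f) f
  tensor_one {X Y : C} (f : X ⟶ Y) : HEq (D.tensor f (D.id 1)) f
  symm_natural {X Y X' Y' : C} (f : X ⟶ Y) (g : X' ⟶ Y') :
    D.comp (D.tensor f g) (D.symm Y Y') = D.comp (D.symm X X') (D.tensor g f)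
  symm_symm (X Y : C) : D.comp (D.symm X Y) (D.symm Y X) = D.id (X * Y)
  hexagon (X Y Z : C) :
    D.symm (X * Y) Z =
      D.comp ((D.tensor (D.id X) (D.symm Y Z)).cast (mul_assoc X Y Z).symm (mul_assoc X Z Y).symm)
        ((D.tensor (D.symm X Z) (D.id Y)).cast rfl (mul_assoc Z X Y))

/-- Symmetric Frobenius objects `(M, μ, η, δ, ε)`. -/
structure IsSymmetricFrobenius {C : Type u} [Quiver.{v} C] [Monoid C] (D : MonoidalOps C)
    (M : C) (μ : M * M ⟶ M) (η : 1 ⟶ M) (δ : M ⟶ M * M) (ε : M ⟶ 1) : Prop where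
  mul_assoc : HEq (D.comp (D.tensor μ (D.id M)) μ) (D.comp (D.tensor (D.id M) μ) μ)
  unit_mul : HEq (D.comp (D.tensor η (D.id M)) μ) (D.id M)
  mul_unit : HEq (D.comp (D.tensor (D.id M) η) μ) (D.id M)
  comul_assoc : HEq (D.comp δ (D.tensor δ (D.id M))) (D.comp δ (D.tensor (D.id M) δ))
  counit_comul : HEq (D.comp δ (D.tensor ε (D.id M))) (D.id M)
  comul_counit : HEq (D.comp δ (D.tensor (D.id M) ε)) (D.id M)
  frobenius_left :
    D.comp ((D.tensor δ (D.id M)).cast rfl (_root_.mul_assoc M M M)) (D.tensor (D.id M) μ) =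
      D.comp μ δ
  frobenius_right :
    D.comp ((D.tensor (D.id M) δ).cast rfl (_root_.mul_assoc M M M).symm)
      (D.tensor μ (D.id M)) = D.comp μ δ
  symmetric : D.comp (D.symm M M) (D.comp μ ε) = D.comp μ ε
  cosymmetric : D.comp (D.comp η δ) (D.symm M M) = D.comp η δ

/-- A map of quivers is a symmetric monoidal functor when it preserves composition, identities,
tensor, unit and symmetry on the nose. -/
structure IsSymmetricMonoidalFunctor {C : Type u₁} [Quiver.{v₁} C] [Monoid C]
    {C' : Type u₂} [Quiver.{v₂} C'] [Monoid C'] (D : MonoidalOps C) (D' : MonoidalOps C')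
    (T : C ⥤q C') : Prop where
  map_id (X : C) : T.map (D.id X) = D'.id (T.obj X)
  map_comp {X Y Z : C} (f : X ⟶ Y) (g : Y ⟶ Z) :
    T.map (D.comp f g) = D'.comp (T.map f) (T.map g)
  obj_one : T.obj 1 = 1
  obj_mul (X Y : C) : T.obj (X * Y) = T.obj X * T.obj Y
  map_tensor {X Y X' Y' : C} (f : X ⟶ Y) (g : X' ⟶ Y') :
    HEq (T.map (D.tensor f g)) (D'.tensor (T.map f) (T.map g))
  map_symm (X Y : C) : HEq (T.map (D.symm X Y)) (D'.symm (T.obj X) (T.obj Y))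

end MonoidalOps

/-! ### The category of matrices -/

/-- Objects of the category of matrices over `F`: the vector spaces `F ^ dim`. -/
@[ext]
structure MatCat (F : Type u) where
  dim : ℕ

namespace MatCat

instance (F : Type u) : Monoid (MatCat F) where
  mul X Y := ⟨X.dim * Y.dim⟩
  one := ⟨1⟩
  mul_assoc X Y Z := congrArg MatCat.mk (Nat.mul_assoc X.dim Y.dim Z.dim)
  one_mul X := congrArg MatCat.mk (Nat.one_mul X.dim)
  mul_one X := congrArg MatCat.mk (Nat.mul_one X.dim)

instance (F : Type u) [Field F] : Category (MatCat F) where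
  Hom X Y := Matrix (Fin Y.dim) (Fin X.dim) F
  id X := (1 : Matrix (Fin X.dim) (Fin X.dim) F)
  comp {X Y Z} f g :=
    (g : Matrix (Fin Z.dim) (Fin Y.dim) F) * (f : Matrix (Fin Y.dim) (Fin X.dim) F)
  id_comp f := Matrix.mul_one f
  comp_id f := Matrix.one_mul f
  assoc f g h := (Matrix.mul_assoc h g f).symm

/-- The tensor of matrices is the Kronecker product, with `(i, q)` numbered `i * k + q`; the
symmetry is the permutation matrix sending `e i ⊗ f j` to `f j ⊗ e i`. -/
def ops (F : Type u) [Field F] : MonoidalOps (MatCat F) where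
  id X := 𝟙 X
  comp f g := f ≫ g
  tensor {X Y X' Y'} f g :=
    (Matrix.reindex finProdFinEquiv finProdFinEquiv
      (Matrix.kroneckerMap (· * ·) (f : Matrix (Fin Y.dim) (Fin X.dim) F)
        (g : Matrix (Fin Y'.dim) (Fin X'.dim) F)) :
      Matrix (Fin (Y.dim * Y'.dim)) (Fin (X.dim * X'.dim)) F)
  symm X Y :=
    (Matrix.reindex finProdFinEquiv finProdFinEquiv
      (Matrix.of fun (a : Fin Y.dim × Fin X.dim) (b : Fin X.dim × Fin Y.dim) =>
        if a = b.swap then (1 : F) else 0) :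
      Matrix (Fin (Y.dim * X.dim)) (Fin (X.dim * Y.dim)) F)

end MatCat

/-! ### Compact oriented one-dimensional manifolds with boundary -/

/-- The closed half line. -/
abbrev HalfLine : Type := Set.Ici (0 : ℝ)

/-- A boundary point: some chart into the half line sends it to the end point. -/
def IsBoundaryPoint {M : Type*} [TopologicalSpace M] (x : M) : Prop :=
  ∃ φ : OpenPartialHomeomorph M HalfLine, x ∈ φ.source ∧ (φ x : ℝ) = 0

/-- The transition from `φ` to `ψ` preserves orientation. For homeomorphisms between open subsets
of the line this means that it is increasing near every point. -/
def OrientedTransition {M : Type*} [TopologicalSpace M] (φ ψ : OpenPartialHomeomorph M ℝ) : Prop :=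
  ∀ x ∈ φ.source ∩ ψ.source, ∃ U ∈ 𝓝 (φ x), StrictMonoOn (fun t => ψ (φ.symm t)) U

/-- A compact oriented topological one-dimensional manifold with boundary. The orientation is a
maximal oriented atlas of the interior. -/
structure OrientedOneManifold where
  carrier : Type
  [topology : TopologicalSpace carrier]
  [t2 : T2Space carrier]
  [secondCountable : SecondCountableTopology carrier]
  [compact : CompactSpace carrier]
  locally_halfLine (x : carrier) : ∃ φ : OpenPartialHomeomorph carrier HalfLine, x ∈ φ.source
  atlas : Set (OpenPartialHomeomorph carrier ℝ)
  atlas_covers (x : carrier) : ¬ IsBoundaryPoint x → ∃ φ ∈ atlas, x ∈ φ.source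
  atlas_source_interior (φ : OpenPartialHomeomorph carrier ℝ) :
    φ ∈ atlas → ∀ x ∈ φ.source, ¬ IsBoundaryPoint x
  atlas_oriented (φ ψ : OpenPartialHomeomorph carrier ℝ) :
    φ ∈ atlas → ψ ∈ atlas → OrientedTransition φ ψ
  atlas_maximal (ψ : OpenPartialHomeomorph carrier ℝ) :
    (∀ φ ∈ atlas, OrientedTransition φ ψ ∧ OrientedTransition ψ φ) → ψ ∈ atlas

namespace OrientedOneManifold

attribute [instance] topology t2 secondCountable compact

/-- The boundary point `x` is positive: some chart into the half line around `x` restricts on the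
interior to a chart of the orientation. -/
def IsPositive (M : OrientedOneManifold) (x : M.carrier) : Prop :=
  ∃ φ : OpenPartialHomeomorph M.carrier HalfLine, x ∈ φ.source ∧
    ∃ ψ ∈ M.atlas, ψ.source = {y ∈ φ.source | ¬ IsBoundaryPoint y} ∧
      ∀ y ∈ ψ.source, ψ y = (φ y : ℝ)

open Classical in
/-- The induced orientation of the boundary. -/
noncomputable def boundarySign (M : OrientedOneManifold) (x : M.carrier) : ℤˣ :=
  if M.IsPositive x then 1 else -1

/-- A map that embeds the interior of `M` as an open part of the interior of `N` preserves
orientation: it carries the charts of the orientation of `M` to charts of that of `N`. -/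
def PreservesOrientation (M N : OrientedOneManifold) (f : M.carrier → N.carrier) : Prop :=
  ∀ φ ∈ M.atlas, ∃ ψ ∈ N.atlas, ψ.source = f '' φ.source ∧ ∀ x ∈ φ.source, ψ (f x) = φ x

theorem PreservesOrientation.refl (M : OrientedOneManifold) :
    PreservesOrientation M M id :=
  fun φ hφ => ⟨φ, hφ, by simp, fun _ _ => rfl⟩

theorem PreservesOrientation.comp {M N P : OrientedOneManifold} {f : M.carrier → N.carrier}
    {g : N.carrier → P.carrier} (hg : PreservesOrientation N P g)
    (hf : PreservesOrientation M N f) : PreservesOrientation M P (g ∘ f) := by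
  intro φ hφ
  obtain ⟨ψ, hψ, hs, he⟩ := hf φ hφ
  obtain ⟨χ, hχ, hs', he'⟩ := hg ψ hψ
  refine ⟨χ, hχ, by rw [hs', hs, Set.image_comp], fun x hx => ?_⟩
  rw [Function.comp_apply, he' _ (hs ▸ Set.mem_image_of_mem f hx), he x hx]

theorem PreservesOrientation.symm {M N : OrientedOneManifold} {f : M.carrier ≃ₜ N.carrier}
    (hf : PreservesOrientation M N f) : PreservesOrientation N M f.symm := by
  intro χ hχ
  have key : ∀ φ ∈ M.atlas, OrientedTransition φ (f.transOpenPartialHomeomorph χ) ∧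
      OrientedTransition (f.transOpenPartialHomeomorph χ) φ := by
    intro φ hφ
    obtain ⟨ψ, hψ, hs, he⟩ := hf φ hφ
    constructor
    · rintro x ⟨hx, hx'⟩
      have hx' : f x ∈ χ.source := hx'
      have hxψ : f x ∈ ψ.source := hs ▸ Set.mem_image_of_mem f hx
      obtain ⟨U, hU, hm⟩ := N.atlas_oriented ψ χ hψ hχ (f x) ⟨hxψ, hx'⟩
      rw [he x hx] at hU
      refine ⟨U ∩ φ.target, Filter.inter_mem hU
        (φ.open_target.mem_nhds (φ.map_source hx)), ?_⟩
      refine (hm.mono Set.inter_subset_left).congr ?_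
      rintro t ⟨-, ht⟩
      have h1 := he _ (φ.map_target ht)
      rw [φ.right_inv ht] at h1
      have h2 : f (φ.symm t) ∈ ψ.source := hs ▸ Set.mem_image_of_mem f (φ.map_target ht)
      have h3 := ψ.left_inv h2
      rw [h1] at h3
      simp [h3]
    · rintro x ⟨hx', hx⟩
      have hx' : f x ∈ χ.source := hx'
      have hxψ : f x ∈ ψ.source := hs ▸ Set.mem_image_of_mem f hx
      obtain ⟨U, hU, hm⟩ := N.atlas_oriented χ ψ hχ hψ (f x) ⟨hx', hxψ⟩
      have hcont : ContinuousAt χ.symm (χ (f x)) := χ.continuousAt_symm (χ.map_source hx')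
      have hmem : ψ.source ∈ 𝓝 (χ.symm (χ (f x))) := by
        rw [χ.left_inv hx']; exact ψ.open_source.mem_nhds hxψ
      refine ⟨U ∩ χ.symm ⁻¹' ψ.source, Filter.inter_mem hU (hcont hmem), ?_⟩
      refine (hm.mono Set.inter_subset_left).congr ?_
      rintro t ⟨-, ht⟩
      have ht : χ.symm t ∈ ψ.source := ht
      rw [hs] at ht
      obtain ⟨y, hy, hyt⟩ := ht
      have h1 := he y hy
      simp only [Homeomorph.transOpenPartialHomeomorph_symm_apply, Function.comp_apply]
      rw [← hyt, h1, f.symm_apply_apply]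
  refine ⟨_, M.atlas_maximal _ key, ?_, ?_⟩
  · simp [f.symm.image_eq_preimage_symm]
  · intro x _
    simp

end OrientedOneManifold

/-! ### One-dimensional cobordisms -/

/-- Objects of the category of one-dimensional cobordisms: `n` points in a row, with signs. -/
structure OneCob where
  n : ℕ
  sign : Fin n → ℤˣ

namespace OneCob

theorem ext' {X Y : OneCob} (h : X.n = Y.n) (h' : X.sign = Y.sign ∘ Fin.cast h) : X = Y := by
  obtain ⟨n, s⟩ := X
  obtain ⟨m, t⟩ := Y
  obtain rfl : n = m := h
  obtain rfl : s = t := h'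
  rfl

/-- Objects are put side by side; the unit is the empty object. -/
instance : Monoid OneCob where
  mul X Y := ⟨X.n + Y.n, Fin.append X.sign Y.sign⟩
  one := ⟨0, Fin.elim0⟩
  mul_assoc X Y Z := ext' (Nat.add_assoc _ _ _) (Fin.append_assoc X.sign Y.sign Z.sign)
  one_mul X := ext' (Nat.zero_add _) (Fin.elim0_append X.sign)
  mul_one X := ext' (Nat.add_zero _) (Fin.append_elim0 X.sign)

/-- The zero-dimensional sphere: a positive point followed by a negative point. -/
def sphere : OneCob := ⟨2, ![1, -1]⟩

end OneCob

/-- A cobordism from `X` to `Y`: the boundary is the disjoint union of the ingoing boundary, the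
image of the orientation preserving embedding `f₀`, and of the outgoing boundary, the image of the
orientation reversing embedding `f₁`. -/
structure Cobordism (X Y : OneCob) where
  M : OrientedOneManifold
  f₀ : Fin X.n → M.carrier
  f₁ : Fin Y.n → M.carrier
  f₀_injective : Function.Injective f₀
  f₁_injective : Function.Injective f₁
  disjoint : Disjoint (Set.range f₀) (Set.range f₁)
  boundary : Set.range f₀ ∪ Set.range f₁ = {x | IsBoundaryPoint x}
  f₀_sign (i : Fin X.n) : M.boundarySign (f₀ i) = X.sign i
  f₁_sign (j : Fin Y.n) : M.boundarySign (f₁ j) = - Y.sign j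

namespace Cobordism

/-- Equivalence of cobordisms. -/
def Equivalent {X Y : OneCob} (K L : Cobordism X Y) : Prop :=
  ∃ h : K.M.carrier ≃ₜ L.M.carrier, K.M.PreservesOrientation L.M h ∧
    (∀ i, h (K.f₀ i) = L.f₀ i) ∧ ∀ j, h (K.f₁ j) = L.f₁ j

instance setoid (X Y : OneCob) : Setoid (Cobordism X Y) where
  r := Equivalent
  iseqv :=
    { refl := fun K => ⟨Homeomorph.refl _, OrientedOneManifold.PreservesOrientation.refl K.M,
        fun _ => rfl, fun _ => rfl⟩
      symm := by
        rintro K L ⟨h, ho, h0, h1⟩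
        exact ⟨h.symm, ho.symm, fun i => by simp [← h0], fun i => by simp [← h1]⟩
      trans := by
        rintro K L N ⟨h, ho, h0, h1⟩ ⟨h', ho', h0', h1'⟩
        exact ⟨h.trans h', ho'.comp ho, fun i => by simp [h0, h0'], fun i => by simp [h1, h1']⟩ }

/-- The space obtained from the manifolds of `K` and `L` by gluing the outgoing boundary of `K` to
the ingoing boundary of `L`, with the quotient topology. -/
def Glued {X Y Z : OneCob} (K : Cobordism X Y) (L : Cobordism Y Z) : Type :=
  Quot fun a b : K.M.carrier ⊕ L.M.carrier => ∃ y, a = Sum.inl (K.f₁ y) ∧ b = Sum.inr (L.f₀ y)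

instance {X Y Z : OneCob} (K : Cobordism X Y) (L : Cobordism Y Z) :
    TopologicalSpace (Glued K L) :=
  inferInstanceAs (TopologicalSpace (Quot _))

/-- The map of the first piece into the glued space. -/
def Glued.inl {X Y Z : OneCob} (K : Cobordism X Y) (L : Cobordism Y Z) (x : K.M.carrier) :
    Glued K L := Quot.mk _ (Sum.inl x)

/-- The map of the second piece into the glued space. -/
def Glued.inr {X Y Z : OneCob} (K : Cobordism X Y) (L : Cobordism Y Z) (x : L.M.carrier) :
    Glued K L := Quot.mk _ (Sum.inr x)

/-- `N` is the result of gluing `L` after `K`. -/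
def IsComposite {X Y Z : OneCob} (K : Cobordism X Y) (L : Cobordism Y Z) (N : Cobordism X Z) :
    Prop :=
  ∃ h : Glued K L ≃ₜ N.M.carrier,
    K.M.PreservesOrientation N.M (fun x => h (Glued.inl K L x)) ∧
    L.M.PreservesOrientation N.M (fun x => h (Glued.inr K L x)) ∧
    (∀ i, h (Glued.inl K L (K.f₀ i)) = N.f₀ i) ∧ ∀ j, h (Glued.inr K L (L.f₁ j)) = N.f₁ j

/-- `N` is the result of putting `K` and `L` side by side. -/
def IsSideBySide {X Y X' Y' : OneCob} (K : Cobordism X Y) (L : Cobordism X' Y')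
    (N : Cobordism (X * X') (Y * Y')) : Prop :=
  ∃ h : K.M.carrier ⊕ L.M.carrier ≃ₜ N.M.carrier,
    K.M.PreservesOrientation N.M (fun x => h (Sum.inl x)) ∧
    L.M.PreservesOrientation N.M (fun x => h (Sum.inr x)) ∧
    (∀ i : Fin X.n, h (Sum.inl (K.f₀ i)) = N.f₀ (Fin.castAdd X'.n i)) ∧
    (∀ i : Fin X'.n, h (Sum.inr (L.f₀ i)) = N.f₀ (Fin.natAdd X.n i)) ∧
    (∀ j : Fin Y.n, h (Sum.inl (K.f₁ j)) = N.f₁ (Fin.castAdd Y'.n j)) ∧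
    ∀ j : Fin Y'.n, h (Sum.inr (L.f₁ j)) = N.f₁ (Fin.natAdd Y.n j)

/-- `N` is the cylinder `X × [0, 1]`. Here and below every component of the manifold has a boundary
point, so its orientation is determined by the signs of the objects. -/
def IsIdentity (X : OneCob) (N : Cobordism X X) : Prop :=
  ∃ h : Fin X.n × Set.Icc (0 : ℝ) 1 ≃ₜ N.M.carrier,
    (∀ i, h (i, 0) = N.f₀ i) ∧ ∀ i, h (i, 1) = N.f₁ i

/-- `N` is the cylinder over `X * Y` whose outgoing end is numbered with the two blocks of points
exchanged. -/
def IsSymmetry (X Y : OneCob) (N : Cobordism (X * Y) (Y * X)) : Prop :=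
  ∃ h : Fin (X.n + Y.n) × Set.Icc (0 : ℝ) 1 ≃ₜ N.M.carrier,
    (∀ i, h (i, 0) = N.f₀ i) ∧ ∀ i, h (i, 1) = N.f₁ (finAddFlip i)

/-- The one-dimensional disc. -/
abbrev Disc : Set ℝ := Set.Icc 0 5

/-- A one-dimensional disc without the interiors of the discs `[1, 2]` and `[3, 4]` in it. -/
abbrev Pants : Set ℝ := Disc \ (Set.Ioo 1 2 ∪ Set.Ioo 3 4)

/-- The disc as a cobordism from the empty object to the sphere. -/
def IsUnit (N : Cobordism 1 OneCob.sphere) : Prop :=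
  ∃ h : Disc ≃ₜ N.M.carrier,
    h ⟨0, by norm_num⟩ = N.f₁ (0 : Fin 2) ∧ h ⟨5, by norm_num⟩ = N.f₁ (1 : Fin 2)

/-- The disc as a cobordism from the sphere to the empty object. -/
def IsCounit (N : Cobordism OneCob.sphere 1) : Prop :=
  ∃ h : Disc ≃ₜ N.M.carrier,
    h ⟨0, by norm_num⟩ = N.f₀ (0 : Fin 2) ∧ h ⟨5, by norm_num⟩ = N.f₀ (1 : Fin 2)

/-- The disc with two discs removed, as a cobordism from the two inner spheres to the outer one. -/
def IsMultiplication (N : Cobordism (OneCob.sphere * OneCob.sphere) OneCob.sphere) : Prop :=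
  ∃ h : Pants ≃ₜ N.M.carrier,
    h ⟨0, by norm_num⟩ = N.f₁ (0 : Fin 2) ∧ h ⟨5, by norm_num⟩ = N.f₁ (1 : Fin 2) ∧
    h ⟨1, by norm_num⟩ = N.f₀ (0 : Fin 4) ∧ h ⟨2, by norm_num⟩ = N.f₀ (1 : Fin 4) ∧
    h ⟨3, by norm_num⟩ = N.f₀ (2 : Fin 4) ∧ h ⟨4, by norm_num⟩ = N.f₀ (3 : Fin 4)

/-- The disc with two discs removed, as a cobordism from the outer sphere to the two inner ones. -/
def IsComultiplication (N : Cobordism OneCob.sphere (OneCob.sphere * OneCob.sphere)) : Prop :=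
  ∃ h : Pants ≃ₜ N.M.carrier,
    h ⟨0, by norm_num⟩ = N.f₀ (0 : Fin 2) ∧ h ⟨5, by norm_num⟩ = N.f₀ (1 : Fin 2) ∧
    h ⟨1, by norm_num⟩ = N.f₁ (0 : Fin 4) ∧ h ⟨2, by norm_num⟩ = N.f₁ (1 : Fin 4) ∧
    h ⟨3, by norm_num⟩ = N.f₁ (2 : Fin 4) ∧ h ⟨4, by norm_num⟩ = N.f₁ (3 : Fin 4)

end Cobordism

namespace OneCob

/-- Arrows are equivalence classes of cobordisms. -/
instance : Quiver OneCob where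
  Hom X Y := Quotient (Cobordism.setoid X Y)

/-- The arrow represented by a cobordism. -/
def arrow {X Y : OneCob} (K : Cobordism X Y) : X ⟶ Y := Quotient.mk (Cobordism.setoid X Y) K

/-- `f` is the arrow represented by the cobordisms with property `P`: there are such cobordisms,
and all of them represent `f`. -/
def IsArrowOf {X Y : OneCob} (P : Cobordism X Y → Prop) (f : X ⟶ Y) : Prop :=
  (∃ K, P K) ∧ ∀ K, P K → arrow K = f

/-- The operations `D` are those of the category of one-dimensional cobordisms: identities are
cylinders, composition is gluing, the tensor product is putting side by side, the symmetry is the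
cylinder that exchanges two blocks. Since every arrow is represented by a cobordism, this
determines `D`. -/
structure IsCobordismOps (D : MonoidalOps OneCob) : Prop where
  id (X : OneCob) : IsArrowOf (Cobordism.IsIdentity X) (D.id X)
  comp {X Y Z : OneCob} (K : Cobordism X Y) (L : Cobordism Y Z) :
    IsArrowOf (Cobordism.IsComposite K L) (D.comp (arrow K) (arrow L))
  tensor {X Y X' Y' : OneCob} (K : Cobordism X Y) (L : Cobordism X' Y') :
    IsArrowOf (Cobordism.IsSideBySide K L) (D.tensor (arrow K) (arrow L))
  symm (X Y : OneCob) : IsArrowOf (Cobordism.IsSymmetry X Y) (D.symm X Y)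

end OneCob

/-! ### The Brauer representation -/

namespace Cobordism

/-- The ingoing and outgoing boundary points of a cobordism. -/
def point {X Y : OneCob} (K : Cobordism X Y) : Fin X.n ⊕ Fin Y.n → K.M.carrier :=
  Sum.elim K.f₀ K.f₁

/-- Two boundary points are related when they lie in the same connected component. -/
def rho {X Y : OneCob} (K : Cobordism X Y) (s t : Fin X.n ⊕ Fin Y.n) : Prop :=
  connectedComponent (K.point s) = connectedComponent (K.point t)

/-- The set of circular components. -/
def circles {X Y : OneCob} (K : Cobordism X Y) : Set (Set K.M.carrier) :=
  {C | (∃ x, C = connectedComponent x) ∧ Nonempty (C ≃ₜ Circle)}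

end Cobordism

/-- The digit with index `i` (counted from the left, starting with `0`) of `a`, written in the base
`p` system with `n` digits. -/
def digit (p n a : ℕ) (i : Fin n) : ℕ := a / p ^ (n - 1 - (i : ℕ)) % p

/-- The digits of the column index `a₀` and of the row index `a₁`. -/
def digits (p : ℕ) {n m : ℕ} (a₀ : Fin (p ^ n)) (a₁ : Fin (p ^ m)) : Fin n ⊕ Fin m → ℕ :=
  Sum.elim (digit p n a₀) (digit p m a₁)

open Classical in
/-- The `0`-`1` matrix of a cobordism. -/
noncomputable def brauerMatrix (p : ℕ) (F : Type u) [Field F] {X Y : OneCob} (K : Cobordism X Y) :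
    Matrix (Fin (p ^ Y.n)) (Fin (p ^ X.n)) F :=
  Matrix.of fun a₁ a₀ => if ∀ s t, K.rho s t → digits p a₀ a₁ s = digits p a₀ a₁ t then 1 else 0

theorem image_connectedComponent_homeomorph {M N : Type*} [TopologicalSpace M]
    [TopologicalSpace N] (h : M ≃ₜ N) (x : M) :
    h '' connectedComponent x = connectedComponent (h x) := by
  refine (h.continuous.image_connectedComponent_subset x).antisymm ?_
  intro y hy
  have := h.symm.continuous.image_connectedComponent_subset (h x) (Set.mem_image_of_mem _ hy)
  rw [h.symm_apply_apply] at this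
  exact ⟨h.symm y, this, h.apply_symm_apply y⟩

theorem Cobordism.Equivalent.rho_eq {X Y : OneCob} {K L : Cobordism X Y} (e : K.Equivalent L) :
    K.rho = L.rho := by
  obtain ⟨h, -, h0, h1⟩ := e
  have hp : ∀ s, L.point s = h (K.point s) := by
    rintro (i | i)
    · exact (h0 i).symm
    · exact (h1 i).symm
  ext s t
  unfold Cobordism.rho
  rw [hp, hp, ← image_connectedComponent_homeomorph h, ← image_connectedComponent_homeomorph h]
  exact (Set.image_injective.2 h.injective).eq_iff.symm

theorem Cobordism.Equivalent.circles_eq {X Y : OneCob} {K L : Cobordism X Y}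
    (e : K.Equivalent L) : K.circles.ncard = L.circles.ncard := by
  obtain ⟨h, -, -, -⟩ := e
  have : L.circles = Set.image h '' K.circles := by
    ext C
    constructor
    · rintro ⟨⟨x, rfl⟩, ⟨g⟩⟩
      have hx : h '' connectedComponent (h.symm x) = connectedComponent x := by
        rw [image_connectedComponent_homeomorph h, h.apply_symm_apply]
      exact ⟨_, ⟨⟨h.symm x, rfl⟩,
        ⟨((h.image _).trans (Homeomorph.setCongr hx)).trans g⟩⟩, hx⟩
    · rintro ⟨_, ⟨⟨x, rfl⟩, ⟨g⟩⟩, rfl⟩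
      exact ⟨⟨h x, image_connectedComponent_homeomorph h x⟩, ⟨(h.image _).symm.trans g⟩⟩
  rw [this, Set.ncard_image_of_injective _ (Set.image_injective.2 h.injective)]

/-- The Brauer representation: `n` points are sent to `F ^ (p ^ n)`, and the arrow represented by
`K` to `p ^ c` times the `0`-`1` matrix of `K`, where `c` is the number of circular components. -/
noncomputable def brauer (p : ℕ) (F : Type u) [Field F] : OneCob ⥤q MatCat F where
  obj X := ⟨p ^ X.n⟩
  map {X Y} := Quotient.lift
    (fun K : Cobordism X Y =>
      ((p : F) ^ K.circles.ncard • brauerMatrix p F K :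
        Matrix (Fin (p ^ Y.n)) (Fin (p ^ X.n)) F))
    (fun K L (e : K.Equivalent L) => by
      unfold brauerMatrix
      rw [e.rho_eq, e.circles_eq])

theorem brauer_obj_one (p : ℕ) (F : Type u) [Field F] : (brauer p F).obj 1 = 1 := rfl

theorem brauer_obj_mul (p : ℕ) (F : Type u) [Field F] (X Y : OneCob) :
    (brauer p F).obj (X * Y) = (brauer p F).obj X * (brauer p F).obj Y :=
  congrArg MatCat.mk (pow_add p X.n Y.n)

/-! ### Vectors and matrices -/

/-- The numbering of pairs in which `(i, j)` has number `i * n + j`. -/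
def pairIndex {n N : ℕ} (h : n * n = N) : Fin n × Fin n ≃ Fin N :=
  finProdFinEquiv.trans (finCongr h)

/-- The isomorphism between vectors of length `N = n * n` and square matrices of order `n` in which
the `(i, j)` entry of the matrix is the entry of the vector with number `i * n + j`. -/
def vecToMatrix (F : Type u) [Field F] {n N : ℕ} (h : n * n = N) :
    (Fin N → F) ≃ₗ[F] Matrix (Fin n) (Fin n) F where
  toFun x := Matrix.of fun i j => x (pairIndex h (i, j))
  invFun A a := A ((pairIndex h).symm a).1 ((pairIndex h).symm a).2
  map_add' _ _ := rfl
  map_smul' _ _ := rfl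
  left_inv x := by ext a; simp
  right_inv A := by ext i j; simp

/-- The standard isomorphism between vectors of length `p ^ 2` and matrices of order `p`. -/
def matrixH (p : ℕ) (F : Type u) [Field F] :
    (Fin (p ^ 2) → F) ≃ₗ[F] Matrix (Fin p) (Fin p) F :=
  vecToMatrix F (by ring)

/-- The standard isomorphism between vectors of length `p ^ 4` and matrices of order `p ^ 2`. -/
def matrixH₂ (p : ℕ) (F : Type u) [Field F] :
    (Fin (p ^ 4) → F) ≃ₗ[F] Matrix (Fin (p ^ 2)) (Fin (p ^ 2)) F :=
  vecToMatrix F (by ring)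

/-- The Kronecker product of two matrices of order `p`, as a matrix of order `p ^ 2`. -/
def kron {p : ℕ} {F : Type u} [Field F] (A C : Matrix (Fin p) (Fin p) F) :
    Matrix (Fin (p ^ 2)) (Fin (p ^ 2)) F :=
  Matrix.reindex (pairIndex (by ring)) (pairIndex (by ring)) (A ⊗ₖ C)

/-- The tensor product of two vectors of length `p ^ 2`; the product of the entries numbered `a`
and `b` has number `a * p ^ 2 + b`. -/
def vecTensor {p : ℕ} {F : Type u} [Field F] (x y : Fin (p ^ 2) → F) : Fin (p ^ 4) → F :=
  (matrixH₂ p F).symm (Matrix.vecMulVec x y)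

/-- The matrix `B` of order `p ^ 2` by `p ^ 4` represents the multiplication of matrices of
order `p`, both on the Kronecker product of two matrices and on the tensor product of the two
corresponding vectors. -/
def RepresentsMul {p : ℕ} {F : Type u} [Field F] (B : Matrix (Fin (p ^ 2)) (Fin (p ^ 4)) F) : Prop :=
  ∀ A C : Matrix (Fin p) (Fin p) F,
    matrixH p F (B.mulVec ((matrixH₂ p F).symm (kron A C))) = A * C ∧
    matrixH p F (B.mulVec (vecTensor ((matrixH p F).symm A) ((matrixH p F).symm C))) = A * C

/-- The column `B` represents the identity matrix of order `p`. -/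
def RepresentsOne {p : ℕ} {F : Type u} [Field F] (B : Matrix (Fin (p ^ 2)) (Fin (p ^ 0)) F) : Prop :=
  matrixH p F (B.mulVec fun _ => 1) = 1

/-- The row `B` represents the trace form on matrices of order `p`. -/
def RepresentsTrace {p : ℕ} {F : Type u} [Field F] (B : Matrix (Fin (p ^ 0)) (Fin (p ^ 2)) F) :
    Prop :=
  ∀ A : Matrix (Fin p) (Fin p) F, B.mulVec ((matrixH p F).symm A) = fun _ => A.trace

/-! The matrix of a cobordism is a state sum. Label the boundary points of K by elements of `Fin p`;
the corresponding entry of B(K) is the number of locally constant functions from the manifold to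
`Fin p` with these values on the boundary (`entry_arrow`). Such a function is a choice of one colour
for each component: a component with boundary points admits one colour or none, a circle admits p,
which is where the factor p^c comes from.

In this form functoriality is formal. A locally constant function on a glued manifold is a pair of
locally constant functions agreeing on the common boundary, and summing over the common values is
matrix multiplication (`entry_arrow_of_isComposite`). On a disjoint union the two restrictions are
independent, so entries multiply as in a Kronecker product (`entry_arrow_of_isSideBySide`).

Faithfulness rests on the classification of compact oriented 1-manifolds. In a compact manifold some
arc leads from a given boundary point to another one (`IsBoundaryPoint.exists_arc_to_boundary`), and
its image is the whole component. In a component without boundary, cutting out an open arc creates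
two boundary points, the same result joins them in the complement, and the two arcs together form a
circle (`LocallyHalfLine.exists_addCircle`). An oriented interval starts at a positive point and
ends at a negative one, so the partition of the boundary points into components, together with the
number of circles, determines a cobordism up to equivalence (`Cobordism.equivalent_of_rho_eq`). Both
are visible in B(K): the partition in the positions of the nonzero entries, the number of circles in
the entry of a constant labelling (`eq_of_entry_eq`).

Faithfulness then replaces most of the geometry of 1Cob. What has to be constructed are
representatives of the operations: cylinders, disjoint unions and glued manifolds, the latter two
oriented by `OrientedOneManifold.exists_union`. That the result does not depend on representatives
(`isCobordismOps`), and that all laws of a symmetric strict monoidal category hold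
(`MonoidalOps.IsSymmetricMonoidalFunctor.isSymmetricStrictMonoidal`), is checked on matrices.

For the Frobenius structure, a labelling of the sphere is a pair (i, j), that is, a matrix unit. The
multiplication cobordism consists of three intervals, and its entries are the structure constants of
the product of matrix units; the comultiplication has the same coefficients, and unit and counit
have those of the trace. The axioms become identities between finite sums, proved once and lifted to
1Cob by faithfulness (`isSymmetricFrobenius_of_entry`); the functor carries them back to matrices.
-/

/-! ### Injective paths and charts in one-dimensional manifolds -/

section Arcs

open Set Filter

/-- Every point of `M` has a neighbourhood homeomorphic to an open part of the half line. -/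
def LocallyHalfLine (M : Type*) [TopologicalSpace M] : Prop :=
  ∀ x : M, ∃ φ : OpenPartialHomeomorph M HalfLine, x ∈ φ.source

theorem exists_Icc_subset_of_mem_nhds {W : Set ℝ} {t : ℝ} (h : W ∈ 𝓝 t) :
    ∃ ε > 0, Icc (t - ε) (t + ε) ⊆ W := by
  obtain ⟨ε, hε, h⟩ := Metric.nhds_basis_closedBall.mem_iff.1 h
  exact ⟨ε, hε, by rwa [← Real.closedBall_eq_Icc]⟩

/-- On a closed interval around t an injective continuous function is strictly monotone, so its
image is the interval between the end values, with f t strictly inside. -/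
theorem image_mem_nhds_of_injOn {f : ℝ → ℝ} {t : ℝ} {U : Set ℝ} (hU : U ∈ 𝓝 t)
    (hc : ContinuousOn f U) (hi : InjOn f U) : f '' U ∈ 𝓝 (f t) := by
  obtain ⟨ε, hε, h⟩ := exists_Icc_subset_of_mem_nhds hU
  have ht : t ∈ Icc (t - ε) (t + ε) := ⟨by linarith, by linarith⟩
  have hl : t - ε ∈ Icc (t - ε) (t + ε) := ⟨by linarith, by linarith⟩
  have hr : t + ε ∈ Icc (t - ε) (t + ε) := ⟨by linarith, by linarith⟩
  refine mem_of_superset ?_ (image_mono h)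
  rcases (hc.mono h).strictMonoOn_of_injOn_Icc' (by linarith) (hi.mono h) with hm | hm
  · rw [(hc.mono h).image_Icc_of_monotoneOn (by linarith) hm.monotoneOn]
    exact Icc_mem_nhds (hm hl ht (by linarith)) (hm ht hr (by linarith))
  · rw [(hc.mono h).image_Icc_of_antitoneOn (by linarith) hm.antitoneOn]
    exact Icc_mem_nhds (hm ht hr (by linarith)) (hm hl ht (by linarith))

/-- A local homeomorphism given by its inverse. -/
theorem exists_openPartialHomeomorph_of_image_mem_nhds {H M : Type*} [TopologicalSpace H]
    [TopologicalSpace M] [Nonempty H] {g : H → M} {V : Set H} (hV : IsOpen V)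
    (hc : ContinuousOn g V) (hi : InjOn g V)
    (ho : ∀ t ∈ V, ∀ U ∈ 𝓝 t, U ⊆ V → g '' U ∈ 𝓝 (g t)) :
    ∃ ψ : OpenPartialHomeomorph M H, ψ.source = g '' V ∧ ψ.target = V ∧
      (∀ t ∈ V, ψ (g t) = t) ∧ ∀ t, ψ.symm t = g t := by
  let e := hi.toPartialEquiv g V
  have hop : IsOpenMap (e.source.domRestrict e) := by
    intro W hW
    rw [isOpen_iff_mem_nhds]
    rintro _ ⟨⟨t, ht⟩, htW, rfl⟩
    have hW' : Subtype.val '' W ∈ 𝓝 t :=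
      (hV.isOpenEmbedding_subtypeVal.isOpenMap W hW).mem_nhds ⟨⟨t, ht⟩, htW, rfl⟩
    have := ho t ht _ hW' (by rintro _ ⟨x, -, rfl⟩; exact x.2)
    refine mem_of_superset this ?_
    rintro _ ⟨_, ⟨x, hx, rfl⟩, rfl⟩
    exact ⟨x, hx, rfl⟩
  refine ⟨(OpenPartialHomeomorph.ofContinuousOpenRestrict e hc hop hV).symm, rfl, rfl, ?_,
    fun t => rfl⟩
  intro t ht
  exact e.left_inv ht

/-- The retraction of the line onto the half line. -/
def toHalfLine (t : ℝ) : HalfLine := ⟨max t 0, mem_Ici.2 (le_max_right _ _)⟩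

@[fun_prop]
theorem continuous_toHalfLine : Continuous toHalfLine :=
  (continuous_id.max continuous_const).subtype_mk _

theorem coe_toHalfLine {t : ℝ} (ht : 0 ≤ t) : (toHalfLine t : ℝ) = t := max_eq_left ht

theorem toHalfLine_coe (t : HalfLine) : toHalfLine t = t := Subtype.ext (coe_toHalfLine t.2)

variable {M : Type*} [TopologicalSpace M]

theorem IsBoundaryPoint.exists_arc {x : M} (hx : IsBoundaryPoint x) :
    ∃ γ : ℝ → M, ContinuousOn γ (Icc 0 1) ∧ InjOn γ (Icc 0 1) ∧ γ 0 = x := by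
  obtain ⟨φ, hs, h0⟩ := hx
  have h0' : toHalfLine 0 = φ x := (congrArg toHalfLine h0).symm.trans (toHalfLine_coe _)
  have hmem : toHalfLine ⁻¹' φ.target ∈ 𝓝 (0 : ℝ) := by
    apply continuous_toHalfLine.continuousAt
    rw [h0']
    exact φ.open_target.mem_nhds (φ.map_source hs)
  obtain ⟨ε, hε, h⟩ := exists_Icc_subset_of_mem_nhds hmem
  have key : ∀ t ∈ Icc (0 : ℝ) 1, toHalfLine (ε * t) ∈ φ.target := by
    intro t ht
    apply h
    constructor <;> nlinarith [ht.1, ht.2]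
  refine ⟨fun t => φ.symm (toHalfLine (ε * t)), ?_, ?_, ?_⟩
  · exact φ.continuousOn_symm.comp (by fun_prop) key
  · intro s hs' t ht hst
    have := congrArg Subtype.val (φ.symm.injOn (key s hs') (key t ht) hst)
    rw [coe_toHalfLine (mul_nonneg hε.le hs'.1), coe_toHalfLine (mul_nonneg hε.le ht.1)] at this
    exact mul_left_cancel₀ hε.ne' this
  · simp only [mul_zero]
    rw [h0', φ.left_inv hs]

/-- An interior point has a positive coordinate in any half line chart, so a two-sided interval
around it fits into the target. The domain is larger than [-1, 1] because the circle construction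
cuts out the image of (-1, 1) and needs the path on both sides of the cuts. -/
theorem LocallyHalfLine.exists_arc (hM : LocallyHalfLine M) {x : M} (hx : ¬ IsBoundaryPoint x) :
    ∃ γ : ℝ → M, ContinuousOn γ (Ioo (-2) 2) ∧ InjOn γ (Ioo (-2) 2) ∧ γ 0 = x := by
  obtain ⟨φ, hs⟩ := hM x
  have h0 : (φ x : ℝ) ≠ 0 := fun h => hx ⟨φ, hs, h⟩
  have hpos : 0 < (φ x : ℝ) := lt_of_le_of_ne (φ x).2 (Ne.symm h0)
  have hmem : toHalfLine ⁻¹' φ.target ∩ Ioi 0 ∈ 𝓝 (φ x : ℝ) := by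
    apply inter_mem _ (Ioi_mem_nhds hpos)
    apply continuous_toHalfLine.continuousAt
    rw [toHalfLine_coe]
    exact φ.open_target.mem_nhds (φ.map_source hs)
  obtain ⟨ε, hε, h⟩ := exists_Icc_subset_of_mem_nhds hmem
  have key : ∀ t ∈ Ioo (-2 : ℝ) 2, (φ x : ℝ) + ε / 2 * t ∈ Icc ((φ x : ℝ) - ε) (φ x + ε) := by
    intro t ht
    constructor <;> nlinarith [ht.1, ht.2]
  refine ⟨fun t => φ.symm (toHalfLine (φ x + ε / 2 * t)), ?_, ?_, ?_⟩
  · exact φ.continuousOn_symm.comp (by fun_prop) fun t ht => (h (key t ht)).1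
  · intro s hs' t ht hst
    have := congrArg Subtype.val (φ.symm.injOn (h (key s hs')).1 (h (key t ht)).1 hst)
    rw [coe_toHalfLine (le_of_lt (h (key s hs')).2),
      coe_toHalfLine (le_of_lt (h (key t ht)).2)] at this
    exact mul_left_cancel₀ (half_pos hε).ne' (add_left_cancel this)
  · simp only [mul_zero, add_zero]
    rw [toHalfLine_coe, φ.left_inv hs]

/-- Invariance of domain. -/
theorem LocallyHalfLine.image_mem_nhds (hM : LocallyHalfLine M) {γ : ℝ → M} {t : ℝ} {U : Set ℝ}
    (hU : U ∈ 𝓝 t) (hc : ContinuousOn γ U) (hi : InjOn γ U) : γ '' U ∈ 𝓝 (γ t) := by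
  obtain ⟨φ, hs⟩ := hM (γ t)
  have hca : ContinuousAt γ t := hc.continuousAt hU
  have hV : U ∩ γ ⁻¹' φ.source ∈ 𝓝 t := inter_mem hU (hca (φ.open_source.mem_nhds hs))
  set V := U ∩ γ ⁻¹' φ.source with hVdef
  -- In a chart the path becomes an injective real function, to which the one-variable statement
  -- applies.
  have hcf : ContinuousOn (fun s => (φ (γ s) : ℝ)) V :=
    continuous_subtype_val.comp_continuousOn
      (φ.continuousOn.comp (hc.mono inter_subset_left) fun s hs => hs.2)
  have hif : InjOn (fun s => (φ (γ s) : ℝ)) V := fun s hs s' hs' h =>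
    hi hs.1 hs'.1 (φ.injOn hs.2 hs'.2 (Subtype.ext h))
  have := image_mem_nhds_of_injOn hV hcf hif
  have hφ : ContinuousAt (fun y => (φ y : ℝ)) (γ t) :=
    continuous_subtype_val.continuousAt.comp (φ.continuousAt hs)
  filter_upwards [hφ this, φ.open_source.mem_nhds hs] with y hy hys
  obtain ⟨s, hs, hsy⟩ := hy
  exact ⟨s, hs.1, φ.injOn hs.2 hys (Subtype.ext hsy)⟩

/-- In a chart sending the point to the end of the half line, the path would cover a neighbourhood
of 0 in the line, negative values included. This invariance of the boundary makes interior and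
boundary exclude each other, whichever chart is used. -/
theorem not_isBoundaryPoint_of_injOn {γ : ℝ → M} {t : ℝ} {U : Set ℝ} (hU : U ∈ 𝓝 t)
    (hc : ContinuousOn γ U) (hi : InjOn γ U) : ¬ IsBoundaryPoint (γ t) := by
  rintro ⟨φ, hs, h0⟩
  have hca : ContinuousAt γ t := hc.continuousAt hU
  have hV : U ∩ γ ⁻¹' φ.source ∈ 𝓝 t := inter_mem hU (hca (φ.open_source.mem_nhds hs))
  set V := U ∩ γ ⁻¹' φ.source with hVdef
  have hcf : ContinuousOn (fun s => (φ (γ s) : ℝ)) V :=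
    continuous_subtype_val.comp_continuousOn
      (φ.continuousOn.comp (hc.mono inter_subset_left) fun s hs => hs.2)
  have hif : InjOn (fun s => (φ (γ s) : ℝ)) V := fun s hs s' hs' h =>
    hi hs.1 hs'.1 (φ.injOn hs.2 hs'.2 (Subtype.ext h))
  have := image_mem_nhds_of_injOn hV hcf hif
  simp only [h0] at this
  obtain ⟨ε, hε, h⟩ := exists_Icc_subset_of_mem_nhds this
  obtain ⟨s, -, hs⟩ := h (show (-ε) ∈ _ from ⟨by linarith, by linarith⟩)
  have : 0 ≤ (φ (γ s) : ℝ) := (φ (γ s)).2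
  simp only at hs
  linarith

theorem OpenPartialHomeomorph.not_isBoundaryPoint (ψ : OpenPartialHomeomorph M ℝ) {x : M}
    (hx : x ∈ ψ.source) : ¬ IsBoundaryPoint x := by
  have := not_isBoundaryPoint_of_injOn (ψ.open_target.mem_nhds (ψ.map_source hx))
    ψ.continuousOn_symm ψ.symm.injOn
  rwa [ψ.left_inv hx] at this

/-- One-sided form of invariance of domain. The coordinate along the path is 0 at a and positive at
a later c, so by the intermediate value theorem it covers an initial segment of the half line. -/
theorem IsBoundaryPoint.image_mem_nhds {γ : ℝ → M} {a b : ℝ} (hab : a < b)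
    (hx : IsBoundaryPoint (γ a)) (hc : ContinuousOn γ (Ico a b)) (hi : InjOn γ (Ico a b)) :
    γ '' Ico a b ∈ 𝓝 (γ a) := by
  obtain ⟨φ, hs, h0⟩ := hx
  have hca : ContinuousWithinAt γ (Ico a b) a := hc a ⟨le_rfl, hab⟩
  have hV : γ ⁻¹' φ.source ∈ 𝓝[Ico a b] a := hca (φ.open_source.mem_nhds hs)
  rw [nhdsWithin_Ico_eq_nhdsGE hab, mem_nhdsGE_iff_exists_Icc_subset] at hV
  obtain ⟨d, hd, h⟩ := hV
  obtain ⟨c, hac, hcmin⟩ := exists_between (lt_min hab hd)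
  have hcb : c < b := hcmin.trans_le (min_le_left _ _)
  have hcd : c < d := hcmin.trans_le (min_le_right _ _)
  have h' : Icc a c ⊆ γ ⁻¹' φ.source := (Icc_subset_Icc_right hcd.le).trans h
  have hsub : Icc a c ⊆ Ico a b := fun s hs => ⟨hs.1, hs.2.trans_lt hcb⟩
  have hcf : ContinuousOn (fun s => (φ (γ s) : ℝ)) (Icc a c) :=
    continuous_subtype_val.comp_continuousOn (φ.continuousOn.comp (hc.mono hsub) h')
  have hpos : 0 < (φ (γ c) : ℝ) := by
    refine lt_of_le_of_ne (φ (γ c)).2 fun h => hac.ne ?_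
    refine hi ⟨le_rfl, hab⟩ ⟨hac.le, hcb⟩ (φ.injOn hs (h' ⟨hac.le, le_rfl⟩) (Subtype.ext ?_))
    rw [h0, ← h]
  have hivt := intermediate_value_Icc hac.le hcf
  have hφ : ContinuousAt (fun y => (φ y : ℝ)) (γ a) :=
    continuous_subtype_val.continuousAt.comp (φ.continuousAt hs)
  have hn : Iio (φ (γ c) : ℝ) ∈ 𝓝 ((φ (γ a) : ℝ)) := Iio_mem_nhds (by rwa [h0])
  filter_upwards [hφ hn, φ.open_source.mem_nhds hs] with y hy hys
  obtain ⟨s, hs, hsy⟩ := hivt ⟨by simp only [h0]; exact (φ y).2, le_of_lt hy⟩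
  exact ⟨s, hsub hs, φ.injOn (h' hs) hys (Subtype.ext hsy)⟩

/-- An injective path inverts to a chart of the interior. -/
theorem LocallyHalfLine.exists_chart (hM : LocallyHalfLine M) {γ : ℝ → M} {V : Set ℝ}
    (hV : IsOpen V) (hc : ContinuousOn γ V) (hi : InjOn γ V) :
    ∃ ψ : OpenPartialHomeomorph M ℝ, ψ.source = γ '' V ∧ ψ.target = V ∧
      (∀ t ∈ V, ψ (γ t) = t) ∧ ∀ t, ψ.symm t = γ t :=
  exists_openPartialHomeomorph_of_image_mem_nhds hV hc hi fun _ _ _ hU hUV =>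
    hM.image_mem_nhds hU (hc.mono hUV) (hi.mono hUV)

/-- An injective path from a boundary point inverts to a chart. -/
theorem LocallyHalfLine.exists_boundary_chart (hM : LocallyHalfLine M) {γ : ℝ → M} {b : ℝ}
    (hb : 0 < b) (hx : IsBoundaryPoint (γ 0)) (hc : ContinuousOn γ (Ico 0 b))
    (hi : InjOn γ (Ico 0 b)) :
    ∃ ψ : OpenPartialHomeomorph M HalfLine, ψ.source = γ '' Ico 0 b ∧
      ∀ t ∈ Ico 0 b, (ψ (γ t) : ℝ) = t := by
  have hV : IsOpen ((↑) ⁻¹' Iio b : Set HalfLine) := isOpen_Iio.preimage continuous_subtype_val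
  have hmaps : ∀ t ∈ ((↑) ⁻¹' Iio b : Set HalfLine), (t : ℝ) ∈ Ico 0 b := fun t ht => ⟨t.2, ht⟩
  have ho : ∀ t ∈ ((↑) ⁻¹' Iio b : Set HalfLine), ∀ U ∈ 𝓝 t, U ⊆ ((↑) ⁻¹' Iio b : Set HalfLine) →
      (fun t : HalfLine => γ t) '' U ∈ 𝓝 (γ t) := by
    intro t ht U hU hUV
    rw [nhds_subtype, mem_comap] at hU
    obtain ⟨W, hW, hWU⟩ := hU
    rcases eq_or_lt_of_le (show (0 : ℝ) ≤ t from t.2) with h0 | h0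
    · obtain ⟨ε, hε, hεW⟩ := exists_Icc_subset_of_mem_nhds hW
      have hpos : 0 < min ε b := lt_min hε hb
      have := IsBoundaryPoint.image_mem_nhds hpos hx
        (hc.mono (Ico_subset_Ico_right (min_le_right _ _)))
        (hi.mono (Ico_subset_Ico_right (min_le_right _ _)))
      simp only [← h0]
      refine mem_of_superset this ?_
      rintro _ ⟨s, hs, rfl⟩
      refine ⟨⟨s, hs.1⟩, hWU (hεW ?_), rfl⟩
      have := hs.2.trans_le (min_le_left _ _)
      rw [← h0]
      constructor <;> simp <;> linarith [hs.1]
    · have hW' : W ∩ Ioo 0 b ∈ 𝓝 (t : ℝ) := inter_mem hW (Ioo_mem_nhds h0 ht)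
      have hsub : W ∩ Ioo 0 b ⊆ Ico 0 b := fun s hs => ⟨hs.2.1.le, hs.2.2⟩
      have := hM.image_mem_nhds hW' (hc.mono hsub) (hi.mono hsub)
      refine mem_of_superset this ?_
      rintro _ ⟨s, hs, rfl⟩
      exact ⟨⟨s, hs.2.1.le⟩, hWU hs.1, rfl⟩
  obtain ⟨ψ, hψs, -, hψ, -⟩ := exists_openPartialHomeomorph_of_image_mem_nhds
    (g := fun t : HalfLine => γ t) hV (hc.comp continuous_subtype_val.continuousOn hmaps)
    (fun s hs t ht h => Subtype.ext (hi (hmaps s hs) (hmaps t ht) h)) ho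
  refine ⟨ψ, ?_, fun t ht => congrArg Subtype.val (hψ ⟨t, ht.1⟩ ht.2)⟩
  rw [hψs]
  ext y
  constructor
  · rintro ⟨t, ht, rfl⟩
    exact ⟨t, hmaps t ht, rfl⟩
  · rintro ⟨t, ht, rfl⟩
    exact ⟨⟨t, ht.1⟩, ht.2, rfl⟩

end Arcs

/-! ### Prolongation of arcs and components with boundary -/

section Reach

open Set Filter

variable {M : Type*} [TopologicalSpace M]

/-- `γ` restricts to an injective path on `[0, b]`. -/
structure IsArc (γ : ℝ → M) (b : ℝ) : Prop where
  nonneg : 0 ≤ b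
  continuousOn : ContinuousOn γ (Icc 0 b)
  injOn : InjOn γ (Icc 0 b)

namespace IsArc

variable {γ α : ℝ → M} {b c : ℝ}

theorem restrict (h : IsArc γ b) {t : ℝ} (h0 : 0 ≤ t) (ht : t ≤ b) : IsArc γ t :=
  ⟨h0, h.continuousOn.mono (Icc_subset_Icc_right ht), h.injOn.mono (Icc_subset_Icc_right ht)⟩

theorem shift (h : IsArc γ b) {s : ℝ} (h0 : 0 ≤ s) (hs : s ≤ b) :
    IsArc (fun u => γ (s + u)) (b - s) := by
  have hm : ∀ u ∈ Icc 0 (b - s), s + u ∈ Icc 0 b := fun u hu =>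
    ⟨by linarith [hu.1], by linarith [hu.2]⟩
  refine ⟨by linarith, h.continuousOn.comp (by fun_prop) hm, fun u hu v hv huv => ?_⟩
  simpa using h.injOn (hm u hu) (hm v hv) huv

theorem reverse (h : IsArc γ b) : IsArc (fun u => γ (b - u)) b := by
  have hm : ∀ u ∈ Icc 0 b, b - u ∈ Icc 0 b := fun u hu =>
    ⟨by linarith [hu.2], by linarith [hu.1]⟩
  refine ⟨h.nonneg, h.continuousOn.comp (by fun_prop) hm, fun u hu v hv huv => ?_⟩
  simpa using h.injOn (hm u hu) (hm v hv) huv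

theorem continuousOn_concat {γ α : ℝ → M} {b c : ℝ} (hγ : ContinuousOn γ (Icc 0 b))
    (hα : ContinuousOn α (Icc 0 c)) (h : γ b = α 0) :
    ContinuousOn (fun u => if u ≤ b then γ u else α (u - b)) (Icc 0 (b + c)) := by
  have h1 : ContinuousOn (fun u => if u ≤ b then γ u else α (u - b)) (Icc 0 b) :=
    hγ.congr fun u hu => if_pos hu.2
  have h2 : ContinuousOn (fun u => if u ≤ b then γ u else α (u - b)) (Icc b (b + c)) := by
    have : ContinuousOn (fun u => α (u - b)) (Icc b (b + c)) :=
      hα.comp (by fun_prop) fun u hu => ⟨by linarith [hu.1], by linarith [hu.2]⟩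
    refine this.congr fun u hu => ?_
    by_cases hub : u ≤ b
    · obtain rfl : u = b := le_antisymm hub hu.1
      simp [h]
    · simp [hub]
  refine (h1.union_of_isClosed h2 isClosed_Icc isClosed_Icc).mono fun u hu => ?_
  rcases le_total u b with hub | hub
  · exact Or.inl ⟨hu.1, hub⟩
  · exact Or.inr ⟨hub, hu.2⟩

/-- A parameter beyond b belongs to a positive parameter of α, and `hd` says that such points are
not on γ; so injectivity cannot fail across the joint. -/
theorem concat (hγ : IsArc γ b) (hα : IsArc α c) (h : γ b = α 0)
    (hd : ∀ t ∈ Icc 0 b, ∀ s ∈ Icc 0 c, γ t = α s → s = 0) :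
    IsArc (fun u => if u ≤ b then γ u else α (u - b)) (b + c) := by
  refine ⟨add_nonneg hγ.nonneg hα.nonneg, continuousOn_concat hγ.continuousOn hα.continuousOn h,
    ?_⟩
  have key : ∀ u ∈ Icc 0 (b + c), ∀ v ∈ Icc 0 (b + c), u ≤ b → ¬ v ≤ b → γ u ≠ α (v - b) := by
    intro u hu v hv hub hvb huv
    have := hd u ⟨hu.1, hub⟩ (v - b) ⟨by linarith, by linarith [hv.2]⟩ huv
    linarith
  intro u hu v hv huv
  by_cases hub : u ≤ b <;> by_cases hvb : v ≤ b <;> simp only [hub, hvb, if_true, if_false] at huv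
  · exact hγ.injOn ⟨hu.1, hub⟩ ⟨hv.1, hvb⟩ huv
  · exact absurd huv (key u hu v hv hub hvb)
  · exact absurd huv.symm (key v hv u hu hvb hub)
  · have := hα.injOn ⟨by linarith, by linarith [hu.2]⟩ ⟨by linarith, by linarith [hv.2]⟩ huv
    linarith

theorem isCompact_image (h : IsArc γ b) : IsCompact (γ '' Icc 0 b) :=
  isCompact_Icc.image_of_continuousOn h.continuousOn

theorem isPreconnected_image (h : IsArc γ b) : IsPreconnected (γ '' Icc 0 b) :=
  isPreconnected_Icc.image γ h.continuousOn

/-- Only the far end can spoil openness: at the starting boundary point the one-sided invariance of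
domain applies, at later points the two-sided one. -/
theorem isOpen_image_Ico (hM : LocallyHalfLine M) (h : IsArc γ b) (h0 : IsBoundaryPoint (γ 0)) :
    IsOpen (γ '' Ico 0 b) := by
  rw [isOpen_iff_mem_nhds]
  rintro _ ⟨t, ht, rfl⟩
  rcases eq_or_lt_of_le ht.1 with rfl | ht0
  · exact h0.image_mem_nhds ht.2 (h.continuousOn.mono Ico_subset_Icc_self)
      (h.injOn.mono Ico_subset_Icc_self)
  · exact mem_of_superset (hM.image_mem_nhds (Ioo_mem_nhds ht0 ht.2)
      (h.continuousOn.mono Ioo_subset_Icc_self) (h.injOn.mono Ioo_subset_Icc_self))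
      (image_mono Ioo_subset_Ico_self)

end IsArc

/-- There is an arc from `x` to `z`. -/
def ArcReaches (x z : M) : Prop := ∃ (γ : ℝ → M) (b : ℝ), IsArc γ b ∧ γ 0 = x ∧ γ b = z

theorem ArcReaches.symm {x z : M} (h : ArcReaches x z) : ArcReaches z x := by
  obtain ⟨γ, b, h, rfl, rfl⟩ := h
  exact ⟨_, b, h.reverse, by simp, by simp⟩

/-- The two arcs may cross, so concatenation must be preceded by cutting. At the last parameter s
where the second arc meets the first, the first is left and the rest of the second is followed. -/
theorem ArcReaches.trans [T2Space M] {x w z : M} (h : ArcReaches x w) (h' : ArcReaches w z) :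
    ArcReaches x z := by
  obtain ⟨γ, b, hγ, rfl, rfl⟩ := h
  obtain ⟨α, c, hα, h0, rfl⟩ := h'
  set S := Icc 0 c ∩ α ⁻¹' (γ '' Icc 0 b) with hS
  have hSc : IsCompact S := isCompact_Icc.of_isClosed_subset
    (hα.continuousOn.preimage_isClosed_of_isClosed isClosed_Icc hγ.isCompact_image.isClosed)
    inter_subset_left
  have hne : S.Nonempty :=
    ⟨0, ⟨le_rfl, hα.nonneg⟩, by rw [mem_preimage, h0]; exact ⟨b, ⟨hγ.nonneg, le_rfl⟩, rfl⟩⟩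
  obtain ⟨s, ⟨hs, t, ht, hts⟩, hmax⟩ := hSc.exists_isGreatest hne
  have harc := (hγ.restrict ht.1 ht.2).concat (hα.shift hs.1 hs.2) (by simpa using hts) ?_
  · refine ⟨_, _, harc, ?_, ?_⟩
    · simp [ht.1]
    · by_cases hc : c ≤ s
      · obtain rfl : s = c := le_antisymm hs.2 hc
        simp [hts]
      · simp [hc]
  · intro t' ht' u hu htu
    have := @hmax (s + u) ⟨⟨by linarith [hs.1, hu.1], by linarith [hu.2]⟩, t',
      ⟨ht'.1, ht'.2.trans ht.2⟩, htu⟩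
    linarith [hu.1]

theorem LocallyHalfLine.eventually_arcReaches (hM : LocallyHalfLine M) (z : M) :
    ∀ᶠ w in 𝓝 z, ArcReaches w z := by
  obtain ⟨φ, hs⟩ := hM z
  have hmem : toHalfLine ⁻¹' φ.target ∈ 𝓝 (φ z : ℝ) := by
    apply continuous_toHalfLine.continuousAt
    rw [toHalfLine_coe]
    exact φ.open_target.mem_nhds (φ.map_source hs)
  obtain ⟨ε, hε, h⟩ := exists_Icc_subset_of_mem_nhds hmem
  have hφ : ContinuousAt (fun y => (φ y : ℝ)) z :=
    continuous_subtype_val.continuousAt.comp (φ.continuousAt hs)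
  have hn : Icc ((φ z : ℝ) - ε) (φ z + ε) ∈ 𝓝 (φ z : ℝ) :=
    Icc_mem_nhds (by linarith) (by linarith)
  filter_upwards [hφ hn, φ.open_source.mem_nhds hs] with w hw hws
  have hw : (φ w : ℝ) ∈ Icc ((φ z : ℝ) - ε) (φ z + ε) := hw
  -- The sign σ is the direction in which the chart coordinate moves from w to z along a straight
  -- segment.
  have key : ∀ σ : ℝ, σ ≠ 0 → ∀ c, 0 ≤ c → (φ w : ℝ) + σ * c = φ z →
      (∀ u ∈ Icc 0 c, (φ w : ℝ) + σ * u ∈ Icc ((φ z : ℝ) - ε) (φ z + ε) ∧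
        0 ≤ (φ w : ℝ) + σ * u) → ArcReaches w z := by
    intro σ hσ c hc hcz hm
    refine ⟨fun u => φ.symm (toHalfLine (φ w + σ * u)), c, ⟨hc, ?_, ?_⟩, ?_, ?_⟩
    · exact φ.continuousOn_symm.comp (by fun_prop) fun u hu => h (hm u hu).1
    · intro u hu v hv huv
      have := congrArg Subtype.val (φ.symm.injOn (h (hm u hu).1) (h (hm v hv).1) huv)
      rw [coe_toHalfLine (hm u hu).2, coe_toHalfLine (hm v hv).2] at this
      exact mul_left_cancel₀ hσ (add_left_cancel this)
    · simp only [mul_zero, add_zero]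
      rw [toHalfLine_coe, φ.left_inv hws]
    · simp only [hcz]
      rw [toHalfLine_coe, φ.left_inv hs]
  have hz0 : (0 : ℝ) ≤ φ z := (φ z).2
  have hw0 : (0 : ℝ) ≤ φ w := (φ w).2
  rcases le_total (φ w : ℝ) (φ z) with hle | hle
  · refine key 1 one_ne_zero (φ z - φ w) (by linarith) (by ring) fun u hu => ?_
    exact ⟨⟨by linarith [hu.1, hw.1], by linarith [hu.2]⟩, by linarith [hu.1]⟩
  · refine key (-1) (by norm_num) (φ w - φ z) (by linarith) (by ring) fun u hu => ?_
    exact ⟨⟨by linarith [hu.2], by linarith [hu.1, hw.2]⟩, by linarith [hu.2]⟩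

/-- Being reachable from x is an open and closed condition, since nearby points reach each other and
reachability is symmetric and transitive. -/
theorem LocallyHalfLine.arcReaches_of_mem_connectedComponent [T2Space M]
    (hM : LocallyHalfLine M) {x z : M} (hz : z ∈ connectedComponent x) : ArcReaches x z := by
  have hclopen : IsClopen {z | ArcReaches x z} := by
    refine ⟨isClosed_iff_frequently.2 fun z hz => ?_, isOpen_iff_mem_nhds.2 fun z hz => ?_⟩
    · obtain ⟨w, hw, hwz⟩ := (hz.and_eventually (hM.eventually_arcReaches z)).exists
      exact ArcReaches.trans hw hwz
    · filter_upwards [hM.eventually_arcReaches z] with w hw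
      exact ArcReaches.trans hz hw.symm
  exact hclopen.connectedComponent_subset
    ⟨fun _ => x, 0, ⟨le_rfl, continuousOn_const, by simp⟩, rfl, rfl⟩ hz

/-- Arcs starting at the same boundary point are nested. -/
theorem IsArc.subset_or_subset [T2Space M] (hM : LocallyHalfLine M) {γ γ' : ℝ → M} {b b' : ℝ}
    (h : IsArc γ b) (h' : IsArc γ' b') (h0 : IsBoundaryPoint (γ 0)) (h00 : γ 0 = γ' 0) :
    γ '' Icc 0 b ⊆ γ' '' Icc 0 b' ∨ γ' '' Icc 0 b' ⊆ γ '' Icc 0 b := by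
  -- The point γ t separates: removing it leaves the open set γ[0, t) and the complement of the
  -- closed set γ[0, t]. The connected image of γ' avoids γ t and starts in the first set, so it
  -- stays there.
  have key : ∀ t ∈ Icc 0 b, γ t ∉ γ' '' Icc 0 b' → γ' '' Icc 0 b' ⊆ γ '' Ico 0 t := by
    intro t ht hnt
    have htpos : 0 < t := by
      refine lt_of_le_of_ne ht.1 ?_
      rintro rfl
      exact hnt ⟨0, ⟨le_rfl, h'.nonneg⟩, h00.symm⟩
    have hr := h.restrict ht.1 ht.2
    refine h'.isPreconnected_image.subset_left_of_subset_union (hr.isOpen_image_Ico hM h0)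
      hr.isCompact_image.isClosed.isOpen_compl
      (disjoint_compl_right.mono_left (image_mono Ico_subset_Icc_self)) ?_ ?_
    · rintro _ hy
      by_contra hcon
      simp only [mem_union, not_or, mem_compl_iff, not_not] at hcon
      obtain ⟨hcon, s, hs, rfl⟩ := hcon
      rcases eq_or_lt_of_le hs.2 with rfl | hlt
      · exact hnt hy
      · exact hcon ⟨s, ⟨hs.1, hlt⟩, rfl⟩
    · exact ⟨γ 0, ⟨0, ⟨le_rfl, h'.nonneg⟩, h00.symm⟩, 0, ⟨le_rfl, htpos⟩, rfl⟩
  by_cases hsub : γ '' Icc 0 b ⊆ γ' '' Icc 0 b'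
  · exact Or.inl hsub
  · rw [not_subset] at hsub
    obtain ⟨_, ⟨t, ht, rfl⟩, hnt⟩ := hsub
    exact Or.inr ((key t ht hnt).trans (image_mono fun s hs => ⟨hs.1, hs.2.le.trans ht.2⟩))

/-- An arc that ends in the interior can be prolonged. -/
theorem IsArc.exists_prolongation [T2Space M] (hM : LocallyHalfLine M) {γ : ℝ → M} {b : ℝ}
    (h : IsArc γ b) (hb : b = 0 ∨ ¬ IsBoundaryPoint (γ b)) :
    ∃ (γ' : ℝ → M) (b' : ℝ), b < b' ∧ IsArc γ' b' ∧ EqOn γ' γ (Icc 0 b) := by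
  -- It is enough to find a short arc that starts at the end of γ and does not meet γ again.
  suffices hs : ∃ (α : ℝ → M) (δ : ℝ), 0 < δ ∧ IsArc α δ ∧ γ b = α 0 ∧
      ∀ t ∈ Icc 0 b, ∀ s ∈ Icc 0 δ, γ t = α s → s = 0 by
    obtain ⟨α, δ, hδ, hα, h0, hd⟩ := hs
    exact ⟨_, b + δ, by linarith, h.concat hα h0 hd, fun u hu => if_pos hu.2⟩
  by_cases hbd : IsBoundaryPoint (γ b)
  · obtain rfl : b = 0 := by tauto
    obtain ⟨α, hαc, hαi, hα0⟩ := hbd.exists_arc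
    refine ⟨α, 1, one_pos, ⟨zero_le_one, hαc, hαi⟩, hα0.symm, fun t ht s hs hts => ?_⟩
    obtain rfl : t = 0 := le_antisymm ht.2 ht.1
    exact (hαi ⟨le_rfl, zero_le_one⟩ hs (hα0.trans hts)).symm
  rcases eq_or_lt_of_le h.nonneg with rfl | hbpos
  · obtain ⟨α, hαc, hαi, hα0⟩ := hM.exists_arc hbd
    have hsub : Icc (0 : ℝ) 1 ⊆ Ioo (-2) 2 := fun s hs => ⟨by linarith [hs.1], by linarith [hs.2]⟩
    refine ⟨α, 1, one_pos, ⟨zero_le_one, hαc.mono hsub, hαi.mono hsub⟩, hα0.symm,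
      fun t ht s hs hts => ?_⟩
    obtain rfl : t = 0 := le_antisymm ht.2 ht.1
    exact (hαi (by norm_num) (hsub hs) (hα0.trans hts)).symm
  obtain ⟨α, hαc, hαi, hα0⟩ := hM.exists_arc hbd
  obtain ⟨ψ, hψs, hψt, hψ, hψsymm⟩ := hM.exists_chart isOpen_Ioo hαc hαi
  have hsrc : γ b ∈ ψ.source := by rw [hψs]; exact ⟨0, by norm_num, hα0⟩
  have hψb : ψ (γ b) = 0 := by rw [← hα0]; exact hψ 0 (by norm_num)
  have hV : γ ⁻¹' ψ.source ∈ 𝓝[Icc 0 b] b :=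
    h.continuousOn b ⟨hbpos.le, le_rfl⟩ (ψ.open_source.mem_nhds hsrc)
  rw [nhdsWithin_Icc_eq_nhdsLE hbpos, mem_nhdsLE_iff_exists_Icc_subset] at hV
  obtain ⟨d, hd, hdV⟩ := hV
  have hd : d < b := hd
  set e := max d 0 with he
  have he0 : 0 ≤ e := le_max_right _ _
  have heb : e < b := max_lt hd hbpos
  have heV : Icc e b ⊆ γ ⁻¹' ψ.source := (Icc_subset_Icc_left (le_max_left _ _)).trans hdV
  have hsub : Icc e b ⊆ Icc 0 b := Icc_subset_Icc_left he0
  have hcf : ContinuousOn (fun s => ψ (γ s)) (Icc e b) :=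
    ψ.continuousOn.comp (h.continuousOn.mono hsub) heV
  have hif : InjOn (fun s => ψ (γ s)) (Icc e b) := fun s hs t ht hst =>
    h.injOn (hsub hs) (hsub ht) (ψ.injOn (heV hs) (heV ht) hst)
  -- In the chart around γ b the path arrives at 0 monotonically; σ is chosen so that it arrives
  -- from the negative side. The continuation is the positive side, hence disjoint from the last
  -- piece of γ.
  obtain ⟨σ, hσ, hσneg⟩ : ∃ σ : ℝ, (σ = 1 ∨ σ = -1) ∧ ∀ t ∈ Ico e b, σ * ψ (γ t) < 0 := by
    rcases hcf.strictMonoOn_of_injOn_Icc' heb.le hif with hm | hm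
    · refine ⟨1, Or.inl rfl, fun t ht => ?_⟩
      have := hm ⟨ht.1, ht.2.le⟩ ⟨heb.le, le_rfl⟩ ht.2
      simp only [hψb] at this
      linarith
    · refine ⟨-1, Or.inr rfl, fun t ht => ?_⟩
      have := hm ⟨ht.1, ht.2.le⟩ ⟨heb.le, le_rfl⟩ ht.2
      simp only [hψb] at this
      linarith
  have hσσ : σ * σ = 1 := by rcases hσ with rfl | rfl <;> norm_num
  have hmaps : ∀ s ∈ Ioo (-2 : ℝ) 2, σ * s ∈ Ioo (-2 : ℝ) 2 := by
    intro s hs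
    rcases hσ with rfl | rfl
    · simpa using hs
    · exact ⟨by linarith [hs.2], by linarith [hs.1]⟩
  have hβc : ContinuousOn (fun s => α (σ * s)) (Ioo (-2) 2) := hαc.comp (by fun_prop) hmaps
  have hβi : InjOn (fun s => α (σ * s)) (Ioo (-2) 2) := fun s hs t ht hst => by
    have := hαi (hmaps s hs) (hmaps t ht) hst
    calc s = σ * (σ * s) := by rw [← mul_assoc, hσσ, one_mul]
      _ = σ * (σ * t) := by rw [this]
      _ = t := by rw [← mul_assoc, hσσ, one_mul]
  have hcl : IsClosed (γ '' Icc 0 e) := (h.restrict he0 heb.le).isCompact_image.isClosed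
  have hnot : γ b ∉ γ '' Icc 0 e := by
    rintro ⟨t, ht, htb⟩
    have := h.injOn ⟨ht.1, ht.2.trans heb.le⟩ ⟨hbpos.le, le_rfl⟩ htb
    linarith [ht.2]
  have hβ0 : γ b = α (σ * 0) := by rw [mul_zero, hα0]
  have hcont : ContinuousAt (fun s => α (σ * s)) 0 :=
    hβc.continuousAt (Ioo_mem_nhds (by norm_num) (by norm_num))
  -- The earlier piece γ[0, e] is compact and misses γ b, so a sufficiently short continuation
  -- avoids it too.
  have hnear : (fun s => α (σ * s)) ⁻¹' (γ '' Icc 0 e)ᶜ ∈ 𝓝 (0 : ℝ) :=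
    hcont (hcl.isOpen_compl.mem_nhds (by simp only [mul_zero, hα0]; exact hnot))
  obtain ⟨ε, hε, hεs⟩ := exists_Icc_subset_of_mem_nhds hnear
  have hδ2 : Icc 0 (min ε 1) ⊆ Ioo (-2) 2 := fun s hs =>
    ⟨by linarith [hs.1], by linarith [hs.2.trans (min_le_right _ _)]⟩
  refine ⟨fun s => α (σ * s), min ε 1, lt_min hε one_pos,
    ⟨(lt_min hε one_pos).le, hβc.mono hδ2, hβi.mono hδ2⟩, hβ0, fun t ht s hs hts => ?_⟩
  simp only at hts
  have hte : e < t := by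
    by_contra hcon
    exact hεs (show s ∈ _ from ⟨by linarith [hs.1], by linarith [hs.2.trans (min_le_left _ _)]⟩)
      ⟨t, ⟨ht.1, not_lt.1 hcon⟩, hts⟩
  have hψβ : ψ (γ t) = σ * s := by rw [hts]; exact hψ _ (hmaps s (hδ2 hs))
  rcases eq_or_lt_of_le ht.2 with rfl | htb
  · rw [hψb] at hψβ
    calc s = σ * (σ * s) := by rw [← mul_assoc, hσσ, one_mul]
      _ = 0 := by rw [← hψβ, mul_zero]
  · have := hσneg t ⟨hte.le, htb⟩
    rw [hψβ, ← mul_assoc, hσσ, one_mul] at this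
    linarith [hs.1]

/-- From a boundary point of a compact manifold, an arc leads to another boundary point. -/
theorem IsBoundaryPoint.exists_arc_to_boundary [T2Space M] [CompactSpace M]
    (hM : LocallyHalfLine M) {x : M} (hx : IsBoundaryPoint x) :
    ∃ (γ : ℝ → M) (b : ℝ), 0 < b ∧ IsArc γ b ∧ γ 0 = x ∧ IsBoundaryPoint (γ b) := by
  by_contra hcon
  push Not at hcon
  -- If no arc from x ended at another boundary point, every arc from x could be prolonged. The
  -- half-open arcs would then be open, nested and cover the compact component, so a single one
  -- would cover it; but a half-open arc misses its own end.
  let ι := {a : (ℝ → M) × ℝ // IsArc a.1 a.2 ∧ a.1 0 = x}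
  let O : ι → Set M := fun a => a.1.1 '' Ico 0 a.1.2
  have hext : ∀ a : ι, ∃ a' : ι, a.1.1 '' Icc 0 a.1.2 ⊆ O a' := by
    rintro ⟨⟨γ, b⟩, h, h0⟩
    have hb : b = 0 ∨ ¬ IsBoundaryPoint (γ b) := by
      rcases eq_or_lt_of_le h.nonneg with hb | hb
      · exact Or.inl hb.symm
      · exact Or.inr (hcon γ b hb h h0)
    obtain ⟨γ', b', hbb, h', he⟩ := h.exists_prolongation hM hb
    refine ⟨⟨⟨γ', b'⟩, h', (he ⟨le_rfl, h.nonneg⟩).trans h0⟩, ?_⟩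
    rintro _ ⟨t, ht, rfl⟩
    exact ⟨t, ⟨ht.1, ht.2.trans_lt hbb⟩, he ht⟩
  have hne : Nonempty ι := ⟨⟨⟨fun _ => x, 0⟩, ⟨le_rfl, continuousOn_const, by simp⟩, rfl⟩⟩
  have hcover : connectedComponent x ⊆ ⋃ a, O a := by
    intro z hz
    obtain ⟨γ, b, h, h0, hb⟩ := hM.arcReaches_of_mem_connectedComponent hz
    obtain ⟨a, ha⟩ := hext ⟨⟨γ, b⟩, h, h0⟩
    exact mem_iUnion.2 ⟨a, ha ⟨b, ⟨h.nonneg, le_rfl⟩, hb⟩⟩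
  have hdir : Directed (· ⊆ ·) O := by
    intro a a'
    obtain ⟨c, hc⟩ := hext a
    obtain ⟨c', hc'⟩ := hext a'
    have h1 : O a ⊆ a.1.1 '' Icc 0 a.1.2 := image_mono Ico_subset_Icc_self
    have h2 : O a' ⊆ a'.1.1 '' Icc 0 a'.1.2 := image_mono Ico_subset_Icc_self
    rcases a.2.1.subset_or_subset hM a'.2.1 (by rw [a.2.2]; exact hx)
      (a.2.2.trans a'.2.2.symm) with hs | hs
    · exact ⟨c', h1.trans (hs.trans hc'), h2.trans hc'⟩
    · exact ⟨c, h1.trans hc, h2.trans (hs.trans hc)⟩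
  obtain ⟨⟨⟨γ, b⟩, h, h0⟩, hi⟩ := isClosed_connectedComponent.isCompact.elim_directed_cover
    (s := connectedComponent x) O (fun a => a.2.1.isOpen_image_Ico hM (by rw [a.2.2]; exact hx))
    hcover hdir
  have hmem : γ b ∈ connectedComponent x :=
    h.isPreconnected_image.subset_connectedComponent ⟨0, ⟨le_rfl, h.nonneg⟩, h0⟩
      ⟨b, ⟨h.nonneg, le_rfl⟩, rfl⟩
  obtain ⟨t, ht, htb⟩ := hi hmem
  have := h.injOn ⟨ht.1, ht.2.le⟩ ⟨h.nonneg, le_rfl⟩ htb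
  simp only at ht
  linarith [ht.2]

/-- The image of an arc between boundary points is a component. -/
theorem IsArc.image_eq_connectedComponent [T2Space M] (hM : LocallyHalfLine M) {γ : ℝ → M} {b : ℝ}
    (hb : 0 < b) (h : IsArc γ b) (h0 : IsBoundaryPoint (γ 0)) (h1 : IsBoundaryPoint (γ b)) :
    IsClopen (γ '' Icc 0 b) ∧ γ '' Icc 0 b = connectedComponent (γ 0) := by
  have hmem : γ 0 ∈ γ '' Icc 0 b := ⟨0, ⟨le_rfl, h.nonneg⟩, rfl⟩
  have hop : IsOpen (γ '' Icc 0 b) := by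
    have h2 := h.isOpen_image_Ico hM h0
    have h3 := h.reverse.isOpen_image_Ico hM (by simpa using h1)
    convert h2.union h3 using 1
    ext y
    constructor
    · rintro ⟨t, ht, rfl⟩
      rcases eq_or_lt_of_le ht.2 with rfl | htb
      · exact Or.inr ⟨0, ⟨le_rfl, hb⟩, by simp⟩
      · exact Or.inl ⟨t, ⟨ht.1, htb⟩, rfl⟩
    · rintro (⟨t, ht, rfl⟩ | ⟨t, ht, rfl⟩)
      · exact ⟨t, ⟨ht.1, ht.2.le⟩, rfl⟩
      · exact ⟨b - t, ⟨by linarith [ht.2], by linarith [ht.1]⟩, rfl⟩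
  have hcl : IsClopen (γ '' Icc 0 b) := ⟨h.isCompact_image.isClosed, hop⟩
  exact ⟨hcl, (h.isPreconnected_image.subset_connectedComponent hmem).antisymm
    (hcl.connectedComponent_subset hmem)⟩

end Reach

/-! ### Components without boundary are circles -/

section Circles

open Set Filter

variable {M : Type*} [TopologicalSpace M]

/-- A parametrization with values in S is inverted inside the subspace S. The point z only serves as
a value of g where k leaves S, which does not happen on V. -/
theorem exists_subtype_chart {H : Type*} [TopologicalSpace H] [Nonempty H] {S : Set M} (z : S)
    {k : H → M} {V : Set H} (hV : IsOpen V) (hc : ContinuousOn k V) (hi : InjOn k V)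
    (hS : ∀ t ∈ V, k t ∈ S) (ho : ∀ t ∈ V, ∀ U ∈ 𝓝 t, U ⊆ V → k '' U ∈ 𝓝[S] (k t)) :
    ∃ φ : OpenPartialHomeomorph S H, (∀ w : S, (w : M) ∈ k '' V → w ∈ φ.source) ∧
      ∀ w : S, ∀ t ∈ V, k t = w → φ w = t := by
  classical
  let g : H → S := fun t => if h : k t ∈ S then ⟨k t, h⟩ else z
  have hg : ∀ t ∈ V, (g t : M) = k t := fun t ht => by simp [g, hS t ht]
  obtain ⟨φ, hφs, -, hφ, -⟩ := exists_openPartialHomeomorph_of_image_mem_nhds (g := g) hV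
    (Topology.IsInducing.subtypeVal.continuousOn_iff.2 (hc.congr hg))
    (fun s hs t ht hst => hi hs ht (by rw [← hg s hs, ← hg t ht, hst]))
    (fun t ht U hU hUV => by
      have := ho t ht U hU hUV
      rw [← hg t ht, ← preimage_coe_mem_nhds_subtype] at this
      refine mem_of_superset this ?_
      rintro w ⟨s, hs, hsw⟩
      exact ⟨s, hs, Subtype.ext ((hg s (hUV hs)).trans hsw)⟩)
  refine ⟨φ, ?_, ?_⟩
  · rintro w ⟨t, ht, htw⟩
    rw [hφs]
    exact ⟨t, ht, Subtype.ext ((hg t ht).trans htw)⟩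
  · intro w t ht htw
    have : g t = w := Subtype.ext ((hg t ht).trans htw)
    rw [← this, hφ t ht]

/-- Near z the set S is the half line from ψ z onwards, and translation by ψ z moves its end to 0.
-/
theorem exists_halfLine_chart_of_mem_iff_le {S : Set M} {z : S} (ψ : OpenPartialHomeomorph M ℝ)
    (hz : (z : M) ∈ ψ.source) (hS : ∀ w ∈ ψ.source, w ∈ S ↔ ψ z ≤ ψ w) :
    IsBoundaryPoint z := by
  have hVo : IsOpen {t : HalfLine | ψ z + t ∈ ψ.target} :=
    ψ.open_target.preimage (by fun_prop : Continuous fun t : HalfLine => ψ z + (t : ℝ))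
  obtain ⟨φ, hφs, hφ⟩ := exists_subtype_chart z (k := fun t : HalfLine => ψ.symm (ψ z + t)) hVo
    (ψ.continuousOn_symm.comp (by fun_prop) fun t ht => ht)
    (fun s hs t ht hst => Subtype.ext (by simpa using ψ.symm.injOn hs ht hst))
    (fun t ht => by
      rw [hS _ (ψ.map_target ht), ψ.right_inv ht]
      linarith [show (0 : ℝ) ≤ t from t.2])
    (fun t ht U hU hUV => by
      have hmem : ψ.symm (ψ z + t) ∈ ψ.source := ψ.map_target ht
      have hcont : ContinuousAt (fun w => toHalfLine (ψ w - ψ z)) (ψ.symm (ψ z + t)) :=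
        continuous_toHalfLine.continuousAt.comp ((ψ.continuousAt hmem).sub continuousAt_const)
      have hval : toHalfLine (ψ (ψ.symm (ψ z + t)) - ψ z) = t := by
        rw [ψ.right_inv ht, add_sub_cancel_left, toHalfLine_coe]
      have h1 := hcont.eventually_mem (by rw [hval]; exact hU)
      filter_upwards [mem_nhdsWithin_of_mem_nhds h1,
        mem_nhdsWithin_of_mem_nhds (ψ.open_source.mem_nhds hmem), self_mem_nhdsWithin]
        with w hw hws hwS
      refine ⟨_, hw, ?_⟩
      have := (hS w hws).1 hwS
      simp only
      rw [coe_toHalfLine (by linarith), add_sub_cancel, ψ.left_inv hws])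
  have h0 : (ψ z + ((⟨0, self_mem_Ici⟩ : HalfLine) : ℝ)) = ψ z := by simp
  have h0' : (⟨0, self_mem_Ici⟩ : HalfLine) ∈ {t : HalfLine | ψ z + t ∈ ψ.target} := by
    change ψ z + ((⟨0, self_mem_Ici⟩ : HalfLine) : ℝ) ∈ ψ.target
    rw [h0]; exact ψ.map_source hz
  have h0'' : ψ.symm (ψ z + ((⟨0, self_mem_Ici⟩ : HalfLine) : ℝ)) = z := by rw [h0, ψ.left_inv hz]
  exact ⟨φ, hφs z ⟨_, h0', h0''⟩, congrArg Subtype.val (hφ z _ h0' h0'')⟩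

theorem LocallyHalfLine.exists_subtype_chart (hM : LocallyHalfLine M) {S : Set M} {z : S}
    (hS : S ∈ 𝓝 (z : M)) : ∃ φ : OpenPartialHomeomorph S HalfLine, z ∈ φ.source := by
  obtain ⟨φ, hz⟩ := hM z
  set χ := φ.restr (interior S)
  have hχs : χ.source = φ.source ∩ interior S := φ.restr_source' _ isOpen_interior
  obtain ⟨φ', hφ', -⟩ := _root_.exists_subtype_chart z (k := χ.symm) χ.open_target
    χ.continuousOn_symm χ.symm.injOn
    (fun t ht => by
      have := χ.map_target ht
      rw [hχs] at this
      exact interior_subset this.2)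
    (fun t ht U hU hUV => mem_nhdsWithin_of_mem_nhds (by
      have := χ.symm.image_mem_nhds ht hU
      exact this))
  have hzχ : (z : M) ∈ χ.source := by rw [hχs]; exact ⟨hz, mem_interior_iff_mem_nhds.2 hS⟩
  exact ⟨φ', hφ' z ⟨χ z, χ.map_source hzχ, χ.left_inv hzχ⟩⟩

theorem injOn_comp_addCircle {M : Type*} {e : AddCircle (1 : ℝ) → M}
    (hi : Function.Injective e) (a : ℝ) :
    InjOn (fun t : ℝ => e t) (Ico a (a + 1)) := fun _ hs _ ht hst =>
  (AddCircle.coe_eq_coe_iff_of_mem_Ico hs ht).1 (hi hst)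

/-- Closed by compactness. Open because the open interval of length 1 around a parameter lies in a
fundamental domain, where the path is injective and invariance of domain applies. -/
theorem LocallyHalfLine.isClopen_range_addCircle [T2Space M] (hM : LocallyHalfLine M)
    {e : AddCircle (1 : ℝ) → M} (hc : Continuous e) (hi : Function.Injective e) :
    IsClopen (range e) := by
  refine ⟨(isCompact_range hc).isClosed, isOpen_iff_mem_nhds.2 ?_⟩
  rintro _ ⟨t, rfl⟩
  obtain ⟨t, rfl⟩ := QuotientAddGroup.mk_surjective t
  have hsub : Ioo (t - 1 / 2) (t + 1 / 2) ⊆ Ico (t - 1 / 2) (t - 1 / 2 + 1) := fun s hs =>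
    ⟨hs.1.le, by linarith [hs.2]⟩
  have := hM.image_mem_nhds (γ := fun t : ℝ => e t) (t := t)
    (Ioo_mem_nhds (a := t - 1 / 2) (b := t + 1 / 2) (by linarith) (by linarith))
    (hc.comp (AddCircle.continuous_mk' 1)).continuousOn ((injOn_comp_addCircle hi _).mono hsub)
  refine mem_of_superset this ?_
  rintro _ ⟨s, -, rfl⟩
  exact ⟨s, rfl⟩

/-- Along the parameters in (0, 2) the complement of the removed arc is the part with t ≥ 1. The
other cut point is treated by applying this to the reversed path. -/
theorem isBoundaryPoint_compl_image_Ioo (hM : LocallyHalfLine M) {α : ℝ → M}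
    (hc : ContinuousOn α (Ioo (-2) 2)) (hi : InjOn α (Ioo (-2) 2))
    (z : ((α '' Ioo (-1) 1)ᶜ : Set M)) (hz : (z : M) = α 1) : IsBoundaryPoint z := by
  have hsub : Ioo (0 : ℝ) 2 ⊆ Ioo (-2) 2 := Ioo_subset_Ioo_left (by norm_num)
  obtain ⟨ψ, hψs, -, hψ, -⟩ := hM.exists_chart isOpen_Ioo (hc.mono hsub) (hi.mono hsub)
  refine exists_halfLine_chart_of_mem_iff_le ψ ?_ ?_
  · rw [hψs, hz]; exact ⟨1, by norm_num, rfl⟩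
  · intro w hw
    rw [hψs] at hw
    obtain ⟨t, ht, rfl⟩ := hw
    rw [hz, hψ 1 (by norm_num), hψ t ht]
    constructor
    · intro h
      by_contra hlt
      exact h ⟨t, ⟨by linarith [ht.1], not_le.1 hlt⟩, rfl⟩
    · rintro h ⟨s, hs, hst⟩
      have := hi ⟨by linarith [hs.1], by linarith [hs.2]⟩ (hsub ht) hst
      linarith [hs.2]

/-- A component without boundary points is a circle. -/
theorem LocallyHalfLine.exists_addCircle [T2Space M] [CompactSpace M] (hM : LocallyHalfLine M)
    {x : M} (hx : ∀ y ∈ connectedComponent x, ¬ IsBoundaryPoint y) :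
    ∃ e : AddCircle (1 : ℝ) → M, Continuous e ∧ Function.Injective e ∧
      range e = connectedComponent x := by
  obtain ⟨α, hαc, hαi, hα0⟩ := hM.exists_arc (hx x mem_connectedComponent)
  have hsub : Icc (-1 : ℝ) 1 ⊆ Ioo (-2) 2 := Icc_subset_Ioo (by norm_num) (by norm_num)
  have hsub' : Ioo (-1 : ℝ) 1 ⊆ Ioo (-2) 2 := Ioo_subset_Icc_self.trans hsub
  -- The open arc E around x is removed. The complement is a compact manifold on which the interval
  -- case can be used, the cut points α 1 and α (-1) being boundary points of it.
  set E := α '' Ioo (-1) 1 with hE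
  have hEo : IsOpen E := isOpen_iff_mem_nhds.2 (by
    rintro _ ⟨t, ht, rfl⟩
    exact hM.image_mem_nhds (Ioo_mem_nhds ht.1 ht.2) (hαc.mono hsub') (hαi.mono hsub'))
  have hcl : IsClosed (α '' Icc (-1) 1) :=
    (isCompact_Icc.image_of_continuousOn (hαc.mono hsub)).isClosed
  have hmem : ∀ t ∈ Ioo (-2 : ℝ) 2, α t ∈ E → t ∈ Ioo (-1 : ℝ) 1 := by
    rintro t ht ⟨s, hs, hst⟩
    rwa [← hαi (hsub' hs) ht hst]
  have h1 : α 1 ∈ Eᶜ := fun h => by have := hmem 1 (by norm_num) h; norm_num at this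
  have h1' : α (-1) ∈ Eᶜ := fun h => by have := hmem (-1) (by norm_num) h; norm_num at this
  have : CompactSpace (Eᶜ : Set M) := isCompact_iff_compactSpace.1 hEo.isClosed_compl.isCompact
  have hrev : (fun t => α (-t)) '' Ioo (-1) 1 = E := by
    ext y
    constructor
    · rintro ⟨t, ht, rfl⟩
      exact ⟨-t, ⟨by linarith [ht.2], by linarith [ht.1]⟩, rfl⟩
    · rintro ⟨t, ht, rfl⟩
      exact ⟨-t, ⟨by linarith [ht.2], by linarith [ht.1]⟩, by simp⟩
  have hneg : ∀ t ∈ Ioo (-2 : ℝ) 2, -t ∈ Ioo (-2 : ℝ) 2 := fun t ht =>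
    ⟨by linarith [ht.2], by linarith [ht.1]⟩
  have hb1 : ∀ z : (Eᶜ : Set M), (z : M) = α 1 → IsBoundaryPoint z := fun z hz =>
    isBoundaryPoint_compl_image_Ioo hM hαc hαi z hz
  have hb1' : ∀ z : (Eᶜ : Set M), (z : M) = α (-1) → IsBoundaryPoint z := by
    have := isBoundaryPoint_compl_image_Ioo hM (α := fun t => α (-t))
      (hαc.comp (by fun_prop) hneg)
      (fun s hs t ht hst => neg_injective (hαi (hneg s hs) (hneg t ht) hst))
    rwa [hrev] at this
  have hout : ∀ z : (Eᶜ : Set M), (z : M) ≠ α 1 → (z : M) ≠ α (-1) →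
      (z : M) ∈ (α '' Icc (-1) 1)ᶜ := by
    rintro z hz hz' ⟨t, ht, htz⟩
    rcases eq_or_lt_of_le ht.1 with rfl | hlt
    · exact hz' htz.symm
    rcases eq_or_lt_of_le ht.2 with rfl | hlt'
    · exact hz htz.symm
    exact z.2 ⟨t, ⟨hlt, hlt'⟩, htz⟩
  have hss : (α '' Icc (-1) 1)ᶜ ⊆ Eᶜ := compl_subset_compl.2 (image_mono Ioo_subset_Icc_self)
  have hM' : LocallyHalfLine (Eᶜ : Set M) := by
    intro z
    by_cases hz : (z : M) = α 1
    · obtain ⟨φ, hφ, -⟩ := hb1 z hz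
      exact ⟨φ, hφ⟩
    by_cases hz' : (z : M) = α (-1)
    · obtain ⟨φ, hφ, -⟩ := hb1' z hz'
      exact ⟨φ, hφ⟩
    exact hM.exists_subtype_chart
      (mem_of_superset (hcl.isOpen_compl.mem_nhds (hout z hz hz')) hss)
  obtain ⟨γ, b, hb, hγ, hγ0, hγb⟩ := (hb1 ⟨α 1, h1⟩ rfl).exists_arc_to_boundary hM'
  have hγ' : IsArc (fun t => (γ t : M)) b := ⟨hγ.nonneg,
    continuous_subtype_val.comp_continuousOn hγ.continuousOn,
    fun s hs t ht hst => hγ.injOn hs ht (Subtype.ext hst)⟩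
  have hαarc : IsPreconnected (α '' Icc (-1) 1) := isPreconnected_Icc.image α (hαc.mono hsub)
  have hα1 : α 1 ∈ connectedComponent x := hαarc.subset_connectedComponent
    ⟨0, by norm_num, hα0⟩ ⟨1, by norm_num, rfl⟩
  have hγcomp : ∀ t ∈ Icc 0 b, (γ t : M) ∈ connectedComponent x := by
    intro t ht
    rw [connectedComponent_eq hα1]
    exact hγ'.isPreconnected_image.subset_connectedComponent
      ⟨0, ⟨le_rfl, hb.le⟩, congrArg Subtype.val hγ0⟩ ⟨t, ht, rfl⟩
  -- The arc in the complement cannot return to its start. At any third point of the component the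
  -- complement is a neighbourhood in M, and a two-sided path through that point shows that it is
  -- not on the boundary of the complement.
  have hend : (γ b : M) = α (-1) := by
    by_contra hne
    have hne1 : (γ b : M) ≠ α 1 := by
      intro h
      have := hγ.injOn ⟨hb.le, le_rfl⟩ ⟨le_rfl, hb.le⟩ (Subtype.ext (h.trans (by rw [hγ0])))
      linarith
    obtain ⟨β, hβc, hβi, hβ0⟩ := hM.exists_arc (hx _ (hγcomp b ⟨hb.le, le_rfl⟩))
    have hnh : Ioo (-2) 2 ∩ β ⁻¹' (α '' Icc (-1) 1)ᶜ ∈ 𝓝 (0 : ℝ) := by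
      refine inter_mem (Ioo_mem_nhds (by norm_num) (by norm_num)) ?_
      refine (hβc.continuousAt (Ioo_mem_nhds (by norm_num) (by norm_num))).preimage_mem_nhds ?_
      rw [hβ0]
      exact hcl.isOpen_compl.mem_nhds (hout _ hne1 hne)
    classical
    let β' : ℝ → (Eᶜ : Set M) := fun t => if h : β t ∈ Eᶜ then ⟨β t, h⟩ else γ b
    have hβ' : ∀ t ∈ Ioo (-2) 2 ∩ β ⁻¹' (α '' Icc (-1) 1)ᶜ, (β' t : M) = β t := by
      intro t ht
      simp only [β', dif_pos (hss ht.2)]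
    refine not_isBoundaryPoint_of_injOn (γ := β') hnh
      (Topology.IsInducing.subtypeVal.continuousOn_iff.2
        ((hβc.mono inter_subset_left).congr hβ'))
      (fun s hs t ht hst => hβi hs.1 ht.1 (by rw [← hβ' s hs, ← hβ' t ht, hst])) ?_
    have : β' 0 = γ b := Subtype.ext ((hβ' 0 (mem_of_mem_nhds hnh)).trans hβ0)
    rwa [this]
  have hα2 : ∀ s ∈ Icc (0 : ℝ) 2, s - 1 ∈ Ioo (-2 : ℝ) 2 := fun s hs =>
    ⟨by linarith [hs.1], by linarith [hs.2]⟩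
  -- The loop runs along γ from α 1 to α (-1) during time b and then along the removed arc back to α
  -- 1 during time 2; the point x = α 0 is passed at time b + 1.
  set θ : ℝ → M := fun u => if u ≤ b then (γ u : M) else α (u - b - 1) with hθ
  have hθc : ContinuousOn θ (Icc 0 (b + 2)) :=
    IsArc.continuousOn_concat (γ := fun t => (γ t : M)) (α := fun s => α (s - 1))
      hγ'.continuousOn (hαc.comp (by fun_prop) hα2) (by simp [hend])
  have hθi : InjOn θ (Ico 0 (b + 2)) := by
    have key : ∀ u ∈ Ico 0 (b + 2), ∀ v ∈ Ico 0 (b + 2), u ≤ b → ¬ v ≤ b →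
        (γ u : M) ≠ α (v - b - 1) := by
      intro u hu v hv hub hvb huv
      refine (γ u).2 ⟨v - b - 1, ⟨by linarith, by linarith [hv.2]⟩, huv.symm⟩
    intro u hu v hv huv
    by_cases hub : u ≤ b <;> by_cases hvb : v ≤ b <;>
      simp only [hθ, hub, hvb, if_true, if_false] at huv
    · exact hγ'.injOn ⟨hu.1, hub⟩ ⟨hv.1, hvb⟩ huv
    · exact absurd huv (key u hu v hv hub hvb)
    · exact absurd huv.symm (key v hv u hu hvb hub)
    · have := hαi ⟨by linarith, by linarith [hu.2]⟩ ⟨by linarith, by linarith [hv.2]⟩ huv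
      linarith
  have hT : 0 < b + 2 := by linarith
  have hmaps : ∀ t ∈ Icc (0 : ℝ) 1, t * (b + 2) ∈ Icc 0 (b + 2) := fun t ht =>
    ⟨mul_nonneg ht.1 hT.le, by nlinarith [ht.2]⟩
  have hmaps' : ∀ t ∈ Ico (0 : ℝ) 1, t * (b + 2) ∈ Ico 0 (b + 2) := fun t ht =>
    ⟨mul_nonneg ht.1 hT.le, by nlinarith [ht.2]⟩
  let e : AddCircle (1 : ℝ) → M := AddCircle.liftIco 1 0 fun t => θ (t * (b + 2))
  have hec : Continuous e := by
    refine AddCircle.liftIco_zero_continuous ?_ (hθc.comp (by fun_prop) hmaps)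
    have h2 : ¬ b + 2 ≤ b := by linarith
    simp only [hθ, zero_mul, hb.le, if_true, one_mul, h2, if_false, hγ0]
    congr 1; ring
  have he : ∀ t ∈ Ico (0 : ℝ) 1, e t = θ (t * (b + 2)) := fun t ht =>
    AddCircle.liftIco_zero_coe_apply ht
  have hrep : ∀ z : AddCircle (1 : ℝ), ∃ t ∈ Ico (0 : ℝ) 1, (t : AddCircle (1 : ℝ)) = z := by
    intro z
    have := (AddCircle.equivIco (1 : ℝ) 0 z).2
    exact ⟨_, ⟨this.1, this.2.trans_eq (zero_add 1)⟩,
      (AddCircle.equivIco (1 : ℝ) 0).symm_apply_apply z⟩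
  have hei : Function.Injective e := by
    intro y z hyz
    obtain ⟨s, hs, rfl⟩ := hrep y
    obtain ⟨t, ht, rfl⟩ := hrep z
    rw [he s hs, he t ht] at hyz
    have := hθi (hmaps' s hs) (hmaps' t ht) hyz
    rw [mul_right_cancel₀ hT.ne' this]
  refine ⟨e, hec, hei, ?_⟩
  have hxe : x ∈ range e := by
    refine ⟨(((b + 1) / (b + 2) : ℝ) : AddCircle (1 : ℝ)), ?_⟩
    rw [he _ ⟨by positivity, by rw [div_lt_one hT]; linarith⟩, div_mul_cancel₀ _ hT.ne']
    have h2 : ¬ b + 1 ≤ b := by linarith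
    simp only [hθ, h2, if_false, ← hα0]
    congr 1; ring
  exact ((isPreconnected_range hec).subset_connectedComponent hxe).antisymm
    ((hM.isClopen_range_addCircle hec hei).connectedComponent_subset hxe)

end Circles

/-! ### Orientation through the direction of paths -/

section Orientation

open Set Filter

/-- A function that increases along a path increases in every chart that does so. -/
theorem exists_strictMonoOn_transition {N : Type*} [TopologicalSpace N]
    {φ : OpenPartialHomeomorph N ℝ} {χ : N → ℝ} {γ : ℝ → N} {t : ℝ} {U : Set ℝ}
    (hφ : γ t ∈ φ.source)
    (hU : U ∈ 𝓝 t) (hc : ContinuousOn γ U)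
    (hφm : StrictMonoOn (fun s => φ (γ s)) U) (hχm : StrictMonoOn (fun s => χ (γ s)) U) :
    ∃ V ∈ 𝓝 (φ (γ t)), StrictMonoOn (fun u => χ (φ.symm u)) V := by
  have hW : U ∩ γ ⁻¹' φ.source ∈ 𝓝 t :=
    inter_mem hU ((hc.continuousAt hU).preimage_mem_nhds (φ.open_source.mem_nhds hφ))
  have hcont : ContinuousOn (fun s => φ (γ s)) (U ∩ γ ⁻¹' φ.source) :=
    φ.continuousOn.comp (hc.mono inter_subset_left) fun s hs => hs.2
  refine ⟨_, image_mem_nhds_of_injOn hW hcont (hφm.injOn.mono inter_subset_left), ?_⟩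
  rintro _ ⟨s, hs, rfl⟩ _ ⟨s', hs', rfl⟩ hlt
  simp only [φ.left_inv hs.2, φ.left_inv hs'.2]
  exact hχm hs.1 hs'.1 ((hφm.lt_iff_lt hs.1 hs'.1).1 hlt)

namespace OrientedOneManifold

variable {M N : OrientedOneManifold}

theorem locallyHalfLine (M : OrientedOneManifold) : LocallyHalfLine M.carrier :=
  M.locally_halfLine

/-- The path `γ` passes through `γ t` in the direction of the orientation. -/
def Up (M : OrientedOneManifold) (γ : ℝ → M.carrier) (t : ℝ) : Prop :=
  ∃ φ ∈ M.atlas, γ t ∈ φ.source ∧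
    ∃ U ∈ 𝓝 t, ContinuousOn γ U ∧ StrictMonoOn (fun s => φ (γ s)) U

/-- The path `γ` passes through `γ t` against the direction of the orientation. -/
def Down (M : OrientedOneManifold) (γ : ℝ → M.carrier) (t : ℝ) : Prop :=
  M.Up (fun s => γ (-s)) (-t)

/-- The direction of a path does not depend on the chart in which it is read, because transitions in
the atlas are increasing. -/
theorem Up.strictMonoOn {γ : ℝ → M.carrier} {t : ℝ} (h : M.Up γ t)
    {ψ : OpenPartialHomeomorph M.carrier ℝ} (hψ : ψ ∈ M.atlas) (ht : γ t ∈ ψ.source) :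
    ∃ U ∈ 𝓝 t, ContinuousOn γ U ∧ StrictMonoOn (fun s => ψ (γ s)) U := by
  obtain ⟨φ, hφ, hs, U, hU, hc, hm⟩ := h
  obtain ⟨V, hV, hVm⟩ := M.atlas_oriented φ ψ hφ hψ (γ t) ⟨hs, ht⟩
  have hca : ContinuousAt γ t := hc.continuousAt hU
  have hW : U ∩ γ ⁻¹' φ.source ∩ (fun s => φ (γ s)) ⁻¹' V ∈ 𝓝 t :=
    inter_mem (inter_mem hU (hca.preimage_mem_nhds (φ.open_source.mem_nhds hs)))
      (((φ.continuousAt hs).comp hca).preimage_mem_nhds hV)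
  refine ⟨_, hW, hc.mono fun s hs => hs.1.1, fun s hs s' hs' hlt => ?_⟩
  have := hVm hs.2 hs'.2 (hm hs.1.1 hs'.1.1 hlt)
  simp only [φ.left_inv hs.1.2, φ.left_inv hs'.1.2] at this
  exact this

/-- A function that increases along one oriented path through a point increases along all. -/
theorem Up.exists_strictMonoOn {γ γ' : ℝ → M.carrier} {t t' : ℝ} (h : M.Up γ t)
    (h' : M.Up γ' t') (he : γ t = γ' t') {g : M.carrier → ℝ}
    (hg : ∃ U ∈ 𝓝 t, StrictMonoOn (fun s => g (γ s)) U) :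
    ∃ U ∈ 𝓝 t', StrictMonoOn (fun s => g (γ' s)) U := by
  obtain ⟨φ, hφ, hs, V, hV, hc, hm⟩ := h'
  obtain ⟨U, hU, hcU, hmU⟩ := h.strictMonoOn hφ (he ▸ hs)
  obtain ⟨U', hU', hgU⟩ := hg
  obtain ⟨W, hW, hgW⟩ := exists_strictMonoOn_transition (χ := g) (he ▸ hs) (inter_mem hU hU')
    (hcU.mono inter_subset_left) (hmU.mono inter_subset_left) (hgU.mono inter_subset_right)
  rw [he] at hW
  have hca : ContinuousAt γ' t' := hc.continuousAt hV
  refine ⟨V ∩ γ' ⁻¹' φ.source ∩ (fun s => φ (γ' s)) ⁻¹' W,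
    inter_mem (inter_mem hV (hca.preimage_mem_nhds (φ.open_source.mem_nhds hs)))
      (((φ.continuousAt hs).comp hca).preimage_mem_nhds hW), fun a ha b hb hab => ?_⟩
  have := hgW ha.2 hb.2 (hm ha.1.1 hb.1.1 hab)
  simp only [φ.left_inv ha.1.2, φ.left_inv hb.1.2] at this
  exact this

theorem Up.eventually {γ : ℝ → M.carrier} {t : ℝ} (h : M.Up γ t) : ∀ᶠ s in 𝓝 t, M.Up γ s := by
  obtain ⟨φ, hφ, hs, U, hU, hc, hm⟩ := h
  filter_upwards [(hc.continuousAt hU).preimage_mem_nhds (φ.open_source.mem_nhds hs),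
    eventually_mem_nhds_iff.2 hU] with s hs hsU
  exact ⟨φ, hφ, hs, U, hsU, hc, hm⟩

theorem Up.comp {γ : ℝ → M.carrier} {f : ℝ → ℝ} {s : ℝ} (hc : Continuous f) (hm : StrictMono f)
    (h : M.Up γ (f s)) : M.Up (fun s => γ (f s)) s := by
  obtain ⟨φ, hφ, hs, U, hU, hcU, hmU⟩ := h
  exact ⟨φ, hφ, hs, f ⁻¹' U, hc.continuousAt.preimage_mem_nhds hU,
    hcU.comp hc.continuousOn fun _ h => h, fun a ha b hb hab => hmU ha hb (hm hab)⟩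

theorem Up.congr {γ γ' : ℝ → M.carrier} {t : ℝ} (h : M.Up γ t) (he : γ' =ᶠ[𝓝 t] γ) :
    M.Up γ' t := by
  obtain ⟨φ, hφ, hs, U, hU, hcU, hmU⟩ := h
  refine ⟨φ, hφ, by rwa [he.eq_of_nhds], U ∩ {s | γ' s = γ s}, inter_mem hU he,
    (hcU.mono inter_subset_left).congr fun s hs => hs.2, fun a ha b hb hab => ?_⟩
  simp only [show γ' a = γ a from ha.2, show γ' b = γ b from hb.2]
  exact hmU ha.1 hb.1 hab

theorem Up.not_isBoundaryPoint {γ : ℝ → M.carrier} {t : ℝ} (h : M.Up γ t) :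
    ¬ IsBoundaryPoint (γ t) := by
  obtain ⟨φ, -, hs, -⟩ := h
  exact φ.not_isBoundaryPoint hs

theorem Down.eventually {γ : ℝ → M.carrier} {t : ℝ} (h : M.Down γ t) :
    ∀ᶠ s in 𝓝 t, M.Down γ s :=
  continuous_neg.continuousAt.eventually (Up.eventually h)

theorem not_up_and_down {γ : ℝ → M.carrier} {t : ℝ} (h : M.Up γ t) (h' : M.Down γ t) : False := by
  obtain ⟨φ, hφ, hs, U, hU, -, hm⟩ := h
  obtain ⟨V, hV, -, hmV⟩ := Up.strictMonoOn h' hφ (by simpa using hs)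
  have hW : U ∩ Neg.neg ⁻¹' V ∈ 𝓝 t :=
    inter_mem hU (continuous_neg.continuousAt.preimage_mem_nhds hV)
  obtain ⟨ε, hε, hW⟩ := exists_Icc_subset_of_mem_nhds hW
  have h1 := hW (show t ∈ _ from ⟨by linarith, by linarith⟩)
  have h2 := hW (show t + ε ∈ _ from ⟨by linarith, by linarith⟩)
  have h3 := hm h1.1 h2.1 (by linarith)
  have h4 := hmV h2.2 h1.2 (by linarith)
  simp only [neg_neg] at h3 h4
  exact lt_asymm h3 h4

/-- In a chart of the orientation an injective path is a strictly monotone function near t. -/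
theorem up_or_down {γ : ℝ → M.carrier} {t : ℝ} {U : Set ℝ} (hU : U ∈ 𝓝 t)
    (hc : ContinuousOn γ U) (hi : InjOn γ U) : M.Up γ t ∨ M.Down γ t := by
  obtain ⟨φ, hφ, hs⟩ := M.atlas_covers (γ t) (not_isBoundaryPoint_of_injOn hU hc hi)
  have hW : U ∩ γ ⁻¹' φ.source ∈ 𝓝 t :=
    inter_mem hU ((hc.continuousAt hU).preimage_mem_nhds (φ.open_source.mem_nhds hs))
  obtain ⟨ε, hε, hW⟩ := exists_Icc_subset_of_mem_nhds hW
  have hcont : ContinuousOn (fun s => φ (γ s)) (Icc (t - ε) (t + ε)) :=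
    φ.continuousOn.comp (hc.mono (hW.trans inter_subset_left)) fun s hs => (hW hs).2
  have hinj : InjOn (fun s => φ (γ s)) (Icc (t - ε) (t + ε)) := fun a ha b hb hab =>
    hi (hW ha).1 (hW hb).1 (φ.injOn (hW ha).2 (hW hb).2 hab)
  have hn : Icc (t - ε) (t + ε) ∈ 𝓝 t := Icc_mem_nhds (by linarith) (by linarith)
  rcases hcont.strictMonoOn_of_injOn_Icc' (by linarith) hinj with hm | hm
  · exact Or.inl ⟨φ, hφ, hs, _, hn, hc.mono (hW.trans inter_subset_left), hm⟩
  · refine Or.inr ⟨φ, hφ, by simpa using hs, Neg.neg ⁻¹' Icc (t - ε) (t + ε),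
      continuous_neg.continuousAt.preimage_mem_nhds (by simpa using hn),
      (hc.mono (hW.trans inter_subset_left)).comp continuous_neg.continuousOn fun s hs => hs, ?_⟩
    intro a ha b hb hab
    exact hm hb ha (neg_lt_neg hab)

/-- The two directions are open conditions on the parameter, exclude each other and exhaust V, so
connectedness leaves only one. -/
theorem up_or_down_on {γ : ℝ → M.carrier} {V : Set ℝ} (hp : _root_.IsPreconnected V)
    (hl : ∀ t ∈ V, ∃ U ∈ 𝓝 t, ContinuousOn γ U ∧ InjOn γ U) :
    (∀ t ∈ V, M.Up γ t) ∨ ∀ t ∈ V, M.Down γ t := by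
  have h1 : IsOpen {t | M.Up γ t} := isOpen_iff_mem_nhds.2 fun t ht => Up.eventually ht
  have h2 : IsOpen {t | M.Down γ t} := isOpen_iff_mem_nhds.2 fun t ht => Down.eventually ht
  refine isPreconnected_iff_subset_of_disjoint.1 hp _ _ h1 h2 (fun t ht => ?_) ?_
  · obtain ⟨U, hU, hc, hi⟩ := hl t ht
    exact up_or_down hU hc hi
  · exact eq_empty_of_forall_notMem fun t ht => not_up_and_down ht.2.1 ht.2.2

theorem up_or_down_on_Ioo {γ : ℝ → M.carrier} {a b : ℝ} (hc : ContinuousOn γ (Ioo a b))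
    (hi : InjOn γ (Ioo a b)) : (∀ t ∈ Ioo a b, M.Up γ t) ∨ ∀ t ∈ Ioo a b, M.Down γ t :=
  up_or_down_on isPreconnected_Ioo fun _ ht =>
    ⟨_, Ioo_mem_nhds ht.1 ht.2, hc, hi⟩

/-- A path in a chart of the orientation. -/
theorem up_symm {φ : OpenPartialHomeomorph M.carrier ℝ} (hφ : φ ∈ M.atlas) {x : M.carrier}
    (hx : x ∈ φ.source) : M.Up φ.symm (φ x) := by
  refine ⟨φ, hφ, by rwa [φ.left_inv hx], φ.target, φ.open_target.mem_nhds (φ.map_source hx),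
    φ.continuousOn_symm, fun a ha b hb hab => ?_⟩
  simpa only [φ.right_inv ha, φ.right_inv hb] using hab

/-- One oriented path through each point is a sufficient test: transitions to and from a chart of
the atlas can be read along it, both charts increase there, and maximality of the atlas does the
rest. -/
theorem mem_atlas_of_up {ψ : OpenPartialHomeomorph M.carrier ℝ}
    (h : ∀ y ∈ ψ.source, ∃ (γ : ℝ → M.carrier) (t : ℝ), γ t = y ∧ M.Up γ t ∧
      ∃ U ∈ 𝓝 t, StrictMonoOn (fun s => ψ (γ s)) U) : ψ ∈ M.atlas := by
  apply M.atlas_maximal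
  intro φ hφ
  have key : ∀ y ∈ φ.source ∩ ψ.source, ∃ (γ : ℝ → M.carrier) (t : ℝ), γ t = y ∧
      ∃ U ∈ 𝓝 t, ContinuousOn γ U ∧ StrictMonoOn (fun s => φ (γ s)) U ∧
        StrictMonoOn (fun s => ψ (γ s)) U := by
    rintro y ⟨hy, hy'⟩
    obtain ⟨γ, t, rfl, hup, U, hU, hm⟩ := h y hy'
    obtain ⟨V, hV, hc, hmV⟩ := hup.strictMonoOn hφ hy
    exact ⟨γ, t, rfl, U ∩ V, inter_mem hU hV, hc.mono inter_subset_right,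
      hmV.mono inter_subset_right, hm.mono inter_subset_left⟩
  constructor
  · rintro y ⟨hy, hy'⟩
    obtain ⟨γ, t, rfl, U, hU, hc, h1, h2⟩ := key y ⟨hy, hy'⟩
    exact exists_strictMonoOn_transition hy hU hc h1 h2
  · rintro y ⟨hy, hy'⟩
    obtain ⟨γ, t, rfl, U, hU, hc, h1, h2⟩ := key y ⟨hy', hy⟩
    exact exists_strictMonoOn_transition hy hU hc h2 h1

theorem PreservesOrientation.up {f : M.carrier → N.carrier} (hf : M.PreservesOrientation N f)
    (hfc : Continuous f) {γ : ℝ → M.carrier} {t : ℝ} (h : M.Up γ t) :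
    N.Up (fun s => f (γ s)) t := by
  obtain ⟨φ, hφ, hs, U, hU, hc, hm⟩ := h
  obtain ⟨ψ, hψ, hψs, he⟩ := hf φ hφ
  have hW : U ∩ γ ⁻¹' φ.source ∈ 𝓝 t :=
    inter_mem hU ((hc.continuousAt hU).preimage_mem_nhds (φ.open_source.mem_nhds hs))
  refine ⟨ψ, hψ, by rw [hψs]; exact ⟨_, hs, rfl⟩, _, hW,
    hfc.comp_continuousOn (hc.mono inter_subset_left), fun a ha b hb hab => ?_⟩
  simp only [he _ ha.2, he _ hb.2]
  exact hm ha.1 hb.1 hab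

/-- Pushing a chart of the interior forward along a map that is injective on its source. -/
theorem exists_pushforward_chart {A B : Type*} [TopologicalSpace A] [TopologicalSpace B]
    (hB : LocallyHalfLine B) {f : A → B} (hfc : Continuous f)
    {φ : OpenPartialHomeomorph A ℝ} (hfi : InjOn f φ.source) :
    ∃ ψ : OpenPartialHomeomorph B ℝ, ψ.source = f '' φ.source ∧ ∀ x ∈ φ.source, ψ (f x) = φ x := by
  obtain ⟨ψ, hψs, hψt, hψ, -⟩ := hB.exists_chart (γ := fun t => f (φ.symm t)) φ.open_target
    (hfc.comp_continuousOn φ.continuousOn_symm)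
    (fun s hs t ht hst => φ.symm.injOn hs ht (hfi (φ.map_target hs) (φ.map_target ht) hst))
  refine ⟨ψ, ?_, fun x hx => ?_⟩
  · rw [hψs, ← φ.symm_image_target_eq_source, image_image]
  · have := hψ (φ x) (φ.map_source hx)
    simpa only [φ.left_inv hx] using this

/-- A chart is pushed forward along f and recognized as oriented by `mem_atlas_of_up`, using the
images of the given paths as tests. -/
theorem preservesOrientation_of_up {f : M.carrier → N.carrier} (hfc : Continuous f)
    (hfi : InjOn f {x | ¬ IsBoundaryPoint x})
    (h : ∀ x, ¬ IsBoundaryPoint x → ∃ (γ : ℝ → M.carrier) (t : ℝ), γ t = x ∧ M.Up γ t ∧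
      N.Up (fun s => f (γ s)) t) : M.PreservesOrientation N f := by
  intro φ hφ
  have hinterior : ∀ x ∈ φ.source, ¬ IsBoundaryPoint x := M.atlas_source_interior φ hφ
  obtain ⟨ψ, hψs, he⟩ := exists_pushforward_chart N.locallyHalfLine hfc (hfi.mono hinterior)
  refine ⟨ψ, mem_atlas_of_up fun y hy => ?_, hψs, he⟩
  rw [hψs] at hy
  obtain ⟨x, hx, rfl⟩ := hy
  obtain ⟨γ, t, rfl, hup, hup'⟩ := h x (hinterior x hx)
  obtain ⟨U, hU, hc, hm⟩ := hup.strictMonoOn hφ hx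
  refine ⟨_, t, rfl, hup', U ∩ γ ⁻¹' φ.source,
    inter_mem hU ((hc.continuousAt hU).preimage_mem_nhds (φ.open_source.mem_nhds hx)),
    fun a ha b hb hab => ?_⟩
  simp only [he _ ha.2, he _ hb.2]
  exact hm ha.1 hb.1 hab

/-- The inverse of the path is the required chart: on [0, b) it is a half line chart, and on (0, b)
it belongs to the orientation because the path goes up. -/
theorem isPositive_of_up {γ : ℝ → M.carrier} {b : ℝ} (hb : 0 < b)
    (hx : IsBoundaryPoint (γ 0)) (hc : ContinuousOn γ (Ico 0 b)) (hi : InjOn γ (Ico 0 b))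
    (hup : ∀ t ∈ Ioo 0 b, M.Up γ t) : M.IsPositive (γ 0) := by
  obtain ⟨φ, hφs, hφ⟩ := M.locallyHalfLine.exists_boundary_chart hb hx hc hi
  obtain ⟨ψ, hψs, -, hψ, -⟩ := M.locallyHalfLine.exists_chart (isOpen_Ioo (a := 0) (b := b))
    (hc.mono Ioo_subset_Ico_self) (hi.mono Ioo_subset_Ico_self)
  refine ⟨φ, by rw [hφs]; exact ⟨0, ⟨le_rfl, hb⟩, rfl⟩, ψ, mem_atlas_of_up ?_, ?_, ?_⟩
  · intro y hy
    rw [hψs] at hy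
    obtain ⟨t, ht, rfl⟩ := hy
    refine ⟨γ, t, rfl, hup t ht, Ioo 0 b, Ioo_mem_nhds ht.1 ht.2, fun s hs s' hs' hlt => ?_⟩
    simpa only [hψ s hs, hψ s' hs'] using hlt
  · rw [hψs, hφs]
    ext y
    constructor
    · rintro ⟨t, ht, rfl⟩
      exact ⟨⟨t, ⟨ht.1.le, ht.2⟩, rfl⟩, (hup t ht).not_isBoundaryPoint⟩
    · rintro ⟨⟨t, ht, rfl⟩, hy⟩
      refine ⟨t, ⟨lt_of_le_of_ne ht.1 ?_, ht.2⟩, rfl⟩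
      rintro rfl
      exact hy hx
  · intro y hy
    rw [hψs] at hy
    obtain ⟨t, ht, rfl⟩ := hy
    rw [hψ t ht, hφ t ⟨ht.1.le, ht.2⟩]

/-- A chart witnessing positivity vanishes at γ 0 and is nonnegative, so it increases along γ; then
γ would also go up. -/
theorem not_isPositive_of_down {γ : ℝ → M.carrier} {b : ℝ} (hb : 0 < b)
    (hx : IsBoundaryPoint (γ 0)) (hc : ContinuousOn γ (Ico 0 b)) (hi : InjOn γ (Ico 0 b))
    (hdown : ∀ t ∈ Ioo 0 b, M.Down γ t) : ¬ M.IsPositive (γ 0) := by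
  rintro ⟨φ, hs, ψ, hψ, hψs, he⟩
  have hV : γ ⁻¹' φ.source ∈ 𝓝[Ico 0 b] 0 :=
    hc 0 ⟨le_rfl, hb⟩ (φ.open_source.mem_nhds hs)
  rw [nhdsWithin_Ico_eq_nhdsGE hb, mem_nhdsGE_iff_exists_Icc_subset] at hV
  obtain ⟨d, hd, h⟩ := hV
  obtain ⟨c, hac, hcmin⟩ := exists_between (lt_min hb hd)
  have hcb : c < b := hcmin.trans_le (min_le_left _ _)
  have h' : Icc 0 c ⊆ γ ⁻¹' φ.source :=
    (Icc_subset_Icc_right (hcmin.trans_le (min_le_right _ _)).le).trans h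
  have hsub : Icc 0 c ⊆ Ico 0 b := fun s hs => ⟨hs.1, hs.2.trans_lt hcb⟩
  have hcf : ContinuousOn (fun s => (φ (γ s) : ℝ)) (Icc 0 c) :=
    continuous_subtype_val.comp_continuousOn (φ.continuousOn.comp (hc.mono hsub) h')
  have hif : InjOn (fun s => (φ (γ s) : ℝ)) (Icc 0 c) := fun s hs t ht hst =>
    hi (hsub hs) (hsub ht) (φ.injOn (h' hs) (h' ht) (Subtype.ext hst))
  have hinterior : ∀ t ∈ Ioo 0 c, ¬ IsBoundaryPoint (γ t) := fun t ht =>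
    not_isBoundaryPoint_of_injOn (Ioo_mem_nhds ht.1 ht.2)
      (hc.mono (Ioo_subset_Icc_self.trans hsub)) (hi.mono (Ioo_subset_Icc_self.trans hsub))
  -- `IsPositive` does not require the chart to vanish at the point. A positive coordinate would
  -- yield a two-sided path through it, which a boundary point excludes.
  have hφ0 : (φ (γ 0) : ℝ) = 0 := by
    by_contra hne
    have hpos : 0 < (φ (γ 0) : ℝ) := lt_of_le_of_ne (φ (γ 0)).2 (Ne.symm hne)
    have hV : {t : ℝ | 0 < t ∧ toHalfLine t ∈ φ.target} ∈ 𝓝 (φ (γ 0) : ℝ) := by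
      refine inter_mem (Ioi_mem_nhds hpos) (continuous_toHalfLine.continuousAt.preimage_mem_nhds ?_)
      rw [toHalfLine_coe]
      exact φ.open_target.mem_nhds (φ.map_source hs)
    have := not_isBoundaryPoint_of_injOn (γ := fun t => φ.symm (toHalfLine t)) hV
      (φ.continuousOn_symm.comp (by fun_prop) fun t ht => ht.2) (fun s hs t ht hst => by
        have := congrArg Subtype.val (φ.symm.injOn hs.2 ht.2 hst)
        rwa [coe_toHalfLine hs.1.le, coe_toHalfLine ht.1.le] at this)
    simp only [toHalfLine_coe, φ.left_inv hs] at this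
    exact this hx
  have hm := hcf.strictMonoOn_of_injOn_Icc hac.le (by rw [hφ0]; exact (φ (γ c)).2) hif
  have ht : c / 2 ∈ Ioo 0 c := ⟨by linarith, by linarith⟩
  have hmem : ∀ t ∈ Ioo 0 c, γ t ∈ ψ.source := fun t ht => by
    rw [hψs]; exact ⟨h' (Ioo_subset_Icc_self ht), hinterior t ht⟩
  refine not_up_and_down (γ := γ) (t := c / 2) ⟨ψ, hψ, hmem _ ht, Ioo 0 c,
    Ioo_mem_nhds ht.1 ht.2, hc.mono (Ioo_subset_Icc_self.trans hsub), fun s hs s' hs' hlt => ?_⟩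
    (hdown _ ⟨ht.1, ht.2.trans hcb⟩)
  simp only [he _ (hmem s hs), he _ (hmem s' hs')]
  exact hm (Ioo_subset_Icc_self hs) (Ioo_subset_Icc_self hs') hlt

/-- The sign of the first point of an arc. -/
theorem isPositive_iff_up {γ : ℝ → M.carrier} {b : ℝ} (hx : IsBoundaryPoint (γ 0))
    (hc : ContinuousOn γ (Ico 0 b)) (hi : InjOn γ (Ico 0 b)) {t : ℝ} (ht : t ∈ Ioo 0 b) :
    M.IsPositive (γ 0) ↔ M.Up γ t := by
  have hb : 0 < b := ht.1.trans ht.2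
  rcases up_or_down_on_Ioo (M := M) (hc.mono Ioo_subset_Ico_self) (hi.mono Ioo_subset_Ico_self)
    with h | h
  · exact iff_of_true (isPositive_of_up hb hx hc hi h) (h t ht)
  · exact iff_of_false (not_isPositive_of_down hb hx hc hi h) fun h' => not_up_and_down h' (h t ht)

/-- The sign is the direction of an arc leaving the boundary point, and f preserves directions and
carries the arc to an arc leaving f x. -/
theorem PreservesOrientation.boundarySign_eq {f : M.carrier → N.carrier}
    (hf : M.PreservesOrientation N f) (hfc : Continuous f) (hfi : Function.Injective f)
    {x : M.carrier} (hx : IsBoundaryPoint x) (hfx : IsBoundaryPoint (f x)) :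
    N.boundarySign (f x) = M.boundarySign x := by
  obtain ⟨γ, hc, hi, rfl⟩ := hx.exists_arc
  have hc' : ContinuousOn γ (Ico 0 1) := hc.mono Ico_subset_Icc_self
  have hi' : InjOn γ (Ico 0 1) := hi.mono Ico_subset_Icc_self
  have hcN := hfc.comp_continuousOn hc'
  have hiN : InjOn (fun s => f (γ s)) (Ico 0 1) := fun s hs t ht hst => hi' hs ht (hfi hst)
  have key : N.IsPositive (f (γ 0)) ↔ M.IsPositive (γ 0) := by
    rcases up_or_down_on_Ioo (M := M) (hc.mono Ioo_subset_Icc_self)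
      (hi.mono Ioo_subset_Icc_self) with h | h
    · exact iff_of_true (isPositive_of_up one_pos hfx hcN hiN fun t ht => hf.up hfc (h t ht))
        (isPositive_of_up one_pos hx hc' hi' h)
    · exact iff_of_false
        (not_isPositive_of_down (γ := fun s => f (γ s)) one_pos hfx hcN hiN
          fun t ht => hf.up hfc (h t ht))
        (not_isPositive_of_down one_pos hx hc' hi' h)
  unfold boundarySign
  by_cases h : M.IsPositive (γ 0)
  · rw [if_pos h, if_pos (key.2 h)]
  · rw [if_neg h, if_neg fun h' => h (key.1 h')]

end OrientedOneManifold

end Orientation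

/-! ### Constructing oriented manifolds, and the union of two of them -/

section Construction

open Set Filter

theorem LocallyHalfLine.secondCountableTopology {Q : Type*} [TopologicalSpace Q] [CompactSpace Q]
    (hQ : LocallyHalfLine Q) : SecondCountableTopology Q := by
  choose φ hφ using hQ
  let _ : ChartedSpace HalfLine Q :=
    { atlas := range φ
      chartAt := φ
      mem_chart_source := hφ
      chart_mem_atlas := fun x => ⟨x, rfl⟩ }
  exact ChartedSpace.secondCountable_of_sigmaCompact HalfLine Q

namespace OrientedOneManifold

/-- The oriented manifold given by an oriented atlas of the interior. -/
def ofAtlas (Q : Type) [TopologicalSpace Q] [T2Space Q] [CompactSpace Q] (hQ : LocallyHalfLine Q)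
    (A : Set (OpenPartialHomeomorph Q ℝ)) (hcov : ∀ x, ¬ IsBoundaryPoint x → ∃ φ ∈ A, x ∈ φ.source)
    (hA : ∀ φ ∈ A, ∀ ψ ∈ A, OrientedTransition φ ψ) : OrientedOneManifold where
  carrier := Q
  secondCountable := hQ.secondCountableTopology
  locally_halfLine := hQ
  atlas := {ψ | ∀ φ ∈ A, OrientedTransition φ ψ ∧ OrientedTransition ψ φ}
  atlas_covers x hx := by
    obtain ⟨φ, hφ, hx⟩ := hcov x hx
    exact ⟨φ, fun ψ hψ => ⟨hA ψ hψ φ hφ, hA φ hφ ψ hψ⟩, hx⟩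
  atlas_source_interior φ _ x hx := φ.not_isBoundaryPoint hx
  atlas_oriented ψ ψ' h h' x hx := by
    obtain ⟨φ, hφ, hxφ⟩ := hcov x (ψ.not_isBoundaryPoint hx.1)
    obtain ⟨U, hU, hm⟩ := (h φ hφ).1 x ⟨hxφ, hx.1⟩
    obtain ⟨U', hU', hm'⟩ := (h' φ hφ).1 x ⟨hxφ, hx.2⟩
    -- Two charts compatible with A are compared along the inverse of a chart from A, where both
    -- increase.
    have := exists_strictMonoOn_transition (φ := ψ) (χ := ψ') (γ := φ.symm) (t := φ x)
      (by rw [φ.left_inv hxφ]; exact hx.1)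
      (inter_mem (inter_mem hU hU') (φ.open_target.mem_nhds (φ.map_source hxφ)))
      (φ.continuousOn_symm.mono inter_subset_right) (hm.mono fun s hs => hs.1.1)
      (hm'.mono fun s hs => hs.1.2)
    rwa [φ.left_inv hxφ] at this
  atlas_maximal ψ h φ hφ := h φ fun φ' hφ' => ⟨hA φ' hφ' φ hφ, hA φ hφ φ' hφ'⟩

theorem mem_atlas_ofAtlas {Q : Type} [TopologicalSpace Q] [T2Space Q] [CompactSpace Q]
    {hQ : LocallyHalfLine Q} {A : Set (OpenPartialHomeomorph Q ℝ)}
    {hcov : ∀ x, ¬ IsBoundaryPoint x → ∃ φ ∈ A, x ∈ φ.source}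
    {hA : ∀ φ ∈ A, ∀ ψ ∈ A, OrientedTransition φ ψ} {φ : OpenPartialHomeomorph Q ℝ} (hφ : φ ∈ A) :
    φ ∈ (ofAtlas Q hQ A hcov hA).atlas :=
  fun ψ hψ => ⟨hA ψ hψ φ hφ, hA φ hφ ψ hψ⟩

/-- `g` increases along the images of oriented paths under `i`. -/
def IncreasesAlong (K : OrientedOneManifold) {Q : Type} [TopologicalSpace Q] (i : K.carrier → Q)
    (ψ : OpenPartialHomeomorph Q ℝ) : Prop :=
  ∀ γ t, K.Up γ t → i (γ t) ∈ ψ.source → ∃ U ∈ 𝓝 t, StrictMonoOn (fun s => ψ (i (γ s))) U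

/-- The path `γ` is near `s` the image under `i` of an oriented path. -/
def IsImageOfUp (K : OrientedOneManifold) {Q : Type} (i : K.carrier → Q) (γ : ℝ → Q) (s : ℝ) :
    Prop :=
  ∃ γ', K.Up γ' s ∧ γ =ᶠ[𝓝 s] fun u => i (γ' u)

theorem IncreasesAlong.of_isImageOfUp {K : OrientedOneManifold} {Q : Type} [TopologicalSpace Q]
    {i : K.carrier → Q} {ψ : OpenPartialHomeomorph Q ℝ} (h : K.IncreasesAlong i ψ) {γ : ℝ → Q}
    {s : ℝ} (hγ : K.IsImageOfUp i γ s) (hs : γ s ∈ ψ.source) :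
    ∃ U ∈ 𝓝 s, StrictMonoOn (fun u => ψ (γ u)) U := by
  obtain ⟨γ', hup, he⟩ := hγ
  obtain ⟨U, hU, hm⟩ := h γ' s hup (he.eq_of_nhds ▸ hs)
  refine ⟨U ∩ {u | γ u = i (γ' u)}, inter_mem hU he, fun a ha b hb hab => ?_⟩
  simp only [show γ a = i (γ' a) from ha.2, show γ b = i (γ' b) from hb.2]
  exact hm ha.1 hb.1 hab

/-- An injective continuous function is monotone in one sense on a whole interval, and a single
parameter other than 0 decides which. This settles the orientation at a glued point, which is
interior to neither piece. -/
theorem exists_strictMonoOn_of_punctured {f : ℝ → ℝ} {U : Set ℝ} (hU : U ∈ 𝓝 (0 : ℝ))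
    (hc : ContinuousOn f U) (hi : InjOn f U)
    (h : ∀ s ∈ U, s ≠ 0 → ∃ V ∈ 𝓝 s, StrictMonoOn f V) :
    ∃ V ∈ 𝓝 (0 : ℝ), StrictMonoOn f V := by
  obtain ⟨ε, hε, hs⟩ := exists_Icc_subset_of_mem_nhds hU
  refine ⟨Icc (0 - ε) (0 + ε), Icc_mem_nhds (by linarith) (by linarith), ?_⟩
  rcases (hc.mono hs).strictMonoOn_of_injOn_Icc' (by linarith) (hi.mono hs) with hm | hm
  · exact hm
  · exfalso
    obtain ⟨V, hV, hmV⟩ := h (ε / 2) (hs ⟨by linarith, by linarith⟩) (by linarith)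
    obtain ⟨δ, hδ, hδV⟩ := exists_Icc_subset_of_mem_nhds
      (inter_mem hV (Icc_mem_nhds (a := 0 - ε) (b := 0 + ε) (by linarith) (by linarith)))
    have h1 := hδV (show ε / 2 ∈ _ from ⟨by linarith, by linarith⟩)
    have h2 := hδV (show ε / 2 + δ ∈ _ from ⟨by linarith, by linarith⟩)
    exact lt_asymm (hmV h1.1 h2.1 (by linarith)) (hm h1.2 h2.2 (by linarith))

/-- The union of two oriented manifolds that meet in boundary points of opposite sign. -/
theorem exists_union (K L : OrientedOneManifold) {Q : Type} [TopologicalSpace Q] [T2Space Q]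
    [CompactSpace Q] (hQ : LocallyHalfLine Q) {i : K.carrier → Q} {j : L.carrier → Q}
    (hic : Continuous i) (hii : Function.Injective i) (hjc : Continuous j)
    (hji : Function.Injective j)
    (hdisj : ∀ x y, ¬ IsBoundaryPoint x → ¬ IsBoundaryPoint y → i x ≠ j y)
    (hcov : ∀ q, ¬ IsBoundaryPoint q → (∃ x, ¬ IsBoundaryPoint x ∧ i x = q) ∨
      (∃ y, ¬ IsBoundaryPoint y ∧ j y = q) ∨
      ∃ γ : ℝ → Q, γ 0 = q ∧ ∃ U ∈ 𝓝 (0 : ℝ), ContinuousOn γ U ∧ InjOn γ U ∧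
        ∀ s ∈ U, s ≠ 0 → K.IsImageOfUp i γ s ∨ L.IsImageOfUp j γ s) :
    ∃ (N : OrientedOneManifold) (h : Q ≃ₜ N.carrier),
      K.PreservesOrientation N (fun x => h (i x)) ∧
      L.PreservesOrientation N (fun x => h (j x)) := by
  -- The atlas consists of the charts that increase along the oriented paths of both pieces. Nothing
  -- is required at the junctions themselves, because behaviour on a punctured neighbourhood
  -- determines it.
  let A : Set (OpenPartialHomeomorph Q ℝ) := {ψ | K.IncreasesAlong i ψ ∧ L.IncreasesAlong j ψ}
  have push : ∀ (K L : OrientedOneManifold) (i : K.carrier → Q) (j : L.carrier → Q),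
      Continuous i → Function.Injective i →
      (∀ x y, ¬ IsBoundaryPoint x → ¬ IsBoundaryPoint y → i x ≠ j y) → ∀ φ ∈ K.atlas,
      ∃ ψ : OpenPartialHomeomorph Q ℝ, K.IncreasesAlong i ψ ∧ L.IncreasesAlong j ψ ∧
        ψ.source = i '' φ.source ∧ ∀ x ∈ φ.source, ψ (i x) = φ x := by
    intro K L i j hic hii hdisj φ hφ
    obtain ⟨ψ, hψs, hψ⟩ := exists_pushforward_chart hQ hic (φ := φ) hii.injOn
    refine ⟨ψ, ?_, ?_, hψs, hψ⟩
    · intro γ t hup ht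
      rw [hψs] at ht
      obtain ⟨x, hx, hxt⟩ := ht
      obtain rfl : x = γ t := hii hxt
      obtain ⟨U, hU, hc, hm⟩ := hup.strictMonoOn hφ hx
      refine ⟨U ∩ γ ⁻¹' φ.source,
        inter_mem hU ((hc.continuousAt hU).preimage_mem_nhds (φ.open_source.mem_nhds hx)),
        fun a ha b hb hab => ?_⟩
      simp only [hψ _ ha.2, hψ _ hb.2]
      exact hm ha.1 hb.1 hab
    -- Increase along the paths of the other piece is vacuous: the interiors of the two pieces have
    -- disjoint images.
    · intro γ t hup ht
      rw [hψs] at ht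
      obtain ⟨x, hx, hxt⟩ := ht
      exact absurd hxt (hdisj _ _ (φ.not_isBoundaryPoint hx) hup.not_isBoundaryPoint)
  have hpushK := push K L i j hic hii hdisj
  have hpushL := push L K j i hjc hji fun x y hx hy h => hdisj y x hy hx h.symm
  have hA : ∀ φ ∈ A, ∀ ψ ∈ A, OrientedTransition φ ψ := by
    rintro φ ⟨hφK, hφL⟩ ψ ⟨hψK, hψL⟩ q ⟨hq, hq'⟩
    have onPiece : ∀ (K : OrientedOneManifold) (i : K.carrier → Q), Continuous i →
        K.IncreasesAlong i φ → K.IncreasesAlong i ψ → ∀ x, ¬ IsBoundaryPoint x → i x = q →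
        ∃ U ∈ 𝓝 (φ q), StrictMonoOn (fun t => ψ (φ.symm t)) U := by
      rintro K i hic hφK hψK x hx rfl
      obtain ⟨χ, hχ, hxχ⟩ := K.atlas_covers x hx
      have hup := up_symm hχ hxχ
      obtain ⟨U, hU, hm⟩ := hφK _ _ hup (by rwa [χ.left_inv hxχ])
      obtain ⟨U', hU', hm'⟩ := hψK _ _ hup (by rwa [χ.left_inv hxχ])
      have := exists_strictMonoOn_transition (φ := φ) (χ := ψ) (γ := fun s => i (χ.symm s))
        (t := χ x) (by rwa [χ.left_inv hxχ])
        (inter_mem (inter_mem hU hU') (χ.open_target.mem_nhds (χ.map_source hxχ)))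
        (hic.comp_continuousOn (χ.continuousOn_symm.mono inter_subset_right))
        (hm.mono fun s hs => hs.1.1) (hm'.mono fun s hs => hs.1.2)
      rwa [χ.left_inv hxχ] at this
    rcases hcov q (φ.not_isBoundaryPoint hq) with ⟨x, hx, hxq⟩ | ⟨x, hx, hxq⟩ |
      ⟨γ, rfl, U, hU, hc, hi, hγ⟩
    · exact onPiece K i hic hφK hψK x hx hxq
    · exact onPiece L j hjc hφL hψL x hx hxq
    · have mono : ∀ χ ∈ A, γ 0 ∈ χ.source →
          ∃ V ∈ 𝓝 (0 : ℝ), StrictMonoOn (fun s => χ (γ s)) V := by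
        rintro χ ⟨hχK, hχL⟩ h0
        have hW : U ∩ γ ⁻¹' χ.source ∈ 𝓝 (0 : ℝ) :=
          inter_mem hU ((hc.continuousAt hU).preimage_mem_nhds (χ.open_source.mem_nhds h0))
        refine exists_strictMonoOn_of_punctured hW
          (χ.continuousOn.comp (hc.mono inter_subset_left) fun s hs => hs.2)
          (fun a ha b hb hab => hi ha.1 hb.1 (χ.injOn ha.2 hb.2 hab)) fun s hs hs0 => ?_
        rcases hγ s hs.1 hs0 with h | h
        · exact hχK.of_isImageOfUp h hs.2
        · exact hχL.of_isImageOfUp h hs.2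
      obtain ⟨V, hV, hm⟩ := mono φ ⟨hφK, hφL⟩ hq
      obtain ⟨V', hV', hm'⟩ := mono ψ ⟨hψK, hψL⟩ hq'
      exact exists_strictMonoOn_transition hq (inter_mem hU (inter_mem hV hV'))
        (hc.mono inter_subset_left) (hm.mono fun s hs => hs.2.1) (hm'.mono fun s hs => hs.2.2)
  have hcovA : ∀ q, ¬ IsBoundaryPoint q → ∃ φ ∈ A, q ∈ φ.source := by
    intro q hq
    by_cases hqK : ∃ x, ¬ IsBoundaryPoint x ∧ i x = q
    · obtain ⟨x, hx, rfl⟩ := hqK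
      obtain ⟨φ, hφ, hxφ⟩ := K.atlas_covers x hx
      obtain ⟨ψ, h1, h2, hs, -⟩ := hpushK φ hφ
      exact ⟨ψ, ⟨h1, h2⟩, by rw [hs]; exact ⟨x, hxφ, rfl⟩⟩
    by_cases hqL : ∃ y, ¬ IsBoundaryPoint y ∧ j y = q
    · obtain ⟨x, hx, rfl⟩ := hqL
      obtain ⟨φ, hφ, hxφ⟩ := L.atlas_covers x hx
      obtain ⟨ψ, h1, h2, hs, -⟩ := hpushL φ hφ
      exact ⟨ψ, ⟨h2, h1⟩, by rw [hs]; exact ⟨x, hxφ, rfl⟩⟩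
    obtain ⟨γ, rfl, U, hU, hc, hi, hγ⟩ := ((hcov q hq).resolve_left hqK).resolve_left hqL
    obtain ⟨ε, hε, hεU⟩ := exists_Icc_subset_of_mem_nhds hU
    have hsub : Ioo (0 - ε) (0 + ε) ⊆ U := Ioo_subset_Icc_self.trans hεU
    obtain ⟨ψ, hψs, -, hψ, -⟩ := hQ.exists_chart isOpen_Ioo (hc.mono hsub) (hi.mono hsub)
    have incr : ∀ (K L : OrientedOneManifold) (i : K.carrier → Q) (j : L.carrier → Q),
        Function.Injective i →
        (∀ x y, ¬ IsBoundaryPoint x → ¬ IsBoundaryPoint y → i x ≠ j y) →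
        (¬ ∃ x, ¬ IsBoundaryPoint x ∧ i x = γ 0) →
        (∀ s ∈ U, s ≠ 0 → K.IsImageOfUp i γ s ∨ L.IsImageOfUp j γ s) → K.IncreasesAlong i ψ := by
      intro K L i j hii hdisj hq hγ γ' t hup ht
      rw [hψs] at ht
      obtain ⟨s, hs, hst⟩ := ht
      -- An oriented path of K stays in the interior, and the junction is not the image of an
      -- interior point of K.
      have hs0 : s ≠ 0 := by
        rintro rfl
        exact hq ⟨_, hup.not_isBoundaryPoint, hst.symm⟩
      rcases hγ s (hsub hs) hs0 with ⟨γ'', hup'', he⟩ | ⟨γ'', hup'', he⟩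
      · refine hup''.exists_strictMonoOn hup (hii (he.eq_of_nhds.symm.trans hst))
          (g := fun x => ψ (i x)) ⟨Ioo (0 - ε) (0 + ε) ∩ {u | γ u = i (γ'' u)},
            inter_mem (Ioo_mem_nhds hs.1 hs.2) he, fun a ha b hb hab => ?_⟩
        simp only [← show γ a = i (γ'' a) from ha.2, ← show γ b = i (γ'' b) from hb.2,
          hψ a ha.1, hψ b hb.1]
        exact hab
      · exact absurd (hst.symm.trans he.eq_of_nhds)
          (hdisj _ _ hup.not_isBoundaryPoint hup''.not_isBoundaryPoint)
    refine ⟨ψ, ⟨incr K L i j hii hdisj hqK hγ, incr L K j i hji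
      (fun x y hx hy h => hdisj y x hy hx h.symm) hqL fun s hs hs0 => (hγ s hs hs0).symm⟩, ?_⟩
    rw [hψs]
    exact ⟨0, ⟨by linarith, by linarith⟩, rfl⟩
  refine ⟨ofAtlas Q hQ A hcovA hA, Homeomorph.refl Q, ?_, ?_⟩
  · intro φ hφ
    obtain ⟨ψ, h1, h2, hs, he⟩ := hpushK φ hφ
    exact ⟨ψ, mem_atlas_ofAtlas ⟨h1, h2⟩, hs, he⟩
  · intro φ hφ
    obtain ⟨ψ, h1, h2, hs, he⟩ := hpushL φ hφ
    exact ⟨ψ, mem_atlas_ofAtlas ⟨h2, h1⟩, hs, he⟩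

end OrientedOneManifold

end Construction

/-! ### The cylinder over finitely many points -/

section Cylinder

open Set Filter

theorem isBoundaryPoint_homeomorph {A B : Type*} [TopologicalSpace A] [TopologicalSpace B]
    (h : A ≃ₜ B) {x : A} (hx : IsBoundaryPoint x) : IsBoundaryPoint (h x) := by
  obtain ⟨φ, hs, h0⟩ := hx
  exact ⟨h.symm.transOpenPartialHomeomorph φ, by simpa using hs, by simpa using h0⟩

theorem isBoundaryPoint_homeomorph_iff {A B : Type*} [TopologicalSpace A] [TopologicalSpace B]
    (h : A ≃ₜ B) {x : A} : IsBoundaryPoint (h x) ↔ IsBoundaryPoint x :=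
  ⟨fun hx => by simpa using isBoundaryPoint_homeomorph h.symm hx, isBoundaryPoint_homeomorph h⟩

/-- The cylinder over `n` points. -/
abbrev Cylinder (n : ℕ) : Type := Fin n × Icc (0 : ℝ) 1

namespace Cylinder

variable {n : ℕ}

/-- The line over the `k`-th point. -/
noncomputable def line (k : Fin n) (t : ℝ) : Cylinder n := (k, projIcc 0 1 zero_le_one t)

theorem continuous_line (k : Fin n) : Continuous (line k) :=
  continuous_const.prodMk continuous_projIcc

theorem line_eq {k : Fin n} {t : ℝ} (ht : t ∈ Icc (0 : ℝ) 1) : line k t = (k, ⟨t, ht⟩) := by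
  rw [line, projIcc_of_mem _ ht]

theorem line_zero (k : Fin n) : line k 0 = (k, 0) := by
  rw [line_eq ⟨le_rfl, zero_le_one⟩]; rfl

theorem line_one (k : Fin n) : line k 1 = (k, 1) := by
  rw [line_eq ⟨zero_le_one, le_rfl⟩]; rfl

theorem line_injective {k k' : Fin n} {s t : ℝ} (hs : s ∈ Icc (0 : ℝ) 1) (ht : t ∈ Icc (0 : ℝ) 1)
    (h : line k s = line k' t) : k = k' ∧ s = t := by
  rw [line_eq hs, line_eq ht] at h
  simpa using h

theorem injOn_line (k : Fin n) : InjOn (line k) (Icc 0 1) := fun _ hs _ ht h =>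
  (line_injective hs ht h).2

/-- A single chart serves the whole line over k except its far end, which is handled by `reflect`.
-/
theorem exists_chart (k : Fin n) : ∃ φ : OpenPartialHomeomorph (Cylinder n) HalfLine,
    (∀ t : Icc (0 : ℝ) 1, (t : ℝ) < 1 → (k, t) ∈ φ.source ∧ (φ (k, t) : ℝ) = t) := by
  obtain ⟨φ, hφs, -, hφ, -⟩ := exists_openPartialHomeomorph_of_image_mem_nhds
    (g := fun s : HalfLine => line k s) (V := {s : HalfLine | (s : ℝ) < 1})
    (isOpen_Iio.preimage continuous_subtype_val)
    ((continuous_line k).comp continuous_subtype_val).continuousOn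
    (fun s hs t ht h => Subtype.ext
      (injOn_line k ⟨s.2, le_of_lt hs⟩ ⟨t.2, le_of_lt ht⟩ h))
    (fun t ht U hU hUV => by
      have hc : Continuous fun w : Cylinder n => toHalfLine w.2 := by fun_prop
      have hval : toHalfLine (line k t).2 = t := by
        rw [line_eq ⟨t.2, le_of_lt ht⟩]; exact toHalfLine_coe t
      have h1 : {w : Cylinder n | toHalfLine w.2 ∈ U} ∈ 𝓝 (line k t) :=
        hc.continuousAt.preimage_mem_nhds (by rw [hval]; exact hU)
      have h2 : {w : Cylinder n | w.1 = k} ∈ 𝓝 (line k t) :=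
        ((isOpen_discrete {k}).preimage continuous_fst).mem_nhds rfl
      filter_upwards [h1, h2] with w hw hwk
      refine ⟨_, hw, ?_⟩
      simp only [coe_toHalfLine w.2.2.1]
      rw [line_eq w.2.2]
      exact Prod.ext hwk.symm rfl)
  have key : ∀ t : Icc (0 : ℝ) 1, (k, t) = line k t := fun t => (line_eq t.2).symm
  refine ⟨φ, fun t ht => ⟨?_, ?_⟩⟩
  · rw [hφs]
    exact ⟨⟨t, t.2.1⟩, ht, (key t).symm⟩
  · rw [key]
    exact congrArg Subtype.val (hφ ⟨t, t.2.1⟩ ht)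

/-- The reflection of the cylinder. -/
def reflect (n : ℕ) : Cylinder n ≃ₜ Cylinder n :=
  (Homeomorph.refl (Fin n)).prodCongr unitInterval.symmHomeomorph

theorem isBoundaryPoint_zero (k : Fin n) : IsBoundaryPoint ((k, 0) : Cylinder n) := by
  obtain ⟨φ, h⟩ := exists_chart k
  exact ⟨φ, (h 0 (by norm_num)).1, (h 0 (by norm_num)).2⟩

theorem isBoundaryPoint_one (k : Fin n) : IsBoundaryPoint ((k, 1) : Cylinder n) := by
  have := isBoundaryPoint_homeomorph (reflect n) (isBoundaryPoint_zero k)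
  have he : reflect n (k, 0) = (k, 1) := by
    simp [reflect, unitInterval.symmHomeomorph]
  rwa [he] at this

theorem locallyHalfLine : LocallyHalfLine (Cylinder n) := by
  rintro ⟨k, t⟩
  obtain ⟨φ, h⟩ := exists_chart k
  rcases lt_or_ge (t : ℝ) 1 with ht | ht
  · exact ⟨φ, (h t ht).1⟩
  · obtain rfl : t = 1 := Subtype.ext (le_antisymm t.2.2 ht)
    obtain ⟨φ, h, -⟩ := isBoundaryPoint_one k
    exact ⟨φ, h⟩

theorem isBoundaryPoint_iff {x : Cylinder n} : IsBoundaryPoint x ↔ x.2 = 0 ∨ x.2 = 1 := by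
  obtain ⟨k, t⟩ := x
  constructor
  · intro h
    by_contra hcon
    simp only [not_or] at hcon
    have ht : (t : ℝ) ∈ Ioo (0 : ℝ) 1 :=
      ⟨lt_of_le_of_ne t.2.1 fun h => hcon.1 (Subtype.ext h.symm),
        lt_of_le_of_ne t.2.2 fun h => hcon.2 (Subtype.ext h)⟩
    have := not_isBoundaryPoint_of_injOn (Ioo_mem_nhds ht.1 ht.2)
      (continuous_line k).continuousOn ((injOn_line k).mono Ioo_subset_Icc_self)
    rw [line_eq t.2] at this
    exact this h
  · rintro (h | h)
    · obtain rfl : t = 0 := h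
      exact isBoundaryPoint_zero k
    · obtain rfl : t = 1 := h
      exact isBoundaryPoint_one k

/-- The cylinder with the orientation of the lines. -/
theorem exists_oriented (n : ℕ) : ∃ (N : OrientedOneManifold) (h : Cylinder n ≃ₜ N.carrier),
    ∀ k : Fin n, ∀ t ∈ Ioo (0 : ℝ) 1, N.Up (fun s => h (line k s)) t := by
  have hch : ∀ k : Fin n, ∃ ψ : OpenPartialHomeomorph (Cylinder n) ℝ,
      ψ.source = line k '' Ioo 0 1 ∧ ∀ t ∈ Ioo (0 : ℝ) 1, ψ (line k t) = t := by
    intro k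
    obtain ⟨ψ, hs, -, he, -⟩ := locallyHalfLine.exists_chart (isOpen_Ioo (a := (0 : ℝ)) (b := 1))
      (continuous_line k).continuousOn ((injOn_line k).mono Ioo_subset_Icc_self)
    exact ⟨ψ, hs, he⟩
  choose ψ hψs hψ using hch
  have hcov : ∀ x : Cylinder n, ¬ IsBoundaryPoint x → ∃ φ ∈ range ψ, x ∈ φ.source := by
    rintro ⟨k, t⟩ hx
    rw [isBoundaryPoint_iff, not_or] at hx
    refine ⟨ψ k, ⟨k, rfl⟩, ?_⟩
    rw [hψs]
    exact ⟨t, ⟨lt_of_le_of_ne t.2.1 fun h => hx.1 (Subtype.ext h.symm),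
        lt_of_le_of_ne t.2.2 fun h => hx.2 (Subtype.ext h)⟩, line_eq t.2⟩
  have hA : ∀ φ ∈ range ψ, ∀ φ' ∈ range ψ, OrientedTransition φ φ' := by
    rintro _ ⟨k, rfl⟩ _ ⟨k', rfl⟩ x ⟨hx, hx'⟩
    rw [hψs] at hx hx'
    obtain ⟨s, hs, rfl⟩ := hx
    obtain ⟨s', hs', h⟩ := hx'
    obtain ⟨rfl, -⟩ := line_injective (Ioo_subset_Icc_self hs') (Ioo_subset_Icc_self hs) h
    have hmem : line k' s ∈ (ψ k').source := by rw [hψs]; exact ⟨s, hs, rfl⟩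
    refine ⟨(ψ k').target, (ψ k').open_target.mem_nhds ((ψ k').map_source hmem),
      fun a ha b hb hab => ?_⟩
    simpa only [(ψ k').right_inv ha, (ψ k').right_inv hb] using hab
  refine ⟨.ofAtlas (Cylinder n) locallyHalfLine (range ψ) hcov hA, Homeomorph.refl _, ?_⟩
  intro k t ht
  refine ⟨ψ k, OrientedOneManifold.mem_atlas_ofAtlas ⟨k, rfl⟩, ?_, Ioo 0 1,
    Ioo_mem_nhds ht.1 ht.2, (continuous_line k).continuousOn, fun a ha b hb hab => ?_⟩
  · change line k t ∈ (ψ k).source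
    rw [hψs]; exact ⟨t, ht, rfl⟩
  · change ψ k (line k a) < ψ k (line k b)
    rwa [hψ k a ha, hψ k b hb]

end Cylinder

end Cylinder

/-! ### Cobordisms made of intervals with prescribed signs -/

section CylinderCobordism

open Set Filter

namespace OrientedOneManifold

theorem boundarySign_of_isPositive {M : OrientedOneManifold} {x : M.carrier} (h : M.IsPositive x) :
    M.boundarySign x = 1 := if_pos h

theorem boundarySign_of_not_isPositive {M : OrientedOneManifold} {x : M.carrier}
    (h : ¬ M.IsPositive x) : M.boundarySign x = -1 := if_neg h

theorem isPositive_of_boundarySign {M : OrientedOneManifold} {x : M.carrier}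
    (h : M.boundarySign x = 1) : M.IsPositive x := by
  by_contra hn
  rw [boundarySign_of_not_isPositive hn] at h
  exact absurd h (by decide)

theorem not_isPositive_of_boundarySign {M : OrientedOneManifold} {x : M.carrier}
    (h : M.boundarySign x = -1) : ¬ M.IsPositive x := fun hn => by
  rw [boundarySign_of_isPositive hn] at h
  exact absurd h (by decide)

end OrientedOneManifold

namespace Cylinder

variable {k : ℕ}

/-- The end points of the lines of a cylinder. -/
def endpoint (b : Fin k × Bool) : Cylinder k := (b.1, if b.2 then 1 else 0)

theorem endpoint_injective : Function.Injective (endpoint (k := k)) := by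
  rintro ⟨l, b⟩ ⟨l', b'⟩ h
  simp only [endpoint, Prod.mk.injEq] at h
  obtain ⟨rfl, h⟩ := h
  cases b <;> cases b' <;> simp_all

theorem range_endpoint : range (endpoint (k := k)) = {x | IsBoundaryPoint x} := by
  ext x
  rw [mem_ofPred_eq, isBoundaryPoint_iff]
  constructor
  · rintro ⟨⟨l, b⟩, rfl⟩
    cases b <;> simp [endpoint]
  · obtain ⟨l, t⟩ := x
    rintro (h | h)
    · exact ⟨(l, false), by simp [endpoint, ← h]⟩
    · exact ⟨(l, true), by simp [endpoint, ← h]⟩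

/-- The sign of an end point when the line over `l` starts at a point of sign `σ l`. -/
def endSign (σ : Fin k → ℤˣ) (b : Fin k × Bool) : ℤˣ := if b.2 then - σ b.1 else σ b.1

/-- Reversal of the lines of sign `-1`. -/
def twist (σ : Fin k → ℤˣ) : Cylinder k ≃ₜ Cylinder k where
  toFun x := (x.1, if σ x.1 = 1 then x.2 else unitInterval.symm x.2)
  invFun x := (x.1, if σ x.1 = 1 then x.2 else unitInterval.symm x.2)
  left_inv x := by by_cases h : σ x.1 = 1 <;> simp [h]
  right_inv x := by by_cases h : σ x.1 = 1 <;> simp [h]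
  continuous_toFun := continuous_prod_of_discrete_left.2 fun l => by
    by_cases h : σ l = 1
    · simp only [h, if_true]; fun_prop
    · simp only [h, if_false]; fun_prop
  continuous_invFun := continuous_prod_of_discrete_left.2 fun l => by
    by_cases h : σ l = 1
    · simp only [h, if_true]; fun_prop
    · simp only [h, if_false]; fun_prop

/-- With all lines oriented upwards the sign is 1 at height 0 and -1 at height 1. Precomposing with
`twist` turns the lines with σ = -1 upside down and so exchanges their two signs. -/
theorem exists_oriented_endSign (σ : Fin k → ℤˣ) :
    ∃ (N : OrientedOneManifold) (h : Cylinder k ≃ₜ N.carrier),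
      ∀ b, N.boundarySign (h (endpoint b)) = endSign σ b := by
  obtain ⟨N, h, hup⟩ := exists_oriented k
  have hzero : ∀ l : Fin k, N.boundarySign (h (l, 0)) = 1 := by
    intro l
    apply OrientedOneManifold.boundarySign_of_isPositive
    have := OrientedOneManifold.isPositive_of_up (M := N) (γ := fun s => h (line l s)) one_pos
      (by rw [line_zero]; exact isBoundaryPoint_homeomorph h (isBoundaryPoint_zero l))
      (h.continuous.comp (continuous_line l)).continuousOn
      (fun s hs t ht hst => injOn_line l (Ico_subset_Icc_self hs) (Ico_subset_Icc_self ht)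
        (h.injective hst)) (hup l)
    rwa [line_zero] at this
  have hone : ∀ l : Fin k, N.boundarySign (h (l, 1)) = -1 := by
    intro l
    apply OrientedOneManifold.boundarySign_of_not_isPositive
    have hm : ∀ s ∈ Icc (0 : ℝ) 1, 1 - s ∈ Icc (0 : ℝ) 1 := fun s hs =>
      ⟨by linarith [hs.2], by linarith [hs.1]⟩
    have := OrientedOneManifold.not_isPositive_of_down (M := N) (γ := fun s => h (line l (1 - s)))
      one_pos (by
        rw [sub_zero, line_one]; exact isBoundaryPoint_homeomorph h (isBoundaryPoint_one l))
      (h.continuous.comp ((continuous_line l).comp (by fun_prop))).continuousOn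
      (fun s hs t ht hst => by
        have := injOn_line l (hm s (Ico_subset_Icc_self hs)) (hm t (Ico_subset_Icc_self ht))
          (h.injective hst)
        linarith) (fun t ht => by
          have := hup l (1 - t) ⟨by linarith [ht.2], by linarith [ht.1]⟩
          refine OrientedOneManifold.Up.comp (f := fun s : ℝ => 1 - -s)
            (γ := fun s => h (line l s)) (by fun_prop) (fun a b hab => by simpa using hab) ?_
          simpa using this)
    rwa [sub_zero, line_one] at this
  refine ⟨N, (twist σ).trans h, ?_⟩
  rintro ⟨l, b⟩
  rcases Int.units_eq_one_or (σ l) with hσ | hσ <;> cases b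
  · simp [twist, endpoint, endSign, hσ, hzero]
  · simp [twist, endpoint, endSign, hσ, hone]
  · simp [twist, endpoint, endSign, hσ, hone]
  · simp [twist, endpoint, endSign, hσ, hzero]

/-- The cobordism given by a labelling of the end points of a cylinder. -/
theorem exists_cobordism {X Y : OneCob} (σ : Fin k → ℤˣ) (a : Fin X.n → Fin k × Bool)
    (c : Fin Y.n → Fin k × Bool) (hbij : Function.Bijective (Sum.elim a c))
    (ha : ∀ i, X.sign i = endSign σ (a i)) (hc : ∀ j, Y.sign j = - endSign σ (c j)) :
    ∃ (N : Cobordism X Y) (h : Cylinder k ≃ₜ N.M.carrier),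
      (∀ i, h (endpoint (a i)) = N.f₀ i) ∧ ∀ j, h (endpoint (c j)) = N.f₁ j := by
  obtain ⟨N, h, hsign⟩ := exists_oriented_endSign σ
  have hinj : Function.Injective fun b => h (endpoint b) := h.injective.comp endpoint_injective
  have hia : Function.Injective a := fun i j hij =>
    Sum.inl_injective (hbij.1 (a₁ := Sum.inl i) (a₂ := Sum.inl j) hij)
  have hic : Function.Injective c := fun i j hij =>
    Sum.inr_injective (hbij.1 (a₁ := Sum.inr i) (a₂ := Sum.inr j) hij)
  refine ⟨⟨N, fun i => h (endpoint (a i)), fun j => h (endpoint (c j)), hinj.comp hia,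
    hinj.comp hic, ?_, ?_, fun i => by rw [hsign, ha], fun j => by rw [hsign, hc, neg_neg]⟩, h,
    fun _ => rfl, fun _ => rfl⟩
  · rw [Set.disjoint_left]
    rintro _ ⟨i, rfl⟩ ⟨j, hj⟩
    have := hbij.1 (a₁ := Sum.inr j) (a₂ := Sum.inl i) (hinj hj)
    exact absurd this (by simp)
  · ext x
    rw [mem_ofPred_eq]
    have hx : IsBoundaryPoint x ↔ h.symm x ∈ range (endpoint (k := k)) := by
      rw [range_endpoint, mem_ofPred_eq, isBoundaryPoint_homeomorph_iff]
    rw [hx]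
    constructor
    · rintro (⟨i, rfl⟩ | ⟨i, rfl⟩)
      · exact ⟨a i, by simp⟩
      · exact ⟨c i, by simp⟩
    · rintro ⟨b, hb⟩
      obtain ⟨s, rfl⟩ := hbij.2 b
      rcases s with i | j
      · exact Or.inl ⟨i, by rw [← h.apply_symm_apply x, ← hb]; rfl⟩
      · exact Or.inr ⟨j, by rw [← h.apply_symm_apply x, ← hb]; rfl⟩

end Cylinder

end CylinderCobordism

/-! ### Local embeddings and disjoint unions -/

section Gluing

open Set Filter

section LocalEmbedding

variable {A B : Type*} [TopologicalSpace A] [TopologicalSpace B] {f : A → B} {U : Set A}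

theorem exists_chart_of_local_embedding {H : Type*} [TopologicalSpace H] (hU : IsOpen U)
    (hc : ContinuousOn f U) (hi : InjOn f U) (ho : ∀ x ∈ U, ∀ W ∈ 𝓝 x, f '' W ∈ 𝓝 (f x)) {x : A}
    (hx : x ∈ U) (φ : OpenPartialHomeomorph A H) (hφ : x ∈ φ.source) :
    ∃ ψ : OpenPartialHomeomorph B H, f x ∈ ψ.source ∧ ψ (f x) = φ x := by
  have : Nonempty H := ⟨φ x⟩
  have hV : IsOpen (φ.target ∩ φ.symm ⁻¹' U) := φ.symm.isOpen_inter_preimage hU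
  have hxV : φ x ∈ φ.target ∩ φ.symm ⁻¹' U :=
    ⟨φ.map_source hφ, by rw [mem_preimage, φ.left_inv hφ]; exact hx⟩
  obtain ⟨ψ, hψs, -, hψ, -⟩ := exists_openPartialHomeomorph_of_image_mem_nhds
    (g := fun t => f (φ.symm t)) hV
    (hc.comp (φ.continuousOn_symm.mono inter_subset_left) fun t ht => ht.2)
    (fun s hs t ht hst => φ.symm.injOn hs.1 ht.1 (hi hs.2 ht.2 hst))
    (fun t ht W hW hWV => by
      have := ho _ ht.2 _ (φ.symm.image_mem_nhds ht.1 hW)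
      rwa [image_image] at this)
  refine ⟨ψ, ?_, ?_⟩
  · rw [hψs]
    exact ⟨φ x, hxV, by simp only [φ.left_inv hφ]⟩
  · have := hψ (φ x) hxV
    rwa [φ.left_inv hφ] at this

/-- Half line charts are pushed forward, so boundary points stay on the boundary; two-sided
injective paths are pushed forward as well, so interior points stay in the interior. -/
theorem isBoundaryPoint_local_embedding_iff (hA : LocallyHalfLine A) (hU : IsOpen U)
    (hc : ContinuousOn f U) (hi : InjOn f U) (ho : ∀ x ∈ U, ∀ W ∈ 𝓝 x, f '' W ∈ 𝓝 (f x)) {x : A}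
    (hx : x ∈ U) : IsBoundaryPoint (f x) ↔ IsBoundaryPoint x := by
  constructor
  · intro h
    by_contra hn
    obtain ⟨γ, hγc, hγi, rfl⟩ := hA.exists_arc hn
    have h2 : Ioo (-2) 2 ∈ 𝓝 (0 : ℝ) := Ioo_mem_nhds (by norm_num) (by norm_num)
    have hW : Ioo (-2) 2 ∩ γ ⁻¹' U ∈ 𝓝 (0 : ℝ) :=
      inter_mem h2 ((hγc.continuousAt h2).preimage_mem_nhds (hU.mem_nhds hx))
    exact not_isBoundaryPoint_of_injOn (γ := fun t => f (γ t)) hW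
      (hc.comp (hγc.mono inter_subset_left) fun t ht => ht.2)
      (fun s hs t ht hst => hγi hs.1 ht.1 (hi hs.2 ht.2 hst)) h
  · rintro ⟨φ, hφ, h0⟩
    obtain ⟨ψ, hψ, he⟩ := exists_chart_of_local_embedding hU hc hi ho hx φ hφ
    exact ⟨ψ, hψ, by rw [he, h0]⟩

end LocalEmbedding

namespace Cobordism

theorem f₀_boundary {X Y : OneCob} (K : Cobordism X Y) (i : Fin X.n) : IsBoundaryPoint (K.f₀ i) :=
  K.boundary.subset (Or.inl ⟨i, rfl⟩)

theorem f₁_boundary {X Y : OneCob} (K : Cobordism X Y) (i : Fin Y.n) : IsBoundaryPoint (K.f₁ i) :=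
  K.boundary.subset (Or.inr ⟨i, rfl⟩)

theorem f₀_ne_f₁ {X Y : OneCob} (K : Cobordism X Y) (i : Fin X.n) (j : Fin Y.n) :
    K.f₀ i ≠ K.f₁ j := fun h => Set.disjoint_left.1 K.disjoint ⟨i, rfl⟩ ⟨j, h.symm⟩

/-- This is `OrientedOneManifold.exists_union` without junctions: each interior point of the sum
comes from an interior point of one summand. -/
theorem exists_isSideBySide {X Y X' Y' : OneCob} (K : Cobordism X Y) (L : Cobordism X' Y') :
    ∃ N, IsSideBySide K L N := by
  have hol : ∀ x ∈ (univ : Set K.M.carrier), ∀ W ∈ 𝓝 x,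
      (Sum.inl : _ → K.M.carrier ⊕ L.M.carrier) '' W ∈ 𝓝 (Sum.inl x) := fun x _ W hW =>
    IsOpenEmbedding.inl.isOpenMap.image_mem_nhds hW
  have hor : ∀ x ∈ (univ : Set L.M.carrier), ∀ W ∈ 𝓝 x,
      (Sum.inr : _ → K.M.carrier ⊕ L.M.carrier) '' W ∈ 𝓝 (Sum.inr x) := fun x _ W hW =>
    IsOpenEmbedding.inr.isOpenMap.image_mem_nhds hW
  have hbl : ∀ x : K.M.carrier,
      IsBoundaryPoint (Sum.inl x : K.M.carrier ⊕ L.M.carrier) ↔ IsBoundaryPoint x := fun x =>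
    isBoundaryPoint_local_embedding_iff K.M.locallyHalfLine isOpen_univ
      continuous_inl.continuousOn Sum.inl_injective.injOn hol (mem_univ x)
  have hbr : ∀ x : L.M.carrier,
      IsBoundaryPoint (Sum.inr x : K.M.carrier ⊕ L.M.carrier) ↔ IsBoundaryPoint x := fun x =>
    isBoundaryPoint_local_embedding_iff L.M.locallyHalfLine isOpen_univ
      continuous_inr.continuousOn Sum.inr_injective.injOn hor (mem_univ x)
  have hQ : LocallyHalfLine (K.M.carrier ⊕ L.M.carrier) := by
    rintro (x | x)
    · obtain ⟨φ, hφ⟩ := K.M.locallyHalfLine x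
      obtain ⟨ψ, hψ, -⟩ := exists_chart_of_local_embedding isOpen_univ
        continuous_inl.continuousOn Sum.inl_injective.injOn hol (mem_univ x) φ hφ
      exact ⟨ψ, hψ⟩
    · obtain ⟨φ, hφ⟩ := L.M.locallyHalfLine x
      obtain ⟨ψ, hψ, -⟩ := exists_chart_of_local_embedding isOpen_univ
        continuous_inr.continuousOn Sum.inr_injective.injOn hor (mem_univ x) φ hφ
      exact ⟨ψ, hψ⟩
  obtain ⟨N, h, hK, hL⟩ := OrientedOneManifold.exists_union K.M L.M hQ continuous_inl
    Sum.inl_injective continuous_inr Sum.inr_injective (fun x y _ _ => Sum.inl_ne_inr) (by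
      rintro (x | x) hx
      · exact Or.inl ⟨x, fun h => hx ((hbl x).2 h), rfl⟩
      · exact Or.inr (Or.inl ⟨x, fun h => hx ((hbr x).2 h), rfl⟩))
  have hbN : ∀ s, IsBoundaryPoint (h s) ↔ IsBoundaryPoint s := fun s =>
    isBoundaryPoint_homeomorph_iff h
  have hsl : ∀ x : K.M.carrier, IsBoundaryPoint x →
      N.boundarySign (h (Sum.inl x)) = K.M.boundarySign x := fun x hx =>
    hK.boundarySign_eq (h.continuous.comp continuous_inl) (h.injective.comp Sum.inl_injective) hx
      ((hbN _).2 ((hbl x).2 hx))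
  have hsr : ∀ x : L.M.carrier, IsBoundaryPoint x →
      N.boundarySign (h (Sum.inr x)) = L.M.boundarySign x := fun x hx =>
    hL.boundarySign_eq (h.continuous.comp continuous_inr) (h.injective.comp Sum.inr_injective) hx
      ((hbN _).2 ((hbr x).2 hx))
  have happ : ∀ {n m : ℕ} (f : Fin n → K.M.carrier) (g : Fin m → L.M.carrier),
      Function.Injective f → Function.Injective g → Function.Injective
        (Fin.append (fun i => h (Sum.inl (f i))) (fun j => h (Sum.inr (g j)))) := by
    intro n m f g hf hg a b hab
    induction a using Fin.addCases <;> induction b using Fin.addCases <;>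
      simp only [Fin.append_left, Fin.append_right, h.injective.eq_iff, Sum.inl.injEq,
        Sum.inr.injEq, reduceCtorEq] at hab
    · rw [hf hab]
    · rw [hg hab]
  have hran : ∀ {n m : ℕ} (f : Fin n → N.carrier) (g : Fin m → N.carrier),
      range (Fin.append f g) = range f ∪ range g := by
    intro n m f g
    ext x
    simp only [mem_range, mem_union]
    constructor
    · rintro ⟨a, rfl⟩
      induction a using Fin.addCases with
      | left i => exact Or.inl ⟨i, by simp⟩
      | right i => exact Or.inr ⟨i, by simp⟩
    · rintro (⟨i, rfl⟩ | ⟨i, rfl⟩)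
      · exact ⟨Fin.castAdd _ i, by simp⟩
      · exact ⟨Fin.natAdd _ i, by simp⟩
  refine ⟨⟨N, Fin.append (fun i => h (Sum.inl (K.f₀ i))) (fun j => h (Sum.inr (L.f₀ j))),
    Fin.append (fun i => h (Sum.inl (K.f₁ i))) (fun j => h (Sum.inr (L.f₁ j))),
    happ _ _ K.f₀_injective L.f₀_injective, happ _ _ K.f₁_injective L.f₁_injective, ?_, ?_, ?_,
    ?_⟩, h, hK, hL, ?_, ?_, ?_, ?_⟩
  · rw [hran, hran, Set.disjoint_left]
    rintro _ (⟨i, rfl⟩ | ⟨i, rfl⟩) (⟨j, hj⟩ | ⟨j, hj⟩)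
    · exact K.f₀_ne_f₁ i j (Sum.inl_injective (h.injective hj)).symm
    · exact absurd (h.injective hj) Sum.inr_ne_inl
    · exact absurd (h.injective hj) Sum.inl_ne_inr
    · exact L.f₀_ne_f₁ i j (Sum.inr_injective (h.injective hj)).symm
  · rw [hran, hran]
    ext x
    obtain ⟨s, rfl⟩ := h.surjective x
    rw [mem_ofPred_eq, hbN]
    have hKb := Set.ext_iff.1 K.boundary
    have hLb := Set.ext_iff.1 L.boundary
    simp only [mem_union, mem_range, mem_ofPred_eq] at hKb hLb
    rcases s with x | x
    · rw [hbl, ← hKb]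
      simp [h.injective.eq_iff]
    · rw [hbr, ← hLb]
      simp [h.injective.eq_iff]
  · intro i
    change _ = Fin.append X.sign X'.sign i
    induction i using Fin.addCases with
    | left i => simp [hsl _ (K.f₀_boundary i), K.f₀_sign]
    | right i => simp [hsr _ (L.f₀_boundary i), L.f₀_sign]
  · intro i
    change _ = - Fin.append Y.sign Y'.sign i
    induction i using Fin.addCases with
    | left i => simp [hsl _ (K.f₁_boundary i), K.f₁_sign]
    | right i => simp [hsr _ (L.f₁_boundary i), L.f₁_sign]
  · exact fun i => (Fin.append_left (fun i => h (Sum.inl (K.f₀ i)))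
      (fun j => h (Sum.inr (L.f₀ j))) i).symm
  · exact fun i => (Fin.append_right (fun i => h (Sum.inl (K.f₀ i)))
      (fun j => h (Sum.inr (L.f₀ j))) i).symm
  · exact fun i => (Fin.append_left (fun i => h (Sum.inl (K.f₁ i)))
      (fun j => h (Sum.inr (L.f₁ j))) i).symm
  · exact fun i => (Fin.append_right (fun i => h (Sum.inl (K.f₁ i)))
      (fun j => h (Sum.inr (L.f₁ j))) i).symm

end Cobordism

end Gluing

/-! ### The glued manifold and existence of composites -/

section GluedManifold

open Set Filter

/-- Tietze extension from a finite, hence closed and discrete, subset. It provides the functions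
that separate points of the glued space. -/
theorem exists_continuousMap_eq_on_finite {A : Type*} [TopologicalSpace A] [T2Space A]
    [CompactSpace A] {S : Set A} (hS : S.Finite) (v : A → ℝ) :
    ∃ f : C(A, ℝ), ∀ x ∈ S, f x = v x := by
  have : Finite S := hS
  have : DiscreteTopology S := inferInstance
  obtain ⟨g, hg⟩ := ContinuousMap.exists_restrict_eq (Y := ℝ) hS.isClosed
    ⟨fun x : S => v x, continuous_of_discreteTopology⟩
  exact ⟨g, fun x hx => congrArg (fun f => f ⟨x, hx⟩) hg⟩

/-- The chart is translated so that x gets the coordinate 1, safely inside the half line. -/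
theorem exists_halfLine_chart_of_real_chart {A : Type*} [TopologicalSpace A]
    (ψ : OpenPartialHomeomorph A ℝ) {x : A} (hx : x ∈ ψ.source) :
    ∃ φ : OpenPartialHomeomorph A HalfLine, x ∈ φ.source := by
  have hV : IsOpen {s : HalfLine | 0 < (s : ℝ) ∧ (s : ℝ) - 1 + ψ x ∈ ψ.target} :=
    (isOpen_lt continuous_const continuous_subtype_val).inter
      (ψ.open_target.preimage (by fun_prop : Continuous fun s : HalfLine => (s : ℝ) - 1 + ψ x))
  obtain ⟨φ, hφs, -⟩ := exists_openPartialHomeomorph_of_image_mem_nhds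
    (g := fun s : HalfLine => ψ.symm ((s : ℝ) - 1 + ψ x)) hV
    (ψ.continuousOn_symm.comp (by fun_prop) fun s hs => hs.2)
    (fun s hs t ht hst => Subtype.ext (by simpa using ψ.symm.injOn hs.2 ht.2 hst))
    (fun t ht U hU hUV => by
      have hmem : ψ.symm ((t : ℝ) - 1 + ψ x) ∈ ψ.source := ψ.map_target ht.2
      have hcr : ContinuousAt (fun w => ψ w - ψ x + 1) (ψ.symm ((t : ℝ) - 1 + ψ x)) :=
        ((ψ.continuousAt hmem).sub continuousAt_const).add continuousAt_const
      have hval : ψ (ψ.symm ((t : ℝ) - 1 + ψ x)) - ψ x + 1 = t := by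
        rw [ψ.right_inv ht.2]; ring
      have h1 := (continuous_toHalfLine.continuousAt.comp hcr).preimage_mem_nhds (t := U)
        (by simp only [Function.comp_apply]; rw [hval, toHalfLine_coe]; exact hU)
      have h2 := hcr.preimage_mem_nhds (t := Ioi 0) (by rw [hval]; exact Ioi_mem_nhds ht.1)
      filter_upwards [h1, h2, ψ.open_source.mem_nhds hmem] with w hw hw0 hws
      refine ⟨_, hw, ?_⟩
      simp only [Function.comp_apply]
      rw [coe_toHalfLine (le_of_lt hw0), add_sub_cancel_right, sub_add_cancel, ψ.left_inv hws])
  refine ⟨φ, ?_⟩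
  rw [hφs]
  refine ⟨⟨1, mem_Ici.2 zero_le_one⟩, ⟨one_pos, ?_⟩, ?_⟩
  · simpa using ψ.map_source hx
  · simpa using ψ.left_inv hx

namespace Cobordism

variable {X Y Z : OneCob} (K : Cobordism X Y) (L : Cobordism Y Z)

namespace Glued

theorem inl_f₁ (y : Fin Y.n) : inl K L (K.f₁ y) = inr K L (L.f₀ y) := Quot.sound ⟨y, rfl, rfl⟩

theorem continuous_mk :
    Continuous (Quot.mk _ : K.M.carrier ⊕ L.M.carrier → Glued K L) := continuous_quot_mk

theorem continuous_inl : Continuous (inl K L) := (continuous_mk K L).comp _root_.continuous_inl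

theorem continuous_inr : Continuous (inr K L) := (continuous_mk K L).comp _root_.continuous_inr

open Classical in
/-- A representative of a point of the glued space, in the first piece if possible. -/
noncomputable def rep : Glued K L → K.M.carrier ⊕ L.M.carrier :=
  Quot.lift (Sum.elim Sum.inl fun z =>
    if h : ∃ y, L.f₀ y = z then Sum.inl (K.f₁ h.choose) else Sum.inr z) (by
      rintro _ _ ⟨y, rfl, rfl⟩
      have h : ∃ y', L.f₀ y' = L.f₀ y := ⟨y, rfl⟩
      have hy : h.choose = y := L.f₀_injective h.choose_spec
      simp [h, hy])

theorem rep_inl (x : K.M.carrier) : rep K L (inl K L x) = Sum.inl x := rfl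

theorem rep_inr_of_notMem {z : L.M.carrier} (h : z ∉ range L.f₀) :
    rep K L (inr K L z) = Sum.inr z := by
  have : ¬ ∃ y, L.f₀ y = z := h
  exact dif_neg this

theorem inl_injective : Function.Injective (inl K L) := fun x x' h => by
  have := congrArg (rep K L) h
  simpa [rep_inl] using this

theorem inl_eq_inr {x : K.M.carrier} {z : L.M.carrier} (h : inl K L x = inr K L z) :
    ∃ y, K.f₁ y = x ∧ L.f₀ y = z := by
  by_cases hz : z ∈ range L.f₀
  · obtain ⟨y, rfl⟩ := hz
    rw [← inl_f₁] at h
    exact ⟨y, (inl_injective K L h).symm, rfl⟩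
  · have := congrArg (rep K L) h
    rw [rep_inl, rep_inr_of_notMem K L hz] at this
    exact absurd this Sum.inl_ne_inr

theorem inr_injective : Function.Injective (inr K L) := fun z z' h => by
  by_cases hz : z ∈ range L.f₀
  · obtain ⟨y, rfl⟩ := hz
    rw [← inl_f₁] at h
    obtain ⟨y', h1, h2⟩ := inl_eq_inr K L h
    rw [← h2, K.f₁_injective h1]
  · by_cases hz' : z' ∈ range L.f₀
    · obtain ⟨y, rfl⟩ := hz'
      rw [← inl_f₁] at h
      obtain ⟨y', h1, h2⟩ := inl_eq_inr K L h.symm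
      rw [← h2, K.f₁_injective h1]
    · have := congrArg (rep K L) h
      rw [rep_inr_of_notMem K L hz, rep_inr_of_notMem K L hz'] at this
      exact Sum.inr_injective this

theorem cases (q : Glued K L) : (∃ x, x ∉ range K.f₁ ∧ inl K L x = q) ∨
    (∃ z, z ∉ range L.f₀ ∧ inr K L z = q) ∨ ∃ y, inl K L (K.f₁ y) = q := by
  induction q using Quot.ind with
  | mk s =>
    rcases s with x | z
    · by_cases hx : x ∈ range K.f₁
      · obtain ⟨y, rfl⟩ := hx
        exact Or.inr (Or.inr ⟨y, rfl⟩)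
      · exact Or.inl ⟨x, hx, rfl⟩
    · by_cases hz : z ∈ range L.f₀
      · obtain ⟨y, rfl⟩ := hz
        exact Or.inr (Or.inr ⟨y, inl_f₁ K L y⟩)
      · exact Or.inr (Or.inl ⟨z, hz, rfl⟩)

instance : CompactSpace (Glued K L) := inferInstanceAs (CompactSpace (Quot _))

/-- Two points are separated by a real function. On each piece it is prescribed on the finite set of
glued points and preimages of q and q', with the values of the indicator of q', and extended
continuously; the two extensions agree on the glued points and descend to the quotient. -/
instance : T2Space (Glued K L) := by
  classical
  refine ⟨fun q q' hqq => ?_⟩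
  let v : Glued K L → ℝ := fun w => if w = q' then 1 else 0
  have hfin : ∀ {A : Type} (f : A → Glued K L), Function.Injective f →
      {x | f x = q ∨ f x = q'}.Finite := fun f hf =>
    ((Set.finite_singleton q).union (Set.finite_singleton q')).preimage hf.injOn
  obtain ⟨f, hf⟩ := exists_continuousMap_eq_on_finite
    ((finite_range K.f₁).union (hfin _ (inl_injective K L))) fun x => v (inl K L x)
  obtain ⟨g, hg⟩ := exists_continuousMap_eq_on_finite
    ((finite_range L.f₀).union (hfin _ (inr_injective K L))) fun x => v (inr K L x)
  let F : Glued K L → ℝ := Quot.lift (Sum.elim f g) (by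
    rintro _ _ ⟨y, rfl, rfl⟩
    simp only [Sum.elim_inl, Sum.elim_inr]
    rw [hf _ (Or.inl ⟨y, rfl⟩), hg _ (Or.inl ⟨y, rfl⟩), inl_f₁])
  have hF : Continuous F := continuous_quot_lift _ (f.continuous.sumElim g.continuous)
  have key : ∀ w, w = q ∨ w = q' → F w = v w := by
    intro w hw
    induction w using Quot.ind with
    | mk s =>
      rcases s with x | x
      · exact hf x (Or.inr hw)
      · exact hg x (Or.inr hw)
  refine separated_by_continuous hF ?_
  rw [key q (Or.inl rfl), key q' (Or.inr rfl)]
  simp [v, hqq]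

theorem isOpen_image {W : Set K.M.carrier} {W' : Set L.M.carrier} (hW : IsOpen W)
    (hW' : IsOpen W') (h : ∀ y, K.f₁ y ∈ W ↔ L.f₀ y ∈ W') :
    IsOpen (inl K L '' W ∪ inr K L '' W') := by
  change IsOpen (Quot.mk _ ⁻¹' (inl K L '' W ∪ inr K L '' W') : Set (K.M.carrier ⊕ L.M.carrier))
  rw [isOpen_sum_iff]
  constructor
  · convert hW using 1
    ext x
    constructor
    · rintro (⟨x', hx', he⟩ | ⟨z, hz, he⟩)
      · rwa [← inl_injective K L he]
      · obtain ⟨y, rfl, rfl⟩ := inl_eq_inr K L he.symm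
        exact (h y).2 hz
    · exact fun hx => Or.inl ⟨x, hx, rfl⟩
  · convert hW' using 1
    ext x
    constructor
    · rintro (⟨x', hx', he⟩ | ⟨z, hz, he⟩)
      · obtain ⟨y, rfl, rfl⟩ := inl_eq_inr K L he
        exact (h y).1 hx'
      · rwa [← inr_injective K L he]
    · exact fun hx => Or.inr ⟨x, hx, rfl⟩

theorem image_inl_mem_nhds {x : K.M.carrier} (hx : x ∉ range K.f₁) {W : Set K.M.carrier}
    (hW : W ∈ 𝓝 x) : inl K L '' W ∈ 𝓝 (inl K L x) := by
  obtain ⟨V, hVW, hV, hxV⟩ := mem_nhds_iff.1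
    (inter_mem hW ((finite_range K.f₁).isClosed.isOpen_compl.mem_nhds hx))
  have := isOpen_image K L hV isOpen_empty (fun y =>
    ⟨fun hy => absurd ⟨y, rfl⟩ (hVW hy).2, fun hy => absurd hy (notMem_empty _)⟩)
  rw [image_empty, union_empty] at this
  exact mem_of_superset (this.mem_nhds ⟨x, hxV, rfl⟩)
    (image_mono (hVW.trans inter_subset_left))

theorem image_inr_mem_nhds {x : L.M.carrier} (hx : x ∉ range L.f₀) {W : Set L.M.carrier}
    (hW : W ∈ 𝓝 x) : inr K L '' W ∈ 𝓝 (inr K L x) := by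
  obtain ⟨V, hVW, hV, hxV⟩ := mem_nhds_iff.1
    (inter_mem hW ((finite_range L.f₀).isClosed.isOpen_compl.mem_nhds hx))
  have := isOpen_image K L isOpen_empty hV (fun y =>
    ⟨fun hy => absurd hy (notMem_empty _), fun hy => absurd ⟨y, rfl⟩ (hVW hy).2⟩)
  rw [image_empty, empty_union] at this
  exact mem_of_superset (this.mem_nhds ⟨x, hxV, rfl⟩)
    (image_mono (hVW.trans inter_subset_left))

/-- Shrinking both neighbourhoods until they contain no other glued point makes their union
saturated, hence open in the quotient. -/
theorem image_union_mem_nhds (y : Fin Y.n) {W : Set K.M.carrier} {W' : Set L.M.carrier}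
    (hW : W ∈ 𝓝 (K.f₁ y)) (hW' : W' ∈ 𝓝 (L.f₀ y)) :
    inl K L '' W ∪ inr K L '' W' ∈ 𝓝 (inl K L (K.f₁ y)) := by
  have h1 : W ∩ (K.f₁ '' {y}ᶜ)ᶜ ∈ 𝓝 (K.f₁ y) := by
    refine inter_mem hW (((Set.toFinite _).isClosed.isOpen_compl).mem_nhds ?_)
    rintro ⟨y', hy', he⟩
    exact hy' (K.f₁_injective he)
  have h2 : W' ∩ (L.f₀ '' {y}ᶜ)ᶜ ∈ 𝓝 (L.f₀ y) := by
    refine inter_mem hW' (((Set.toFinite _).isClosed.isOpen_compl).mem_nhds ?_)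
    rintro ⟨y', hy', he⟩
    exact hy' (L.f₀_injective he)
  obtain ⟨V, hVW, hV, hxV⟩ := mem_nhds_iff.1 h1
  obtain ⟨V', hVW', hV', hxV'⟩ := mem_nhds_iff.1 h2
  have := isOpen_image K L hV hV' (fun y' => by
    constructor
    · intro h
      have : y' = y := by
        by_contra hne
        exact (hVW h).2 ⟨y', hne, rfl⟩
      rwa [this]
    · intro h
      have : y' = y := by
        by_contra hne
        exact (hVW' h).2 ⟨y', hne, rfl⟩
      rwa [this])
  exact mem_of_superset (this.mem_nhds (Or.inl ⟨_, hxV, rfl⟩))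
    (union_subset_union (image_mono (hVW.trans inter_subset_left))
      (image_mono (hVW'.trans inter_subset_left)))

/-- A path across a glued point. -/
theorem exists_path (y : Fin Y.n) : ∃ γ : ℝ → Glued K L, γ 0 = inl K L (K.f₁ y) ∧
    ContinuousOn γ (Ioo (-1) 1) ∧ InjOn γ (Ioo (-1) 1) ∧
    (∀ s ∈ Ioo (-1 : ℝ) 1, ∀ U ∈ 𝓝 s, U ⊆ Ioo (-1) 1 → γ '' U ∈ 𝓝 (γ s)) ∧
    ∀ s ∈ Ioo (-1 : ℝ) 1, s ≠ 0 →
      if Y.sign y = 1 then K.M.IsImageOfUp (inl K L) γ s ∨ L.M.IsImageOfUp (inr K L) γ s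
      else K.M.IsImageOfUp (inl K L) (fun u => γ (-u)) (-s) ∨
        L.M.IsImageOfUp (inr K L) (fun u => γ (-u)) (-s) := by
  obtain ⟨a, hac, hai, ha0⟩ := (K.f₁_boundary y).exists_arc
  obtain ⟨b, hbc, hbi, hb0⟩ := (L.f₀_boundary y).exists_arc
  have haN : ∀ s ∈ Ioo (0 : ℝ) 1, ¬ IsBoundaryPoint (a s) := fun s hs =>
    not_isBoundaryPoint_of_injOn (Icc_mem_nhds hs.1 hs.2) hac hai
  have hbN : ∀ s ∈ Ioo (0 : ℝ) 1, ¬ IsBoundaryPoint (b s) := fun s hs =>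
    not_isBoundaryPoint_of_injOn (Icc_mem_nhds hs.1 hs.2) hbc hbi
  have haR : ∀ s ∈ Ioo (0 : ℝ) 1, a s ∉ range K.f₁ := by
    rintro s hs ⟨y', hy'⟩
    exact haN s hs (hy' ▸ K.f₁_boundary y')
  have hbR : ∀ s ∈ Ioo (0 : ℝ) 1, b s ∉ range L.f₀ := by
    rintro s hs ⟨y', hy'⟩
    exact hbN s hs (hy' ▸ L.f₀_boundary y')
  -- For negative parameters the path runs in K towards the glued point, for positive ones it runs
  -- away from it in L.
  set γ : ℝ → Glued K L := fun s => if s ≤ 0 then inl K L (a (-s)) else inr K L (b s) with hγ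
  have hneg : ∀ s ≤ 0, γ s = inl K L (a (-s)) := fun s hs => if_pos hs
  have hpos : ∀ s, 0 < s → γ s = inr K L (b s) := fun s hs => if_neg (not_le.2 hs)
  have h0 : γ 0 = inl K L (K.f₁ y) := by rw [hneg 0 le_rfl, neg_zero, ha0]
  have hnonneg : ∀ s, 0 ≤ s → γ s = inr K L (b s) := by
    intro s hs
    rcases eq_or_lt_of_le hs with rfl | hs
    · rw [h0, hb0, inl_f₁]
    · exact hpos s hs
  have hc : ContinuousOn γ (Icc (-1) 1) := by
    have h1 : ContinuousOn γ (Icc (-1) 0) := by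
      refine ((continuous_inl K L).comp_continuousOn
        (hac.comp (f := fun s : ℝ => -s) (by fun_prop) fun s hs => ?_)).congr
        fun s hs => hneg s hs.2
      exact ⟨by linarith [hs.2], by linarith [hs.1]⟩
    have h2 : ContinuousOn γ (Icc 0 1) :=
      ((continuous_inr K L).comp_continuousOn hbc).congr fun s hs => hnonneg s hs.1
    refine (h1.union_of_isClosed h2 isClosed_Icc isClosed_Icc).mono fun s hs => ?_
    rcases le_total s 0 with h | h
    · exact Or.inl ⟨hs.1, h⟩
    · exact Or.inr ⟨h, hs.2⟩
  have hi : InjOn γ (Ioo (-1) 1) := by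
    have key : ∀ s ∈ Ioo (-1 : ℝ) 1, ∀ t ∈ Ioo (-1 : ℝ) 1, s ≤ 0 → 0 < t → γ s ≠ γ t := by
      intro s hs t ht hs0 ht0 h
      rw [hneg s hs0, hpos t ht0] at h
      obtain ⟨y', -, h2⟩ := inl_eq_inr K L h
      exact hbR t ⟨ht0, ht.2⟩ ⟨y', h2⟩
    intro s hs t ht hst
    rcases le_or_gt s 0 with hs0 | hs0 <;> rcases le_or_gt t 0 with ht0 | ht0
    · rw [hneg s hs0, hneg t ht0] at hst
      have := hai ⟨by linarith, by linarith [hs.1]⟩ ⟨by linarith, by linarith [ht.1]⟩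
        (inl_injective K L hst)
      linarith
    · exact absurd hst (key s hs t ht hs0 ht0)
    · exact absurd hst.symm (key t ht s hs ht0 hs0)
    · rw [hpos s hs0, hpos t ht0] at hst
      exact hbi ⟨hs0.le, hs.2.le⟩ ⟨ht0.le, ht.2.le⟩ (inr_injective K L hst)
  have hevn : ∀ s < 0, γ =ᶠ[𝓝 s] fun u => inl K L (a (-u)) := fun s hs => by
    filter_upwards [Iio_mem_nhds hs] with u hu
    exact hneg u (le_of_lt hu)
  have hevp : ∀ s, 0 < s → γ =ᶠ[𝓝 s] fun u => inr K L (b u) := fun s hs => by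
    filter_upwards [Ioi_mem_nhds hs] with u hu
    exact hpos u hu
  refine ⟨γ, h0, hc.mono Ioo_subset_Icc_self, hi, ?_, ?_⟩
  · intro s hs U hU hU1
    rcases lt_trichotomy s 0 with hs0 | rfl | hs0
    · have hs' : -s ∈ Ioo (0 : ℝ) 1 := ⟨by linarith, by linarith [hs.1]⟩
      have hW : Ioo 0 1 ∩ Neg.neg ⁻¹' U ∈ 𝓝 (-s) := inter_mem (Ioo_mem_nhds hs'.1 hs'.2)
        (continuous_neg.continuousAt.preimage_mem_nhds (by rwa [neg_neg]))
      have hsub : Ioo 0 1 ∩ Neg.neg ⁻¹' U ⊆ Icc (0 : ℝ) 1 :=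
        inter_subset_left.trans Ioo_subset_Icc_self
      have := image_inl_mem_nhds K L (haR (-s) hs')
        (K.M.locallyHalfLine.image_mem_nhds hW (hac.mono hsub) (hai.mono hsub))
      rw [hneg s hs0.le]
      refine mem_of_superset this ?_
      rintro _ ⟨_, ⟨u, hu, rfl⟩, rfl⟩
      refine ⟨-u, hu.2, ?_⟩
      rw [hneg (-u) (by linarith [hu.1.1]), neg_neg]
    · obtain ⟨ε, hε, hεU⟩ := exists_Icc_subset_of_mem_nhds hU
      have hmin : 0 < min ε 1 := lt_min hε one_pos
      have hsub : Ico 0 (min ε 1) ⊆ Icc (0 : ℝ) 1 := fun s hs =>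
        ⟨hs.1, hs.2.le.trans (min_le_right _ _)⟩
      have h1 := IsBoundaryPoint.image_mem_nhds hmin (ha0 ▸ K.f₁_boundary y) (hac.mono hsub)
        (hai.mono hsub)
      have h2 := IsBoundaryPoint.image_mem_nhds hmin (hb0 ▸ L.f₀_boundary y) (hbc.mono hsub)
        (hbi.mono hsub)
      rw [ha0] at h1
      rw [hb0] at h2
      rw [h0]
      refine mem_of_superset (image_union_mem_nhds K L y h1 h2) ?_
      rintro _ (⟨_, ⟨u, hu, rfl⟩, rfl⟩ | ⟨_, ⟨u, hu, rfl⟩, rfl⟩)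
      · have := hu.2.trans_le (min_le_left _ _)
        refine ⟨-u, hεU ⟨by linarith, by linarith [hu.1]⟩, ?_⟩
        rw [hneg (-u) (by linarith [hu.1]), neg_neg]
      · have := hu.2.trans_le (min_le_left _ _)
        exact ⟨u, hεU ⟨by linarith [hu.1], by linarith⟩, hnonneg u hu.1⟩
    · have hs' : s ∈ Ioo (0 : ℝ) 1 := ⟨hs0, hs.2⟩
      have hW : Ioo 0 1 ∩ U ∈ 𝓝 s := inter_mem (Ioo_mem_nhds hs'.1 hs'.2) hU
      have hsub : Ioo 0 1 ∩ U ⊆ Icc (0 : ℝ) 1 := inter_subset_left.trans Ioo_subset_Icc_self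
      have := image_inr_mem_nhds K L (hbR s hs')
        (L.M.locallyHalfLine.image_mem_nhds hW (hbc.mono hsub) (hbi.mono hsub))
      rw [hpos s hs0]
      refine mem_of_superset this ?_
      rintro _ ⟨_, ⟨u, hu, rfl⟩, rfl⟩
      exact ⟨u, hu.2, hpos u hu.1.1⟩
  · have hIco : Ico (0 : ℝ) 1 ⊆ Icc 0 1 := Ico_subset_Icc_self
    have haIco := hac.mono hIco
    have haIcoi := hai.mono hIco
    have hbIco := hbc.mono hIco
    have hbIcoi := hbi.mono hIco
    have hposa : ∀ t ∈ Ioo (0 : ℝ) 1, (K.M.IsPositive (a 0) ↔ K.M.Up a t) := fun t ht =>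
      OrientedOneManifold.isPositive_iff_up (ha0 ▸ K.f₁_boundary y) haIco haIcoi ht
    have hposb : ∀ t ∈ Ioo (0 : ℝ) 1, (L.M.IsPositive (b 0) ↔ L.M.Up b t) := fun t ht =>
      OrientedOneManifold.isPositive_iff_up (hb0 ▸ L.f₀_boundary y) hbIco hbIcoi ht
    have hnega : ∀ t ∈ Ioo (0 : ℝ) 1, ¬ K.M.IsPositive (a 0) → K.M.Down a t := fun t ht h =>
      (OrientedOneManifold.up_or_down (Icc_mem_nhds ht.1 ht.2) hac hai).resolve_left
        fun h' => h ((hposa t ht).2 h')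
    have hnegb : ∀ t ∈ Ioo (0 : ℝ) 1, ¬ L.M.IsPositive (b 0) → L.M.Down b t := fun t ht h =>
      (OrientedOneManifold.up_or_down (Icc_mem_nhds ht.1 ht.2) hbc hbi).resolve_left
        fun h' => h ((hposb t ht).2 h')
    -- The glued point has sign `-Y.sign y` on the side of K and `Y.sign y` on the side of L. If the
    -- latter is 1, the arc in L goes up and the arc in K goes down, so γ, which traverses the arc
    -- in K backwards, goes up on both sides. If it is -1, the same holds for the reversed path.
    have hsK := K.f₁_sign y
    have hsL := L.f₀_sign y
    rw [← ha0] at hsK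
    rw [← hb0] at hsL
    have hcneg : ∀ s : ℝ, Tendsto (fun u : ℝ => -u) (𝓝 (-s)) (𝓝 s) := fun s => by
      simpa using (continuous_neg (G := ℝ)).tendsto (-s)
    intro s hs hs0
    rcases Int.units_eq_one_or (Y.sign y) with hσ | hσ
    · rw [if_pos hσ]
      rw [hσ] at hsK hsL
      rcases lt_or_gt_of_ne hs0 with hs0 | hs0
      · refine Or.inl ⟨fun u => a (-u), ?_, hevn s hs0⟩
        have := hnega (-s) ⟨by linarith, by linarith [hs.1]⟩
          (OrientedOneManifold.not_isPositive_of_boundarySign hsK)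
        rwa [OrientedOneManifold.Down, neg_neg] at this
      · exact Or.inr ⟨b, (hposb s ⟨hs0, hs.2⟩).1
          (OrientedOneManifold.isPositive_of_boundarySign hsL), hevp s hs0⟩
    · rw [if_neg (by rw [hσ]; decide)]
      rw [hσ] at hsK hsL
      rw [neg_neg] at hsK
      rcases lt_or_gt_of_ne hs0 with hs0 | hs0
      · refine Or.inl ⟨a, (hposa (-s) ⟨by linarith, by linarith [hs.1]⟩).1
          (OrientedOneManifold.isPositive_of_boundarySign hsK), ?_⟩
        filter_upwards [(hcneg s).eventually (hevn s hs0)] with u hu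
        rw [hu, neg_neg]
      · exact Or.inr ⟨fun u => b (-u), hnegb s ⟨hs0, hs.2⟩
          (OrientedOneManifold.not_isPositive_of_boundarySign hsL),
          (hcneg s).eventually (hevp s hs0)⟩

theorem exists_chart (y : Fin Y.n) : ∃ ψ : OpenPartialHomeomorph (Glued K L) ℝ,
    inl K L (K.f₁ y) ∈ ψ.source := by
  obtain ⟨γ, h0, hc, hi, ho, -⟩ := exists_path K L y
  obtain ⟨ψ, hψs, -⟩ := exists_openPartialHomeomorph_of_image_mem_nhds isOpen_Ioo hc hi ho
  exact ⟨ψ, by rw [hψs]; exact ⟨0, by norm_num, h0⟩⟩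

theorem not_isBoundaryPoint (y : Fin Y.n) : ¬ IsBoundaryPoint (inl K L (K.f₁ y)) := by
  obtain ⟨ψ, hψ⟩ := exists_chart K L y
  exact ψ.not_isBoundaryPoint hψ

theorem isBoundaryPoint_inl_iff {x : K.M.carrier} (hx : x ∉ range K.f₁) :
    IsBoundaryPoint (inl K L x) ↔ IsBoundaryPoint x :=
  isBoundaryPoint_local_embedding_iff K.M.locallyHalfLine
    (finite_range K.f₁).isClosed.isOpen_compl (continuous_inl K L).continuousOn
    (inl_injective K L).injOn (fun _ h _ hW => image_inl_mem_nhds K L h hW) hx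

theorem isBoundaryPoint_inr_iff {x : L.M.carrier} (hx : x ∉ range L.f₀) :
    IsBoundaryPoint (inr K L x) ↔ IsBoundaryPoint x :=
  isBoundaryPoint_local_embedding_iff L.M.locallyHalfLine
    (finite_range L.f₀).isClosed.isOpen_compl (continuous_inr K L).continuousOn
    (inr_injective K L).injOn (fun _ h _ hW => image_inr_mem_nhds K L h hW) hx

theorem locallyHalfLine : LocallyHalfLine (Glued K L) := by
  intro q
  rcases cases K L q with ⟨x, hx, rfl⟩ | ⟨x, hx, rfl⟩ | ⟨y, rfl⟩
  · obtain ⟨φ, hφ⟩ := K.M.locallyHalfLine x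
    obtain ⟨ψ, hψ, -⟩ := exists_chart_of_local_embedding
      (finite_range K.f₁).isClosed.isOpen_compl (continuous_inl K L).continuousOn
      (inl_injective K L).injOn (fun _ h _ hW => image_inl_mem_nhds K L h hW) hx φ hφ
    exact ⟨ψ, hψ⟩
  · obtain ⟨φ, hφ⟩ := L.M.locallyHalfLine x
    obtain ⟨ψ, hψ, -⟩ := exists_chart_of_local_embedding
      (finite_range L.f₀).isClosed.isOpen_compl (continuous_inr K L).continuousOn
      (inr_injective K L).injOn (fun _ h _ hW => image_inr_mem_nhds K L h hW) hx φ hφ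
    exact ⟨ψ, hψ⟩
  · obtain ⟨ψ, hψ⟩ := exists_chart K L y
    exact exists_halfLine_chart_of_real_chart ψ hψ

end Glued

theorem exists_isComposite : ∃ N, IsComposite K L N := by
  obtain ⟨N, h, hK, hL⟩ := OrientedOneManifold.exists_union K.M L.M (Glued.locallyHalfLine K L)
    (Glued.continuous_inl K L) (Glued.inl_injective K L) (Glued.continuous_inr K L)
    (Glued.inr_injective K L) (fun x y hx _ he => by
      obtain ⟨y', rfl, -⟩ := Glued.inl_eq_inr K L he
      exact hx (K.f₁_boundary y')) (fun q hq => by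
      rcases Glued.cases K L q with ⟨x, hx, rfl⟩ | ⟨x, hx, rfl⟩ | ⟨y, rfl⟩
      · exact Or.inl ⟨x, fun h => hq ((Glued.isBoundaryPoint_inl_iff K L hx).2 h), rfl⟩
      · exact Or.inr (Or.inl ⟨x, fun h => hq ((Glued.isBoundaryPoint_inr_iff K L hx).2 h), rfl⟩)
      · obtain ⟨γ, h0, hc, hi, -, hup⟩ := Glued.exists_path K L y
        have hn : Ioo (-1) 1 ∈ 𝓝 (0 : ℝ) := Ioo_mem_nhds (by norm_num) (by norm_num)
        have hm : ∀ s ∈ Ioo (-1 : ℝ) 1, -s ∈ Ioo (-1 : ℝ) 1 := fun s hs =>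
          ⟨by linarith [hs.2], by linarith [hs.1]⟩
        -- `OrientedOneManifold.exists_union` wants a junction path that goes up; at a negative
        -- glued point this is the reversed one.
        by_cases hσ : Y.sign y = 1
        · simp only [if_pos hσ] at hup
          exact Or.inr (Or.inr ⟨γ, h0, _, hn, hc, hi, hup⟩)
        · simp only [if_neg hσ] at hup
          refine Or.inr (Or.inr ⟨fun u => γ (-u), by simpa using h0, _, hn,
            hc.comp (by fun_prop) hm, fun s hs t ht hst => neg_injective
              (hi (hm s hs) (hm t ht) hst), fun s hs hs0 => ?_⟩)
          have := hup (-s) (hm s hs) (neg_ne_zero.2 hs0)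
          rwa [neg_neg] at this)
  have hbN : ∀ q, IsBoundaryPoint (h q) ↔ IsBoundaryPoint q := fun s =>
    isBoundaryPoint_homeomorph_iff h
  have h0R : ∀ i, K.f₀ i ∉ range K.f₁ := by
    rintro i ⟨j, hj⟩
    exact K.f₀_ne_f₁ i j hj.symm
  have h1R : ∀ i, L.f₁ i ∉ range L.f₀ := by
    rintro i ⟨j, hj⟩
    exact L.f₀_ne_f₁ j i hj
  have hb0 : ∀ i, IsBoundaryPoint (h (Glued.inl K L (K.f₀ i))) := fun i =>
    (hbN _).2 ((Glued.isBoundaryPoint_inl_iff K L (h0R i)).2 (K.f₀_boundary i))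
  have hb1 : ∀ i, IsBoundaryPoint (h (Glued.inr K L (L.f₁ i))) := fun i =>
    (hbN _).2 ((Glued.isBoundaryPoint_inr_iff K L (h1R i)).2 (L.f₁_boundary i))
  have hil : Function.Injective fun x => h (Glued.inl K L x) :=
    h.injective.comp (Glued.inl_injective K L)
  have hir : Function.Injective fun x => h (Glued.inr K L x) :=
    h.injective.comp (Glued.inr_injective K L)
  refine ⟨⟨N, fun i => h (Glued.inl K L (K.f₀ i)), fun j => h (Glued.inr K L (L.f₁ j)),
    hil.comp K.f₀_injective, hir.comp L.f₁_injective, ?_, ?_, ?_, ?_⟩, h, hK, hL,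
    fun _ => rfl, fun _ => rfl⟩
  · rw [Set.disjoint_left]
    rintro _ ⟨i, rfl⟩ ⟨j, hj⟩
    obtain ⟨y, hy, -⟩ := Glued.inl_eq_inr K L (h.injective hj).symm
    exact K.f₀_ne_f₁ i y hy.symm
  · ext x
    obtain ⟨q, rfl⟩ := h.surjective x
    rw [mem_ofPred_eq, hbN]
    constructor
    · rintro (⟨i, hi⟩ | ⟨i, hi⟩)
      · exact (hbN q).1 (hi ▸ hb0 i)
      · exact (hbN q).1 (hi ▸ hb1 i)
    · intro hq
      rcases Glued.cases K L q with ⟨x, hx, rfl⟩ | ⟨x, hx, rfl⟩ | ⟨y, rfl⟩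
      · rw [Glued.isBoundaryPoint_inl_iff K L hx] at hq
        rcases K.boundary.superset hq with ⟨i, rfl⟩ | hi
        · exact Or.inl ⟨i, rfl⟩
        · exact absurd hi hx
      · rw [Glued.isBoundaryPoint_inr_iff K L hx] at hq
        rcases L.boundary.superset hq with hi | ⟨i, rfl⟩
        · exact absurd hi hx
        · exact Or.inr ⟨i, rfl⟩
      · exact absurd hq (Glued.not_isBoundaryPoint K L y)
  · intro i
    rw [← K.f₀_sign i]
    exact hK.boundarySign_eq (h.continuous.comp (Glued.continuous_inl K L)) hil
      (K.f₀_boundary i) (hb0 i)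
  · intro i
    rw [← L.f₁_sign i]
    exact hL.boundarySign_eq (h.continuous.comp (Glued.continuous_inr K L)) hir
      (L.f₁_boundary i) (hb1 i)

end Cobordism

end GluedManifold

/-! ### Components as oriented intervals and circles -/

section Components

open Set Filter

namespace OrientedOneManifold

variable {M N : OrientedOneManifold}

/-- `γ` is an oriented parametrization of the interval `C` between two boundary points. -/
structure IsIntervalParam (M : OrientedOneManifold) (C : Set M.carrier) (γ : ℝ → M.carrier) :
    Prop where
  isArc : IsArc γ 1
  zero_boundary : IsBoundaryPoint (γ 0)
  one_boundary : IsBoundaryPoint (γ 1)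
  up : ∀ t ∈ Ioo (0 : ℝ) 1, M.Up γ t
  image_eq : γ '' Icc 0 1 = C

/-- `e` is an oriented parametrization of the circle `C`. -/
structure IsCircleParam (M : OrientedOneManifold) (C : Set M.carrier)
    (e : AddCircle (1 : ℝ) → M.carrier) : Prop where
  continuous : Continuous e
  injective : Function.Injective e
  up : ∀ t : ℝ, M.Up (fun s : ℝ => e s) t
  range_eq : range e = C

/-- The arc to another boundary point fills the component. It is rescaled to [0, 1] and reversed if
it runs against the orientation. -/
theorem exists_isIntervalParam {x : M.carrier} (hx : IsBoundaryPoint x) :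
    ∃ γ, M.IsIntervalParam (connectedComponent x) γ := by
  obtain ⟨α, b, hb, hα, rfl, hbd⟩ := hx.exists_arc_to_boundary M.locallyHalfLine
  have himg := (hα.image_eq_connectedComponent M.locallyHalfLine hb hx hbd).2
  have hmaps : ∀ t ∈ Icc (0 : ℝ) 1, b * t ∈ Icc 0 b := fun t ht =>
    ⟨mul_nonneg hb.le ht.1, by nlinarith [ht.2]⟩
  have harc : IsArc (fun t => α (b * t)) 1 := ⟨zero_le_one,
    hα.continuousOn.comp (by fun_prop) hmaps,
    fun s hs t ht hst => mul_left_cancel₀ hb.ne' (hα.injOn (hmaps s hs) (hmaps t ht) hst)⟩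
  have himg' : (fun t => α (b * t)) '' Icc 0 1 = connectedComponent (α 0) := by
    rw [← himg]
    ext y
    constructor
    · rintro ⟨t, ht, rfl⟩
      exact ⟨_, hmaps t ht, rfl⟩
    · rintro ⟨t, ht, rfl⟩
      exact ⟨t / b, ⟨div_nonneg ht.1 hb.le, (div_le_one hb).2 ht.2⟩,
        by simp only [mul_div_cancel₀ t hb.ne']⟩
  rcases up_or_down_on_Ioo (M := M) (harc.continuousOn.mono Ioo_subset_Icc_self)
    (harc.injOn.mono Ioo_subset_Icc_self) with h | h
  · exact ⟨_, harc, by simpa using hx, by simpa using hbd, h, himg'⟩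
  · refine ⟨_, harc.reverse, by simpa using hbd, by simpa using hx, fun t ht => ?_, ?_⟩
    · have := h (1 - t) ⟨by linarith [ht.2], by linarith [ht.1]⟩
      have := Up.comp (f := fun s : ℝ => -(1 - s)) (γ := fun s => α (b * -s)) (s := t)
        (by fun_prop) (fun a b hab => by simpa using hab) this
      simpa only [neg_neg] using this
    · rw [← himg']
      ext y
      constructor
      · rintro ⟨t, ht, rfl⟩
        exact ⟨1 - t, ⟨by linarith [ht.2], by linarith [ht.1]⟩, rfl⟩
      · rintro ⟨t, ht, rfl⟩
        exact ⟨1 - t, ⟨by linarith [ht.2], by linarith [ht.1]⟩, by simp⟩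

theorem exists_injOn_nhds {A : Type*} [TopologicalSpace A] {e : AddCircle (1 : ℝ) → A}
    (hc : Continuous e) (hi : Function.Injective e) (t : ℝ) :
    ∃ U ∈ 𝓝 t, ContinuousOn (fun s : ℝ => e s) U ∧ InjOn (fun s : ℝ => e s) U :=
  ⟨Ico (t - 1 / 2) (t - 1 / 2 + 1), Ico_mem_nhds (by linarith) (by linarith),
    (hc.comp (AddCircle.continuous_mk' 1)).continuousOn, injOn_comp_addCircle hi _⟩

/-- Lifted to the connected line, a parametrization of the circle has one direction throughout; if
it is the wrong one, z is replaced by -z. -/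
theorem exists_isCircleParam {x : M.carrier}
    (hx : ∀ y ∈ connectedComponent x, ¬ IsBoundaryPoint y) :
    ∃ e, M.IsCircleParam (connectedComponent x) e := by
  obtain ⟨e, hc, hi, hr⟩ := M.locallyHalfLine.exists_addCircle hx
  rcases up_or_down_on (M := M) (γ := fun s : ℝ => e s) isPreconnected_univ
    (fun t _ => exists_injOn_nhds hc hi t) with h | h
  · exact ⟨e, hc, hi, fun t => h t (mem_univ t), hr⟩
  · refine ⟨fun z => e (-z), hc.comp continuous_neg, hi.comp neg_injective, fun t => ?_, ?_⟩
    · have := h (-t) (mem_univ _)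
      simpa only [Down, neg_neg, AddCircle.coe_neg] using this
    · rw [← hr]
      exact neg_surjective.range_comp e

/-- A component is an arc between boundary points or a circle, and both were shown to be open. With
compactness this makes the set of components finite and discrete. -/
theorem isClopen_connectedComponent (M : OrientedOneManifold) (x : M.carrier) :
    IsClopen (connectedComponent x) := by
  by_cases h : ∃ y ∈ connectedComponent x, IsBoundaryPoint y
  · obtain ⟨y, hy, hb⟩ := h
    obtain ⟨γ, hγ⟩ := exists_isIntervalParam hb
    rw [connectedComponent_eq hy, ← hγ.image_eq]
    exact (hγ.isArc.image_eq_connectedComponent M.locallyHalfLine one_pos hγ.zero_boundary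
      hγ.one_boundary).1
  · push Not at h
    obtain ⟨e, he⟩ := exists_isCircleParam h
    rw [← he.range_eq]
    exact M.locallyHalfLine.isClopen_range_addCircle he.continuous he.injective

instance (M : OrientedOneManifold) : DiscreteTopology (ConnectedComponents M.carrier) := by
  rw [discreteTopology_iff_isOpen_singleton]
  intro c
  obtain ⟨x, rfl⟩ := ConnectedComponents.surjective_coe c
  rw [← ConnectedComponents.isQuotientMap_coe.isOpen_preimage,
    connectedComponents_preimage_singleton]
  exact (M.isClopen_connectedComponent x).isOpen

instance (M : OrientedOneManifold) : Finite (ConnectedComponents M.carrier) :=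
  finite_of_compact_of_discrete

theorem IsIntervalParam.eq_or_eq {C : Set M.carrier} {γ : ℝ → M.carrier}
    (h : M.IsIntervalParam C γ) {x : M.carrier} (hxC : x ∈ C) (hx : IsBoundaryPoint x) :
    x = γ 0 ∨ x = γ 1 := by
  rw [← h.image_eq] at hxC
  obtain ⟨t, ht, rfl⟩ := hxC
  rcases eq_or_lt_of_le ht.1 with rfl | h0
  · exact Or.inl rfl
  rcases eq_or_lt_of_le ht.2 with rfl | h1
  · exact Or.inr rfl
  exact absurd hx (h.up t ⟨h0, h1⟩).not_isBoundaryPoint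

/-- Together with the statement for the other end, this says that the signs tell the two ends of an
oriented interval apart. Hence an oriented homeomorphism of intervals matches boundary points by
their signs. -/
theorem IsIntervalParam.isPositive_zero {C : Set M.carrier} {γ : ℝ → M.carrier}
    (h : M.IsIntervalParam C γ) : M.IsPositive (γ 0) :=
  isPositive_of_up one_pos h.zero_boundary (h.isArc.continuousOn.mono Ico_subset_Icc_self)
    (h.isArc.injOn.mono Ico_subset_Icc_self) h.up

theorem IsIntervalParam.not_isPositive_one {C : Set M.carrier} {γ : ℝ → M.carrier}
    (h : M.IsIntervalParam C γ) : ¬ M.IsPositive (γ 1) := by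
  have hr := h.isArc.reverse
  have := not_isPositive_of_down (M := M) (γ := fun s => γ (1 - s)) one_pos
    (by simpa using h.one_boundary) (hr.continuousOn.mono Ico_subset_Icc_self)
    (hr.injOn.mono Ico_subset_Icc_self) (fun t ht => by
      refine Up.comp (f := fun s : ℝ => 1 - -s) (γ := γ) (by fun_prop)
        (fun a b hab => by simpa using hab) ?_
      simpa using h.up (1 - t) ⟨by linarith [ht.2], by linarith [ht.1]⟩)
  simpa using this

end OrientedOneManifold

namespace Cobordism

variable {X Y : OneCob}

/-- The component of a boundary point. -/
def comp (K : Cobordism X Y) (s : Fin X.n ⊕ Fin Y.n) : ConnectedComponents K.M.carrier :=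
  (K.point s : ConnectedComponents K.M.carrier)

theorem rho_iff (K : Cobordism X Y) (s t : Fin X.n ⊕ Fin Y.n) :
    K.rho s t ↔ K.comp s = K.comp t := ConnectedComponents.coe_eq_coe.symm

theorem point_boundary (K : Cobordism X Y) (s : Fin X.n ⊕ Fin Y.n) :
    IsBoundaryPoint (K.point s) := by
  rcases s with i | i
  · exact K.f₀_boundary i
  · exact K.f₁_boundary i

theorem exists_point_eq (K : Cobordism X Y) {x : K.M.carrier} (hx : IsBoundaryPoint x) :
    ∃ s, K.point s = x := by
  rcases K.boundary.superset hx with ⟨i, rfl⟩ | ⟨i, rfl⟩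
  · exact ⟨Sum.inl i, rfl⟩
  · exact ⟨Sum.inr i, rfl⟩

theorem mem_range_comp_iff (K : Cobordism X Y) (x : K.M.carrier) :
    (x : ConnectedComponents K.M.carrier) ∈ range K.comp ↔
      ∃ y ∈ connectedComponent x, IsBoundaryPoint y := by
  constructor
  · rintro ⟨s, hs⟩
    refine ⟨K.point s, ?_, K.point_boundary s⟩
    rw [← ConnectedComponents.coe_eq_coe']
    exact hs
  · rintro ⟨y, hy, hb⟩
    obtain ⟨s, rfl⟩ := K.exists_point_eq hb
    exact ⟨s, ConnectedComponents.coe_eq_coe'.2 hy⟩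

/-- A circle has no boundary points, because a two-sided injective path runs through each of its
points; conversely a component without boundary points is a circle. So the circular components are
those not met by the ends of the cobordism. -/
theorem circles_eq_image (K : Cobordism X Y) :
    K.circles = (fun c => ((↑) ⁻¹' {c} : Set K.M.carrier)) '' (range K.comp)ᶜ := by
  ext C
  constructor
  · rintro ⟨⟨x, rfl⟩, ⟨f⟩⟩
    refine ⟨x, ?_, connectedComponents_preimage_singleton⟩
    rw [mem_compl_iff, mem_range_comp_iff]
    rintro ⟨y, hy, hb⟩
    let e : AddCircle (1 : ℝ) → K.M.carrier := fun z =>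
      f.symm (AddCircle.homeomorphCircle one_ne_zero z)
    have hc : Continuous e := by fun_prop
    have hi : Function.Injective e := Subtype.val_injective.comp
      (f.symm.injective.comp (AddCircle.homeomorphCircle one_ne_zero).injective)
    obtain ⟨z, hz⟩ : ∃ z, e z = y := ⟨(AddCircle.homeomorphCircle one_ne_zero).symm (f ⟨y, hy⟩),
      by simp [e]⟩
    obtain ⟨t, rfl⟩ := QuotientAddGroup.mk_surjective z
    obtain ⟨U, hU, hcU, hiU⟩ := OrientedOneManifold.exists_injOn_nhds hc hi t
    exact not_isBoundaryPoint_of_injOn hU hcU hiU (by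
      rw [← hz] at hb
      exact hb)
  · rintro ⟨c, hc, rfl⟩
    obtain ⟨x, rfl⟩ := ConnectedComponents.surjective_coe c
    rw [mem_compl_iff, mem_range_comp_iff] at hc
    push Not at hc
    simp only [connectedComponents_preimage_singleton]
    refine ⟨⟨x, rfl⟩, ?_⟩
    obtain ⟨e, he⟩ := OrientedOneManifold.exists_isCircleParam hc
    have hemb := he.continuous.isClosedEmbedding he.injective
    exact ⟨(((AddCircle.homeomorphCircle one_ne_zero).symm.trans
      hemb.isEmbedding.toHomeomorph).trans (Homeomorph.setCongr he.range_eq)).symm⟩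

theorem ncard_circles (K : Cobordism X Y) : K.circles.ncard = ((range K.comp)ᶜ).ncard := by
  rw [circles_eq_image]
  refine Set.ncard_image_of_injective _ fun c c' h => ?_
  obtain ⟨x, rfl⟩ := ConnectedComponents.surjective_coe c
  have : x ∈ ((↑) ⁻¹' {c'} : Set K.M.carrier) := by
    rw [← show _ = _ from h]; rfl
  exact this

end Cobordism

end Components

/-! ### Matrix entries as numbers of colourings -/

section Counting

open Set Filter

/-- The values on the range of q are forced by `lab`, consistently by hypothesis; those outside the
range are free. -/
theorem card_functions_extending {S C T : Type*} [Finite C] [Nonempty T] [Finite T]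
    (q : S → C) (lab : S → T) (h : ∀ s t, q s = q t → lab s = lab t) :
    Nat.card {F : C → T // ∀ s, F (q s) = lab s} = Nat.card T ^ ((range q)ᶜ).ncard := by
  classical
  let E : {F : C → T // ∀ s, F (q s) = lab s} ≃ (((range q)ᶜ : Set C) → T) :=
    { toFun := fun F c => F.1 c
      invFun := fun G => ⟨fun c => if hc : ∃ s, q s = c then lab hc.choose else G ⟨c, hc⟩,
        fun s => by
          have hs : ∃ s', q s' = q s := ⟨s, rfl⟩
          simp only [hs, dif_pos]
          exact h _ _ hs.choose_spec⟩
      left_inv := fun F => by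
        ext c
        by_cases hc : ∃ s, q s = c
        · simp only [hc, dif_pos]
          rw [← F.2, hc.choose_spec]
        · simp only [hc, dif_neg, not_false_eq_true]
      right_inv := fun G => by
        ext c
        have hc : ¬ ∃ s, q s = c := c.2
        simp only [hc, dif_neg, not_false_eq_true] }
  rw [Nat.card_congr E, Nat.card_fun, Nat.card_coe_set_eq]

namespace Cobordism

variable {X Y : OneCob}

/-- Locally constant functions are functions on the set of components. -/
noncomputable def locallyConstantEquiv (M : OrientedOneManifold) (T : Type*) :
    LocallyConstant M.carrier T ≃ (ConnectedComponents M.carrier → T) where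
  toFun g := Quotient.lift g fun a b (hab : connectedComponent a = connectedComponent b) => by
    refine g.isLocallyConstant.apply_eq_of_isPreconnected isPreconnected_connectedComponent
      (x := a) (y := b) mem_connectedComponent ?_
    rw [hab]; exact mem_connectedComponent
  invFun F := ⟨fun x => F x, (IsLocallyConstant.of_discrete F).comp_continuous
    ConnectedComponents.continuous_coe⟩
  left_inv g := rfl
  right_inv F := by
    ext c
    obtain ⟨x, rfl⟩ := ConnectedComponents.surjective_coe c
    rfl

open Classical in
/-- The number of colourings of the components with prescribed colours of the boundary. -/
theorem card_colorings {p : ℕ} (hp : 0 < p) (K : Cobordism X Y) (lab : Fin X.n ⊕ Fin Y.n → Fin p) :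
    Nat.card {g : LocallyConstant K.M.carrier (Fin p) // ∀ s, g (K.point s) = lab s} =
      if ∀ s t, K.rho s t → lab s = lab t then p ^ K.circles.ncard else 0 := by
  have : Nonempty (Fin p) := ⟨⟨0, hp⟩⟩
  have e : {g : LocallyConstant K.M.carrier (Fin p) // ∀ s, g (K.point s) = lab s} ≃
      {F : ConnectedComponents K.M.carrier → Fin p // ∀ s, F (K.comp s) = lab s} :=
    (locallyConstantEquiv K.M (Fin p)).subtypeEquiv fun g => Iff.rfl
  rw [Nat.card_congr e]
  split_ifs with h
  · rw [card_functions_extending K.comp lab fun s t hst => h s t ((K.rho_iff s t).2 hst),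
      Nat.card_fin, ncard_circles]
  · have : IsEmpty {F : ConnectedComponents K.M.carrier → Fin p // ∀ s, F (K.comp s) = lab s} := by
      refine ⟨fun F => h fun s t hst => ?_⟩
      rw [← F.2 s, ← F.2 t, (K.rho_iff s t).1 hst]
    exact Nat.card_of_isEmpty

end Cobordism

/-- The digits of a number with `n` digits, as a bijection. -/
def digitEquiv (p n : ℕ) : Fin (p ^ n) ≃ (Fin n → Fin p) :=
  -- `finFunctionFinEquiv` lists digits from the least significant one, whereas here they are read
  -- from the left; hence the reversal.
  finFunctionFinEquiv.symm.trans (Equiv.arrowCongr Fin.revPerm (Equiv.refl _))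

theorem digitEquiv_apply {p n : ℕ} (a : Fin (p ^ n)) (i : Fin n) :
    (digitEquiv p n a i : ℕ) = digit p n a i := by
  simp only [digitEquiv, Equiv.trans_apply, Equiv.arrowCongr_apply, Function.comp_apply,
    Equiv.refl_apply, digit]
  change ((finFunctionFinEquiv.symm a) (Fin.rev i) : ℕ) = _
  have hrev : ((Fin.rev i : Fin n) : ℕ) = n - 1 - i := by
    rw [Fin.val_rev]; omega
  rw [finFunctionFinEquiv_symm_apply_val, hrev]

/-- The entry of a matrix indexed by sequences of digits. -/
noncomputable def entry (p : ℕ) (F : Type u) [Field F] {X Y : OneCob} (f : X ⟶ Y)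
    (a : Fin X.n → Fin p) (b : Fin Y.n → Fin p) : F :=
  ((brauer p F).map f : Matrix (Fin (p ^ Y.n)) (Fin (p ^ X.n)) F) ((digitEquiv p Y.n).symm b)
    ((digitEquiv p X.n).symm a)

/-- The state sum behind everything that follows: the power of p counts the free choices of colours
on the circles, and the 0-1 entry says whether the labels extend to the components with boundary. -/
theorem entry_arrow {p : ℕ} (hp : 0 < p) (F : Type u) [Field F] {X Y : OneCob}
    (K : Cobordism X Y) (a : Fin X.n → Fin p) (b : Fin Y.n → Fin p) :
    entry p F (OneCob.arrow K) a b =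
      (Nat.card {g : LocallyConstant K.M.carrier (Fin p) //
        ∀ s, g (K.point s) = Sum.elim a b s} : F) := by
  classical
  rw [K.card_colorings hp]
  change ((p : F) ^ K.circles.ncard • brauerMatrix p F K) _ _ = _
  rw [Matrix.smul_apply, brauerMatrix, Matrix.of_apply]
  have hd : ∀ s, digits p ((digitEquiv p X.n).symm a) ((digitEquiv p Y.n).symm b) s =
      (Sum.elim a b s : Fin p) := by
    rintro (i | i)
    · simp only [digits, Sum.elim_inl]
      rw [← digitEquiv_apply, Equiv.apply_symm_apply]
    · simp only [digits, Sum.elim_inr]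
      rw [← digitEquiv_apply, Equiv.apply_symm_apply]
  simp only [hd, Fin.val_inj]
  split_ifs <;> simp

end Counting

/-! ### Classification of cobordisms and faithfulness -/

section Faithful

open Set Filter

theorem IsCompact.continuousOn_invFunOn {A B : Type*} [TopologicalSpace A] [TopologicalSpace B]
    [T2Space B] [Nonempty A] {f : A → B} {s : Set A} (hs : IsCompact s) (hc : ContinuousOn f s)
    (hi : InjOn f s) : ContinuousOn (Function.invFunOn f s) (f '' s) := by
  rw [continuousOn_iff_isClosed]
  intro t ht
  refine ⟨f '' (s ∩ t), ((hs.inter_right ht).image_of_continuousOn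
    (hc.mono inter_subset_left)).isClosed, ?_⟩
  ext y
  constructor
  · rintro ⟨hy, hyi⟩
    exact ⟨⟨_, ⟨Function.invFunOn_mem hyi, hy⟩, Function.invFunOn_eq hyi⟩, hyi⟩
  · rintro ⟨⟨x, ⟨hxs, hxt⟩, rfl⟩, hyi⟩
    refine ⟨?_, hyi⟩
    rw [mem_preimage, hi.leftInvOn_invFunOn hxs]
    exact hxt

/-- Equal kernels identify the ranges of f and g, and the complements of the ranges are matched by
an arbitrary bijection. It is applied to the maps sending boundary points to components, where the
complements are the circles. -/
theorem exists_equiv_apply_eq {S A B : Type*} [Finite A] [Finite B] (f : S → A) (g : S → B)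
    (h : ∀ s t, f s = f t ↔ g s = g t) (hc : ((range f)ᶜ).ncard = ((range g)ᶜ).ncard) :
    ∃ β : A ≃ B, ∀ s, β (f s) = g s := by
  classical
  let e₁ : range f ≃ range g := (Setoid.quotientKerEquivRange f).symm.trans
    ((Quotient.congr (Equiv.refl S) fun s t => h s t).trans (Setoid.quotientKerEquivRange g))
  have he₁ : ∀ s, e₁ ⟨f s, s, rfl⟩ = ⟨g s, s, rfl⟩ := fun s => by
    have : (Setoid.quotientKerEquivRange f).symm ⟨f s, s, rfl⟩ = Quotient.mk _ s := by
      rw [Equiv.symm_apply_eq]; rfl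
    simp only [e₁, Equiv.trans_apply, this]
    rfl
  obtain ⟨e₂⟩ : Nonempty (((range f)ᶜ : Set A) ≃ ((range g)ᶜ : Set B)) := by
    rw [← Nat.card_coe_set_eq, ← Nat.card_coe_set_eq] at hc
    exact (Finite.card_eq).1 hc
  refine ⟨(Equiv.Set.sumCompl (range f)).symm.trans ((Equiv.sumCongr e₁ e₂).trans
    (Equiv.Set.sumCompl (range g))), fun s => ?_⟩
  simp only [Equiv.trans_apply]
  rw [Equiv.Set.sumCompl_symm_apply_of_mem (mem_range_self s)]
  simp [he₁]

namespace OrientedOneManifold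

/-- `g` maps `C` bijectively onto `C'`, continuously and preserving the orientation. -/
structure IsOrientedIso (M N : OrientedOneManifold) (C : Set M.carrier) (C' : Set N.carrier)
    (g : M.carrier → N.carrier) : Prop where
  continuousOn : ContinuousOn g C
  bijOn : BijOn g C C'
  up : ∀ x ∈ C, ¬ IsBoundaryPoint x → ∃ γ t, γ t = x ∧ M.Up γ t ∧ N.Up (fun s => g (γ s)) t

variable {M N : OrientedOneManifold}

theorem Up.continuousAt {γ : ℝ → M.carrier} {t : ℝ} (h : M.Up γ t) : ContinuousAt γ t := by
  obtain ⟨φ, hφ, hs, U, hU, hc, hm⟩ := h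
  exact hc.continuousAt hU

/-- The map is γ' after the inverse of γ, continuous because [0, 1] is compact; the oriented path γ
serves as test path. -/
theorem IsIntervalParam.exists_isOrientedIso {C : Set M.carrier} {C' : Set N.carrier}
    {γ : ℝ → M.carrier} {γ' : ℝ → N.carrier} (h : M.IsIntervalParam C γ)
    (h' : N.IsIntervalParam C' γ') :
    ∃ g, IsOrientedIso M N C C' g ∧ g (γ 0) = γ' 0 ∧ g (γ 1) = γ' 1 := by
  have hinv := h.isArc.injOn.leftInvOn_invFunOn
  have hmaps : MapsTo (Function.invFunOn γ (Icc 0 1)) C (Icc 0 1) := by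
    rw [← h.image_eq]
    exact fun y hy => Function.invFunOn_mem hy
  have hg : ∀ t ∈ Icc (0 : ℝ) 1, γ' (Function.invFunOn γ (Icc 0 1) (γ t)) = γ' t :=
    fun t ht => by rw [hinv ht]
  refine ⟨fun x => γ' (Function.invFunOn γ (Icc 0 1) x), ⟨?_, ⟨?_, ?_, ?_⟩, ?_⟩,
    hg 0 (by simp), hg 1 (by simp)⟩
  · refine h'.isArc.continuousOn.comp ?_ hmaps
    rw [← h.image_eq]
    exact isCompact_Icc.continuousOn_invFunOn h.isArc.continuousOn h.isArc.injOn
  · intro x hx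
    rw [← h'.image_eq]
    exact ⟨_, hmaps hx, rfl⟩
  · rw [← h.image_eq]
    rintro _ ⟨s, hs, rfl⟩ _ ⟨t, ht, rfl⟩ hst
    simp only [hg s hs, hg t ht] at hst
    rw [h'.isArc.injOn hs ht hst]
  · rw [← h'.image_eq]
    rintro _ ⟨t, ht, rfl⟩
    exact ⟨γ t, h.image_eq ▸ ⟨t, ht, rfl⟩, hg t ht⟩
  · rw [← h.image_eq]
    rintro _ ⟨t, ht, rfl⟩ hb
    have ht' : t ∈ Ioo (0 : ℝ) 1 :=
      ⟨lt_of_le_of_ne ht.1 fun h0 => hb (h0 ▸ h.zero_boundary),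
        lt_of_le_of_ne ht.2 fun h1 => hb (h1 ▸ h.one_boundary)⟩
    refine ⟨γ, t, rfl, h.up t ht', (h'.up t ht').congr ?_⟩
    filter_upwards [Ioo_mem_nhds ht'.1 ht'.2] with s hs using hg s (Ioo_subset_Icc_self hs)

theorem IsCircleParam.exists_isOrientedIso {C : Set M.carrier} {C' : Set N.carrier}
    {e : AddCircle (1 : ℝ) → M.carrier} {e' : AddCircle (1 : ℝ) → N.carrier}
    (h : M.IsCircleParam C e) (h' : N.IsCircleParam C' e') :
    ∃ g, IsOrientedIso M N C C' g := by
  have : Fact ((0 : ℝ) < 1) := ⟨one_pos⟩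
  have hinv := h.injective.injOn.leftInvOn_invFunOn (s := univ)
  have hg : ∀ z, e' (Function.invFunOn e univ (e z)) = e' z :=
    fun z => by rw [hinv (mem_univ z)]
  refine ⟨fun x => e' (Function.invFunOn e univ x), ?_, ⟨?_, ?_, ?_⟩, ?_⟩
  · refine h'.continuous.comp_continuousOn ?_
    rw [← h.range_eq, ← image_univ]
    exact isCompact_univ.continuousOn_invFunOn h.continuous.continuousOn h.injective.injOn
  · intro x _
    rw [← h'.range_eq]
    exact ⟨_, rfl⟩
  · rw [← h.range_eq]
    rintro _ ⟨s, rfl⟩ _ ⟨t, rfl⟩ hst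
    simp only [hg] at hst
    rw [h'.injective hst]
  · rw [← h'.range_eq]
    rintro _ ⟨t, rfl⟩
    exact ⟨e t, h.range_eq ▸ ⟨t, rfl⟩, hg t⟩
  · rw [← h.range_eq]
    rintro _ ⟨z, rfl⟩ _
    obtain ⟨t, rfl⟩ := QuotientAddGroup.mk_surjective z
    refine ⟨fun s : ℝ => e s, t, rfl, h.up t, ?_⟩
    simp only [hg]
    exact h'.up t

/-- Components are open, so a map defined separately on each of them is continuous. It is bijective
because β is, and a continuous bijection from a compact to a Hausdorff space is a homeomorphism. -/
theorem exists_homeomorph_of_isOrientedIso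
    (β : ConnectedComponents M.carrier ≃ ConnectedComponents N.carrier)
    (g : ConnectedComponents M.carrier → M.carrier → N.carrier)
    (hg : ∀ c, IsOrientedIso M N ((↑) ⁻¹' {c}) ((↑) ⁻¹' {β c}) (g c)) :
    ∃ h : M.carrier ≃ₜ N.carrier, M.PreservesOrientation N h ∧ ∀ x : M.carrier, h x = g x x := by
  have hopen : ∀ x : M.carrier, ((↑) ⁻¹' {(x : ConnectedComponents M.carrier)} : Set M.carrier) ∈
      𝓝 x := fun x => by
    rw [connectedComponents_preimage_singleton]
    exact (M.isClopen_connectedComponent x).isOpen.mem_nhds mem_connectedComponent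
  have hev : ∀ x : M.carrier, (fun y : M.carrier => g y y) =ᶠ[𝓝 x] g x := fun x => by
    filter_upwards [hopen x] with y hy
    rw [show (y : ConnectedComponents M.carrier) = x from hy]
  have hcont : Continuous fun x : M.carrier => g x x :=
    continuous_iff_continuousAt.2 fun x =>
      (((hg x).continuousOn.continuousAt (hopen x))).congr (hev x).symm
  have hmk : ∀ x : M.carrier, (g x x : ConnectedComponents N.carrier) = β x :=
    fun x => (hg x).bijOn.mapsTo rfl
  have hinj : Function.Injective fun x : M.carrier => g x x := by
    intro x y hxy
    have hxy : g x x = g y y := hxy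
    have hc : (x : ConnectedComponents M.carrier) = y := β.injective (by rw [← hmk, ← hmk, hxy])
    refine (hg x).bijOn.injOn rfl hc.symm ?_
    rw [hxy, hc]
  have hsurj : Function.Surjective fun x : M.carrier => g x x := by
    intro y
    obtain ⟨x, hx, hxy⟩ := (hg (β.symm y)).bijOn.surjOn (a := y) (by simp)
    refine ⟨x, ?_⟩
    simp only
    rw [show (x : ConnectedComponents M.carrier) = _ from hx, hxy]
  refine ⟨Continuous.homeoOfEquivCompactToT2 (f := Equiv.ofBijective _ ⟨hinj, hsurj⟩) hcont, ?_,
    fun x => rfl⟩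
  refine preservesOrientation_of_up hcont hinj.injOn fun x hx => ?_
  obtain ⟨γ, t, rfl, hup, hup'⟩ := (hg x).up x rfl hx
  refine ⟨γ, t, rfl, hup, hup'.congr ?_⟩
  exact hup.continuousAt.eventually (hev (γ t))

end OrientedOneManifold

namespace Cobordism

variable {X Y : OneCob}

theorem isPositive_point_iff (K L : Cobordism X Y) (s : Fin X.n ⊕ Fin Y.n) :
    K.M.IsPositive (K.point s) ↔ L.M.IsPositive (L.point s) := by
  have : K.M.boundarySign (K.point s) = L.M.boundarySign (L.point s) := by
    rcases s with i | i
    · exact (K.f₀_sign i).trans (L.f₀_sign i).symm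
    · exact (K.f₁_sign i).trans (L.f₁_sign i).symm
  unfold OrientedOneManifold.boundarySign at this
  have h1 : (1 : ℤˣ) ≠ -1 := by decide
  split_ifs at this with h h' h'
  · exact iff_of_true h h'
  · exact absurd this h1
  · exact absurd this.symm h1
  · exact iff_of_false h h'

/-- Compact oriented one-dimensional cobordisms are classified by the partition of the boundary
points into components and by the number of circles. -/
theorem equivalent_of_rho_eq (K L : Cobordism X Y) (hρ : K.rho = L.rho)
    (hc : K.circles.ncard = L.circles.ncard) : K.Equivalent L := by
  obtain ⟨β, hβ⟩ := exists_equiv_apply_eq K.comp L.comp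
    (fun s t => by rw [← K.rho_iff, ← L.rho_iff, hρ])
    (by rw [← ncard_circles, ← ncard_circles, hc])
  have key : ∀ c, ∃ g, OrientedOneManifold.IsOrientedIso K.M L.M ((↑) ⁻¹' {c}) ((↑) ⁻¹' {β c}) g ∧
      ∀ s, K.comp s = c → g (K.point s) = L.point s := by
    intro c
    by_cases hcr : c ∈ range K.comp
    · obtain ⟨s, rfl⟩ := hcr
      rw [hβ, comp, comp, connectedComponents_preimage_singleton,
        connectedComponents_preimage_singleton]
      obtain ⟨γ, hγ⟩ := OrientedOneManifold.exists_isIntervalParam (K.point_boundary s)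
      obtain ⟨γ', hγ'⟩ := OrientedOneManifold.exists_isIntervalParam (L.point_boundary s)
      obtain ⟨g, hg, hg0, hg1⟩ := hγ.exists_isOrientedIso hγ'
      refine ⟨g, hg, fun t ht => ?_⟩
      have htK : K.point t ∈ connectedComponent (K.point s) := ConnectedComponents.coe_eq_coe'.1 ht
      have htL : L.point t ∈ connectedComponent (L.point s) := by
        rw [← ConnectedComponents.coe_eq_coe']
        change L.comp t = L.comp s
        rw [← hβ, ← hβ, ← show K.comp t = K.comp s from ht]
      have hpos := K.isPositive_point_iff L t
      -- A labelled point is an end of the interval on both sides. Its sign is fixed by the objects,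
      -- so it is the positive end in both or the negative end in both.
      rcases hγ.eq_or_eq htK (K.point_boundary t) with h | h <;>
        rcases hγ'.eq_or_eq htL (L.point_boundary t) with h' | h' <;> rw [h, h'] at hpos
      · rw [h, h', hg0]
      · exact absurd (hpos.1 hγ.isPositive_zero) hγ'.not_isPositive_one
      · exact absurd (hpos.2 hγ'.isPositive_zero) hγ.not_isPositive_one
      · rw [h, h', hg1]
    -- A component without labelled points is a circle, and so is its partner; there is nothing to
    -- match on them.
    · have hcr' : β c ∉ range L.comp := by
        rintro ⟨s, hs⟩
        rw [← hβ] at hs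
        exact hcr ⟨s, β.injective hs⟩
      have hnone : ∀ s, K.comp s ≠ c := fun s hs => hcr ⟨s, hs⟩
      generalize hd : β c = d at *
      obtain ⟨x, rfl⟩ := ConnectedComponents.surjective_coe c
      obtain ⟨y, rfl⟩ := ConnectedComponents.surjective_coe d
      rw [mem_range_comp_iff] at hcr hcr'
      push Not at hcr hcr'
      rw [connectedComponents_preimage_singleton, connectedComponents_preimage_singleton]
      obtain ⟨e, he⟩ := OrientedOneManifold.exists_isCircleParam hcr
      obtain ⟨e', he'⟩ := OrientedOneManifold.exists_isCircleParam hcr'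
      obtain ⟨g, hg⟩ := he.exists_isOrientedIso he'
      exact ⟨g, hg, fun s hs => absurd hs (hnone s)⟩
  choose g hg hgp using key
  obtain ⟨h, ho, hh⟩ := OrientedOneManifold.exists_homeomorph_of_isOrientedIso β g hg
  have hp : ∀ s, h (K.point s) = L.point s := fun s => by rw [hh]; exact hgp _ s rfl
  exact ⟨h, ho, fun i => hp (Sum.inl i), fun i => hp (Sum.inr i)⟩

end Cobordism

section

variable {p : ℕ} {F : Type u} [Field F] {X Y : OneCob}

open Classical in
theorem entry_arrow_eq_ite (hp : 0 < p) (K : Cobordism X Y) (a : Fin X.n → Fin p)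
    (b : Fin Y.n → Fin p) : entry p F (OneCob.arrow K) a b =
      if ∀ s t, K.rho s t → Sum.elim a b s = Sum.elim a b t then (p : F) ^ K.circles.ncard
      else 0 := by
  rw [entry_arrow hp, K.card_colorings hp]
  split_ifs <;> simp

/-- The Brauer representation is faithful. -/
theorem eq_of_entry_eq [CharZero F] (hp : 2 ≤ p) {f g : X ⟶ Y}
    (h : ∀ a b, entry p F f a b = entry p F g a b) : f = g := by
  classical
  obtain ⟨K, rfl⟩ := Quotient.exists_rep f
  obtain ⟨L, rfl⟩ := Quotient.exists_rep g
  change ∀ a b, entry p F (OneCob.arrow K) a b = entry p F (OneCob.arrow L) a b at h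
  have hp0 : 0 < p := by omega
  simp only [entry_arrow_eq_ite hp0] at h
  have hF : (p : F) ≠ 0 := by exact_mod_cast hp0.ne'
  have hle : ∀ {K L : Cobordism X Y}, (∀ (a : Fin X.n → Fin p) (b : Fin Y.n → Fin p),
      (if ∀ s t, K.rho s t → Sum.elim a b s = Sum.elim a b t then (p : F) ^ K.circles.ncard
        else 0) = if ∀ s t, L.rho s t → Sum.elim a b s = Sum.elim a b t then
          (p : F) ^ L.circles.ncard else 0) → ∀ s t, K.rho s t → L.rho s t := by
    intro K L h s t hst
    by_contra hn
    -- The indicator of the class of s under L is compatible with L, so the entry of L is nonzero.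
    -- It separates s from t, which K joins, so the entry of K vanishes.
    let lab : Fin X.n ⊕ Fin Y.n → Fin p := fun r => if L.rho s r then ⟨1, by omega⟩ else ⟨0, hp0⟩
    have hlab : Sum.elim (fun i => lab (Sum.inl i)) (fun i => lab (Sum.inr i)) = lab :=
      Sum.elim_comp_inl_inr lab
    have := h (fun i => lab (Sum.inl i)) (fun i => lab (Sum.inr i))
    rw [hlab, if_neg, if_pos] at this
    · exact pow_ne_zero _ hF this.symm
    · intro r r' hr
      simp only [lab, show L.rho s r ↔ L.rho s r' from
        ⟨fun h => h.trans hr, fun h => h.trans hr.symm⟩]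
    · intro hall
      have := hall s t hst
      simp only [lab, if_neg hn] at this
      rw [if_pos (show L.rho s s from rfl)] at this
      simp at this
  have hρ : K.rho = L.rho := by
    ext s t
    exact ⟨hle h s t, hle (fun a b => (h a b).symm) s t⟩
  refine Quotient.sound (K.equivalent_of_rho_eq L hρ ?_)
  -- The constant labelling is compatible with every partition, so its entry is p to the number of
  -- circles.
  have := h (fun _ => ⟨0, hp0⟩) (fun _ => ⟨0, hp0⟩)
  have hconst : ∀ s t : Fin X.n ⊕ Fin Y.n,
      Sum.elim (fun _ => (⟨0, hp0⟩ : Fin p)) (fun _ => ⟨0, hp0⟩) s =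
        Sum.elim (fun _ => ⟨0, hp0⟩) (fun _ => ⟨0, hp0⟩) t := by
    rintro (_ | _) (_ | _) <;> rfl
  rw [if_pos fun s t _ => hconst s t, if_pos fun s t _ => hconst s t] at this
  have : p ^ K.circles.ncard = p ^ L.circles.ncard := by exact_mod_cast this
  exact Nat.pow_right_injective hp this

theorem brauer_map_injective [CharZero F] (hp : 2 ≤ p) (X Y : OneCob) :
    Function.Injective fun f : X ⟶ Y => (brauer p F).map f := by
  intro f g h
  refine eq_of_entry_eq (F := F) hp fun a b => ?_
  simp only [entry]
  rw [show (brauer p F).map f = (brauer p F).map g from h]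

end

end Faithful

/-! ### Entries of composites, disjoint unions and cylinders -/

section Entries

open Set Filter

namespace Cobordism

variable {X Y Z X' Y' : OneCob}

/-- Locally constant functions on a glued space with prescribed values on the boundary. -/
noncomputable def coloringsOfIsComposite (p : ℕ) {K : Cobordism X Y} {L : Cobordism Y Z}
    {N : Cobordism X Z} (h : Glued K L ≃ₜ N.M.carrier)
    (h₀ : ∀ i, h (Glued.inl K L (K.f₀ i)) = N.f₀ i)
    (h₁ : ∀ j, h (Glued.inr K L (L.f₁ j)) = N.f₁ j) (a : Fin X.n → Fin p) (c : Fin Z.n → Fin p) :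
    {g : LocallyConstant N.M.carrier (Fin p) // ∀ s, g (N.point s) = Sum.elim a c s} ≃
      Σ b : Fin Y.n → Fin p,
        {g : LocallyConstant K.M.carrier (Fin p) // ∀ s, g (K.point s) = Sum.elim a b s} ×
        {g : LocallyConstant L.M.carrier (Fin p) // ∀ s, g (L.point s) = Sum.elim b c s} where
  toFun g := ⟨fun y => g.1 (h (Glued.inl K L (K.f₁ y))),
    ⟨g.1.comap ⟨_, h.continuous.comp (Glued.continuous_inl K L)⟩, by
      rintro (i | i)
      · change g.1 (h (Glued.inl K L (K.f₀ i))) = a i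
        rw [h₀]; exact g.2 (Sum.inl i)
      · rfl⟩,
    ⟨g.1.comap ⟨_, h.continuous.comp (Glued.continuous_inr K L)⟩, by
      rintro (i | i)
      · change g.1 (h (Glued.inr K L (L.f₀ i))) = g.1 (h (Glued.inl K L (K.f₁ i)))
        rw [Glued.inl_f₁]
      · change g.1 (h (Glued.inr K L (L.f₁ i))) = c i
        rw [h₁]; exact g.2 (Sum.inr i)⟩⟩
  invFun G := ⟨(⟨Quot.lift (Sum.elim G.2.1.1 G.2.2.1) (by
      rintro _ _ ⟨y, rfl, rfl⟩
      exact (G.2.1.2 (Sum.inr y)).trans (G.2.2.2 (Sum.inl y)).symm), by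
      exact (IsLocallyConstant.iff_continuous _).2 (continuous_quot_lift _
        (G.2.1.1.continuous.sumElim G.2.2.1.continuous))⟩ : LocallyConstant (Glued K L)
          (Fin p)).comap ⟨_, h.symm.continuous⟩, by
      rintro (i | i)
      · change Quot.lift _ _ (h.symm (N.f₀ i)) = a i
        rw [← h₀, h.symm_apply_apply]
        exact G.2.1.2 (Sum.inl i)
      · change Quot.lift _ _ (h.symm (N.f₁ i)) = c i
        rw [← h₁, h.symm_apply_apply]
        exact G.2.2.2 (Sum.inr i)⟩
  left_inv g := by
    refine Subtype.ext (LocallyConstant.ext fun x => ?_)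
    obtain ⟨x, rfl⟩ := h.surjective x
    change Quot.lift _ _ (h.symm (h x)) = _
    rw [h.symm_apply_apply]
    rcases x with ⟨x | x⟩ <;> rfl
  right_inv G := by
    obtain ⟨b, ⟨g, hg⟩, ⟨g', hg'⟩⟩ := G
    have hb : (fun y => g (K.f₁ y)) = b := funext fun y => hg (Sum.inr y)
    subst hb
    refine Sigma.ext ?_ ?_
    · ext y
      change ((Quot.lift _ _ (h.symm (h (Glued.inl K L (K.f₁ y)))) : Fin p) : ℕ) = _
      rw [h.symm_apply_apply]
      rfl
    · simp only
      -- The pairs live over labellings that are only provably equal; after identifying these,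
      -- comparison of underlying functions suffices.
      have key : ∀ {b b' : Fin Y.n → Fin p} (e : b = b')
          (G : {g : LocallyConstant K.M.carrier (Fin p) // ∀ s, g (K.point s) = Sum.elim a b s} ×
            {g : LocallyConstant L.M.carrier (Fin p) // ∀ s, g (L.point s) = Sum.elim b c s})
          (G' : {g : LocallyConstant K.M.carrier (Fin p) // ∀ s, g (K.point s) = Sum.elim a b' s} ×
            {g : LocallyConstant L.M.carrier (Fin p) // ∀ s, g (L.point s) = Sum.elim b' c s}),
          (∀ x, G.1.1 x = G'.1.1 x) → (∀ x, G.2.1 x = G'.2.1 x) → HEq G G' := by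
        rintro b _ rfl ⟨⟨g, hg⟩, ⟨k, hk⟩⟩ ⟨⟨g', hg'⟩, ⟨k', hk'⟩⟩ h1 h2
        obtain rfl : g = g' := LocallyConstant.ext h1
        obtain rfl : k = k' := LocallyConstant.ext h2
        rfl
      refine key ?_ _ _ (fun x => ?_) (fun x => ?_)
      · ext y
        change ((Quot.lift _ _ (h.symm (h (Glued.inl K L (K.f₁ y)))) : Fin p) : ℕ) = _
        rw [h.symm_apply_apply]
        rfl
      · change Quot.lift _ _ (h.symm (h (Glued.inl K L x))) = _
        rw [h.symm_apply_apply]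
        rfl
      · change Quot.lift _ _ (h.symm (h (Glued.inr K L x))) = _
        rw [h.symm_apply_apply]
        rfl

/-- Locally constant functions on a disjoint union with prescribed values on the boundary. -/
noncomputable def coloringsOfIsSideBySide (p : ℕ) {K : Cobordism X Y} {L : Cobordism X' Y'}
    {N : Cobordism (X * X') (Y * Y')} (h : K.M.carrier ⊕ L.M.carrier ≃ₜ N.M.carrier)
    (h₀ : ∀ i : Fin X.n, h (Sum.inl (K.f₀ i)) = N.f₀ (Fin.castAdd X'.n i))
    (h₀' : ∀ i : Fin X'.n, h (Sum.inr (L.f₀ i)) = N.f₀ (Fin.natAdd X.n i))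
    (h₁ : ∀ j : Fin Y.n, h (Sum.inl (K.f₁ j)) = N.f₁ (Fin.castAdd Y'.n j))
    (h₁' : ∀ j : Fin Y'.n, h (Sum.inr (L.f₁ j)) = N.f₁ (Fin.natAdd Y.n j))
    (a : Fin X.n → Fin p) (b : Fin Y.n → Fin p) (a' : Fin X'.n → Fin p) (b' : Fin Y'.n → Fin p) :
    {g : LocallyConstant N.M.carrier (Fin p) //
      ∀ s, g (N.point s) = Sum.elim (Fin.append a a') (Fin.append b b') s} ≃
      {g : LocallyConstant K.M.carrier (Fin p) // ∀ s, g (K.point s) = Sum.elim a b s} ×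
      {g : LocallyConstant L.M.carrier (Fin p) // ∀ s, g (L.point s) = Sum.elim a' b' s} where
  toFun g :=
    ⟨⟨g.1.comap ⟨_, h.continuous.comp continuous_inl⟩, by
      rintro (i | i)
      · change g.1 (h (Sum.inl (K.f₀ i))) = a i
        rw [h₀]; exact (g.2 (Sum.inl (Fin.castAdd X'.n i))).trans (Fin.append_left a a' i)
      · change g.1 (h (Sum.inl (K.f₁ i))) = b i
        rw [h₁]; exact (g.2 (Sum.inr (Fin.castAdd Y'.n i))).trans (Fin.append_left b b' i)⟩,
    ⟨g.1.comap ⟨_, h.continuous.comp continuous_inr⟩, by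
      rintro (i | i)
      · change g.1 (h (Sum.inr (L.f₀ i))) = a' i
        rw [h₀']; exact (g.2 (Sum.inl (Fin.natAdd X.n i))).trans (Fin.append_right a a' i)
      · change g.1 (h (Sum.inr (L.f₁ i))) = b' i
        rw [h₁']; exact (g.2 (Sum.inr (Fin.natAdd Y.n i))).trans (Fin.append_right b b' i)⟩⟩
  invFun G := ⟨(⟨Sum.elim G.1.1 G.2.1, by
      rw [IsLocallyConstant.iff_continuous]
      exact G.1.1.continuous.sumElim G.2.1.continuous⟩ :
        LocallyConstant (K.M.carrier ⊕ L.M.carrier) (Fin p)).comap ⟨_, h.symm.continuous⟩, by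
      rintro (i | i)
      · change Sum.elim _ _ (h.symm (N.f₀ i)) = Fin.append a a' i
        refine Fin.addCases (m := X.n) (n := X'.n) (fun i => ?_) (fun i => ?_) i
        · rw [← h₀, h.symm_apply_apply, Fin.append_left]
          exact G.1.2 (Sum.inl i)
        · rw [← h₀', h.symm_apply_apply, Fin.append_right]
          exact G.2.2 (Sum.inl i)
      · change Sum.elim _ _ (h.symm (N.f₁ i)) = Fin.append b b' i
        refine Fin.addCases (m := Y.n) (n := Y'.n) (fun i => ?_) (fun i => ?_) i
        · rw [← h₁, h.symm_apply_apply, Fin.append_left]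
          exact G.1.2 (Sum.inr i)
        · rw [← h₁', h.symm_apply_apply, Fin.append_right]
          exact G.2.2 (Sum.inr i)⟩
  left_inv g := by
    refine Subtype.ext (LocallyConstant.ext fun x => ?_)
    obtain ⟨x, rfl⟩ := h.surjective x
    change Sum.elim _ _ (h.symm (h x)) = _
    rw [h.symm_apply_apply]
    rcases x with x | x <;> rfl
  right_inv G := by
    refine Prod.ext (Subtype.ext (LocallyConstant.ext fun x => ?_))
      (Subtype.ext (LocallyConstant.ext fun x => ?_))
    · change Sum.elim _ _ (h.symm (h (Sum.inl x))) = _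
      rw [h.symm_apply_apply]
      rfl
    · change Sum.elim _ _ (h.symm (h (Sum.inr x))) = _
      rw [h.symm_apply_apply]
      rfl

/-- Locally constant functions on a disjoint union of intervals. -/
noncomputable def locallyConstantCylinderEquiv (k : ℕ) (T : Type*) :
    LocallyConstant (Cylinder k) T ≃ (Fin k → T) where
  toFun g i := g (i, 0)
  invFun c := ⟨fun x => c x.1, (IsLocallyConstant.of_discrete c).comp_continuous continuous_fst⟩
  left_inv g := by
    ext ⟨i, t⟩
    have := (g.comap ⟨fun t : Icc (0 : ℝ) 1 => ((i, t) : Cylinder k),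
      Continuous.prodMk_right i⟩).isLocallyConstant.apply_eq_of_isPreconnected
        isPreconnected_univ (mem_univ 0) (mem_univ t)
    exact this
  right_inv c := rfl

end Cobordism

variable {p : ℕ} {F : Type u} [Field F] {X Y Z X' Y' : OneCob}

/-- The colourings of the composite are sorted by their values on the glued points; for each choice
of values the two pieces are coloured independently. -/
theorem entry_arrow_of_isComposite (hp : 0 < p) {K : Cobordism X Y} {L : Cobordism Y Z}
    {N : Cobordism X Z} (hN : K.IsComposite L N) (a : Fin X.n → Fin p) (c : Fin Z.n → Fin p) :
    entry p F (OneCob.arrow N) a c =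
      ∑ b, entry p F (OneCob.arrow K) a b * entry p F (OneCob.arrow L) b c := by
  obtain ⟨h, -, -, h₀, h₁⟩ := hN
  have : ∀ {X Y : OneCob} (K : Cobordism X Y), Finite (LocallyConstant K.M.carrier (Fin p)) :=
    fun K => Finite.of_equiv _ (Cobordism.locallyConstantEquiv K.M (Fin p)).symm
  simp only [entry_arrow hp]
  rw [Nat.card_congr (Cobordism.coloringsOfIsComposite p h h₀ h₁ a c), Nat.card_sigma]
  simp only [Nat.card_prod]
  push_cast
  rfl

theorem entry_arrow_of_isSideBySide (hp : 0 < p) {K : Cobordism X Y} {L : Cobordism X' Y'}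
    {N : Cobordism (X * X') (Y * Y')} (hN : K.IsSideBySide L N) (a : Fin X.n → Fin p)
    (b : Fin Y.n → Fin p) (a' : Fin X'.n → Fin p) (b' : Fin Y'.n → Fin p) :
    entry p F (OneCob.arrow N) (Fin.append a a') (Fin.append b b') =
      entry p F (OneCob.arrow K) a b * entry p F (OneCob.arrow L) a' b' := by
  obtain ⟨h, -, -, h₀, h₀', h₁, h₁'⟩ := hN
  simp only [entry_arrow hp]
  rw [Nat.card_congr (Cobordism.coloringsOfIsSideBySide p h h₀ h₀' h₁ h₁' a b a' b'),
    Nat.card_prod]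
  push_cast
  rfl

-- Every interval has a labelled end, so there is at most one colouring, and no circle contributes.
-- The entry is therefore 0 or 1, according to whether the labels come from colours of the
-- intervals.
open Classical in
theorem entry_arrow_of_cylinder (hp : 0 < p) {K : Cobordism X Y} {k : ℕ}
    (h : Cylinder k ≃ₜ K.M.carrier) (e : Fin X.n ⊕ Fin Y.n → Fin k × Bool)
    (he : ∀ s, h (Cylinder.endpoint (e s)) = K.point s) (hs : ∀ i, ∃ s, (e s).1 = i)
    (a : Fin X.n → Fin p) (b : Fin Y.n → Fin p) :
    entry p F (OneCob.arrow K) a b =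
      if ∃ c : Fin k → Fin p, ∀ s, c (e s).1 = Sum.elim a b s then 1 else 0 := by
  have e' : {g : LocallyConstant K.M.carrier (Fin p) // ∀ s, g (K.point s) = Sum.elim a b s} ≃
      {c : Fin k → Fin p // ∀ s, c (e s).1 = Sum.elim a b s} := by
    refine ((LocallyConstant.congrLeft h.symm).trans
      (Cobordism.locallyConstantCylinderEquiv k (Fin p))).subtypeEquiv fun g => ?_
    refine forall_congr' fun s => ?_
    rw [← he]
    have : ∀ g' : LocallyConstant (Cylinder k) (Fin p),
        g' (Cylinder.endpoint (e s)) =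
          Cobordism.locallyConstantCylinderEquiv k (Fin p) g' (e s).1 := by
      intro g'
      obtain ⟨c, rfl⟩ := (Cobordism.locallyConstantCylinderEquiv k (Fin p)).symm.surjective g'
      rw [Equiv.apply_symm_apply]
      rfl
    rw [Equiv.trans_apply, ← this]
    simp [LocallyConstant.congrLeft]
  rw [entry_arrow hp, Nat.card_congr e']
  split_ifs with hc
  · obtain ⟨c, hc⟩ := hc
    have : Unique {c : Fin k → Fin p // ∀ s, c (e s).1 = Sum.elim a b s} :=
      { default := ⟨c, hc⟩
        uniq := fun c' => Subtype.ext (funext fun i => by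
          obtain ⟨s, rfl⟩ := hs i
          exact (c'.2 s).trans (hc s).symm) }
    rw [Nat.card_unique, Nat.cast_one]
  · have : IsEmpty {c : Fin k → Fin p // ∀ s, c (e s).1 = Sum.elim a b s} :=
      ⟨fun c => hc ⟨c.1, c.2⟩⟩
    rw [Nat.card_of_isEmpty, Nat.cast_zero]

end Entries

/-! ### Identities, symmetries and the structure cobordisms of the sphere -/

section Generators

open Set Filter

namespace Cobordism

variable {X Y : OneCob}

/-- An interval, rescaled. -/
noncomputable def cylinderHomeomorphDisc : Cylinder 1 ≃ₜ Disc :=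
  Continuous.homeoOfEquivCompactToT2 (f := Equiv.ofBijective
    (fun x : Cylinder 1 => (⟨5 * x.2, by
      constructor <;> linarith [x.2.2.1, x.2.2.2]⟩ : Disc)) (by
    constructor
    · rintro ⟨i, s⟩ ⟨j, t⟩ h
      have h : 5 * (s : ℝ) = 5 * t := congrArg Subtype.val h
      exact Prod.ext (Subsingleton.elim _ _) (Subtype.ext (by simp only; linarith))
    · rintro ⟨x, h0, h1⟩
      exact ⟨(0, ⟨x / 5, by linarith, by linarith⟩), Subtype.ext (by simp only; ring)⟩))
    (by
      change Continuous fun x : Cylinder 1 => (⟨5 * x.2, _⟩ : Disc)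
      fun_prop)

/-- The interval with two gaps consists of three intervals. -/
noncomputable def cylinderHomeomorphPants : Cylinder 3 ≃ₜ Pants :=
  Continuous.homeoOfEquivCompactToT2 (f := Equiv.ofBijective
    -- The i-th interval is placed at [2i, 2i + 1], giving [0, 1], [2, 3] and [4, 5].
    (fun x : Cylinder 3 => (⟨2 * (x.1 : ℕ) + x.2, by
      obtain ⟨i, t, h0, h1⟩ := x
      fin_cases i <;> norm_num <;> (try constructor) <;> (try constructor) <;> intros <;>
        linarith⟩ : Pants)) (by
    constructor
    · rintro ⟨i, s, hs0, hs1⟩ ⟨j, t, ht0, ht1⟩ h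
      have h : 2 * ((i : ℕ) : ℝ) + s = 2 * ((j : ℕ) : ℝ) + t := congrArg Subtype.val h
      have hij : (i : ℕ) = j := by
        rcases lt_trichotomy (i : ℕ) j with hlt | heq | hlt
        · have : ((i : ℕ) : ℝ) + 1 ≤ (j : ℕ) := by exact_mod_cast hlt
          linarith
        · exact heq
        · have : ((j : ℕ) : ℝ) + 1 ≤ (i : ℕ) := by exact_mod_cast hlt
          linarith
      obtain rfl : i = j := Fin.ext hij
      have : s = t := by linarith
      subst this
      rfl
    · rintro ⟨x, ⟨h0, h1⟩, h2⟩
      simp only [mem_union, mem_Ioo, not_or, not_and, not_lt] at h2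
      by_cases hx1 : x ≤ 1
      · exact ⟨(0, ⟨x, h0, hx1⟩), Subtype.ext (by simp)⟩
      have hx2 := h2.1 (not_le.1 hx1)
      by_cases hx3 : x ≤ 3
      · exact ⟨(1, ⟨x - 2, by linarith, by linarith⟩), Subtype.ext (by simp)⟩
      have hx4 := h2.2 (not_le.1 hx3)
      exact ⟨(2, ⟨x - 4, by linarith, by linarith⟩), Subtype.ext (by simp; norm_num)⟩))
    (by
      change Continuous fun x : Cylinder 3 => (⟨2 * (x.1 : ℕ) + x.2, _⟩ : Pants)
      refine Continuous.subtype_mk ?_ _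
      have : Continuous fun x : Cylinder 3 => ((x.1 : ℕ) : ℝ) :=
        (continuous_of_discreteTopology (f := fun i : Fin 3 => ((i : ℕ) : ℝ))).comp continuous_fst
      fun_prop)

theorem cylinderHomeomorphDisc_endpoint (b : Bool) :
    (cylinderHomeomorphDisc (Cylinder.endpoint (0, b)) : ℝ) = if b then 5 else 0 := by
  change 5 * ((Cylinder.endpoint ((0 : Fin 1), b)).2 : ℝ) = _
  cases b <;> simp [Cylinder.endpoint]

theorem cylinderHomeomorphPants_endpoint (i : Fin 3) (b : Bool) :
    (cylinderHomeomorphPants (Cylinder.endpoint (i, b)) : ℝ) =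
      2 * (i : ℕ) + if b then 1 else 0 := by
  change 2 * ((i : ℕ) : ℝ) + ((Cylinder.endpoint (i, b)).2 : ℝ) = _
  cases b <;> simp [Cylinder.endpoint]

theorem exists_isIdentity (X : OneCob) : ∃ K, IsIdentity X K := by
  obtain ⟨N, h, h₀, h₁⟩ := Cylinder.exists_cobordism (X := X) (Y := X) X.sign
    (fun i => (i, false)) (fun i => (i, true))
    ⟨by rintro (i | i) (j | j) h <;> simp at h <;> simp [h], by
      rintro ⟨i, _ | _⟩
      · exact ⟨Sum.inl i, rfl⟩
      · exact ⟨Sum.inr i, rfl⟩⟩ (by simp [Cylinder.endSign]) (by simp [Cylinder.endSign])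
  exact ⟨N, h, fun i => by simpa [Cylinder.endpoint] using h₀ i,
    fun i => by simpa [Cylinder.endpoint] using h₁ i⟩

theorem sign_mul_finAddFlip (X Y : OneCob) (i : Fin (X.n + Y.n)) :
    (Y * X).sign (finAddFlip i) = (X * Y).sign i := by
  change Fin.append Y.sign X.sign (finAddFlip i) = Fin.append X.sign Y.sign i
  refine Fin.addCases (fun i => ?_) (fun i => ?_) i <;> simp

theorem exists_isSymmetry (X Y : OneCob) : ∃ K, IsSymmetry X Y K := by
  obtain ⟨N, h, h₀, h₁⟩ := Cylinder.exists_cobordism (X := X * Y) (Y := Y * X) (X * Y).sign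
    -- An outgoing point is the far end of the line whose start is the corresponding point before
    -- the exchange of blocks.
    (fun i => (i, false)) (fun i => ((finAddFlip (m := X.n) (n := Y.n)).symm i, true))
    ⟨by rintro (i | i) (j | j) h <;> simp at h <;> simp [h], by
      rintro ⟨i, _ | _⟩
      · exact ⟨Sum.inl i, rfl⟩
      · exact ⟨Sum.inr (finAddFlip (m := X.n) (n := Y.n) i),
          Prod.ext (Equiv.symm_apply_apply _ _) rfl⟩⟩
    (by simp [Cylinder.endSign]) (fun j => by
      obtain ⟨j, rfl⟩ := (finAddFlip (m := X.n) (n := Y.n)).surjective j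
      rw [Equiv.symm_apply_apply, sign_mul_finAddFlip]
      simp [Cylinder.endSign])
  refine ⟨N, h, fun i => by simpa [Cylinder.endpoint] using h₀ i, fun i => ?_⟩
  have := h₁ (finAddFlip (m := X.n) (n := Y.n) i)
  rw [Equiv.symm_apply_apply] at this
  simpa [Cylinder.endpoint] using this

theorem disc_endpoint {N : Type*} [TopologicalSpace N] (h : Cylinder 1 ≃ₜ N) (x : Disc) (b : Bool)
    (hx : (x : ℝ) = if b then 5 else 0) :
    (cylinderHomeomorphDisc.symm.trans h) x = h (Cylinder.endpoint (0, b)) := by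
  rw [Homeomorph.trans_apply, show x = cylinderHomeomorphDisc (Cylinder.endpoint (0, b)) from
    Subtype.ext (hx.trans (cylinderHomeomorphDisc_endpoint b).symm), Homeomorph.symm_apply_apply]

theorem pants_endpoint {N : Type*} [TopologicalSpace N] (h : Cylinder 3 ≃ₜ N) (x : Pants)
    (i : Fin 3) (b : Bool) (hx : (x : ℝ) = 2 * (i : ℕ) + if b then 1 else 0) :
    (cylinderHomeomorphPants.symm.trans h) x = h (Cylinder.endpoint (i, b)) := by
  rw [Homeomorph.trans_apply, show x = cylinderHomeomorphPants (Cylinder.endpoint (i, b)) from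
    Subtype.ext (hx.trans (cylinderHomeomorphPants_endpoint i b).symm),
    Homeomorph.symm_apply_apply]

/-- The end points of an interval. -/
def discEnds : Fin 2 → Fin 1 × Bool := ![(0, false), (0, true)]

/-- The end points of three intervals that are boundary points of the outer disc. -/
def outerEnds : Fin 2 → Fin 3 × Bool := ![(0, false), (2, true)]

/-- The end points of three intervals that are boundary points of the inner discs. -/
def innerEnds : Fin 4 → Fin 3 × Bool := ![(0, true), (1, false), (1, true), (2, false)]

theorem exists_isUnit : ∃ K, IsUnit K := by
  obtain ⟨N, h, -, h₁⟩ := Cylinder.exists_cobordism (X := 1) (Y := OneCob.sphere) (k := 1)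
    -- The sphere is outgoing here and outgoing signs are reversed, so the interval must start with
    -- sign -1 at the positive point of the sphere.
    (fun _ => -1) Fin.elim0 discEnds
    (show Function.Bijective (Sum.elim (Fin.elim0 : Fin 0 → _) discEnds) from
      ⟨by decide, by decide⟩) (fun i => i.elim0)
    (show ∀ j : Fin 2, (![1, -1] : Fin 2 → ℤˣ) j = _ by decide)
  exact ⟨N, cylinderHomeomorphDisc.symm.trans h,
    (disc_endpoint h _ false (by simp)).trans (h₁ (0 : Fin 2)),
    (disc_endpoint h _ true (by simp)).trans (h₁ (1 : Fin 2))⟩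

theorem exists_isCounit : ∃ K, IsCounit K := by
  obtain ⟨N, h, h₀, -⟩ := Cylinder.exists_cobordism (X := OneCob.sphere) (Y := 1) (k := 1)
    (fun _ => 1) discEnds Fin.elim0
    (show Function.Bijective (Sum.elim discEnds (Fin.elim0 : Fin 0 → _)) from
      ⟨by decide, by decide⟩)
    (show ∀ j : Fin 2, (![1, -1] : Fin 2 → ℤˣ) j = _ by decide) (fun i => i.elim0)
  exact ⟨N, cylinderHomeomorphDisc.symm.trans h,
    (disc_endpoint h _ false (by simp)).trans (h₀ (0 : Fin 2)),
    (disc_endpoint h _ true (by simp)).trans (h₀ (1 : Fin 2))⟩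

theorem exists_isMultiplication : ∃ K, IsMultiplication K := by
  obtain ⟨N, h, h₀, h₁⟩ := Cylinder.exists_cobordism (X := OneCob.sphere * OneCob.sphere)
    (Y := OneCob.sphere) (k := 3) (fun _ => -1) innerEnds outerEnds
    (show Function.Bijective (Sum.elim innerEnds outerEnds) from ⟨by decide, by decide⟩)
    (show ∀ j : Fin 4, (Fin.append ![1, -1] ![1, -1] : Fin (2 + 2) → ℤˣ) j = _ by decide)
    (show ∀ j : Fin 2, (![1, -1] : Fin 2 → ℤˣ) j = _ by decide)
  exact ⟨N, cylinderHomeomorphPants.symm.trans h,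
    (pants_endpoint h _ 0 false (by norm_num)).trans (h₁ (0 : Fin 2)),
    (pants_endpoint h _ 2 true (by norm_num)).trans (h₁ (1 : Fin 2)),
    (pants_endpoint h _ 0 true (by norm_num)).trans (h₀ (0 : Fin 4)),
    (pants_endpoint h _ 1 false (by norm_num)).trans (h₀ (1 : Fin 4)),
    (pants_endpoint h _ 1 true (by norm_num)).trans (h₀ (2 : Fin 4)),
    (pants_endpoint h _ 2 false (by norm_num)).trans (h₀ (3 : Fin 4))⟩

theorem exists_isComultiplication : ∃ K, IsComultiplication K := by
  obtain ⟨N, h, h₀, h₁⟩ := Cylinder.exists_cobordism (Y := OneCob.sphere * OneCob.sphere)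
    (X := OneCob.sphere) (k := 3) (fun _ => 1) outerEnds innerEnds
    (show Function.Bijective (Sum.elim outerEnds innerEnds) from ⟨by decide, by decide⟩)
    (show ∀ j : Fin 2, (![1, -1] : Fin 2 → ℤˣ) j = _ by decide)
    (show ∀ j : Fin 4, (Fin.append ![1, -1] ![1, -1] : Fin (2 + 2) → ℤˣ) j = _ by decide)
  exact ⟨N, cylinderHomeomorphPants.symm.trans h,
    (pants_endpoint h _ 0 false (by norm_num)).trans (h₀ (0 : Fin 2)),
    (pants_endpoint h _ 2 true (by norm_num)).trans (h₀ (1 : Fin 2)),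
    (pants_endpoint h _ 0 true (by norm_num)).trans (h₁ (0 : Fin 4)),
    (pants_endpoint h _ 1 false (by norm_num)).trans (h₁ (1 : Fin 4)),
    (pants_endpoint h _ 1 true (by norm_num)).trans (h₁ (2 : Fin 4)),
    (pants_endpoint h _ 2 false (by norm_num)).trans (h₁ (3 : Fin 4))⟩

end Cobordism

variable {p : ℕ} {F : Type u} [Field F]

theorem entry_arrow_of_isIdentity (hp : 0 < p) {X : OneCob} {K : Cobordism X X}
    (hK : K.IsIdentity X) (a b : Fin X.n → Fin p) :
    entry p F (OneCob.arrow K) a b = if a = b then 1 else 0 := by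
  classical
  obtain ⟨h, h₀, h₁⟩ := hK
  rw [entry_arrow_of_cylinder hp h (Sum.elim (fun i => (i, false)) (fun i => (i, true)))]
  · refine if_congr ⟨?_, ?_⟩ rfl rfl
    · rintro ⟨c, hc⟩
      exact funext fun i => (hc (Sum.inl i)).symm.trans (hc (Sum.inr i))
    · rintro rfl
      exact ⟨a, by rintro (i | i) <;> rfl⟩
  · rintro (i | i)
    · simpa [Cylinder.endpoint, Cobordism.point] using h₀ i
    · simpa [Cylinder.endpoint, Cobordism.point] using h₁ i
  · exact fun i => ⟨Sum.inl i, rfl⟩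

theorem entry_arrow_of_isSymmetry (hp : 0 < p) {X Y : OneCob} {K : Cobordism (X * Y) (Y * X)}
    (hK : K.IsSymmetry X Y) (a : Fin X.n → Fin p) (a' : Fin Y.n → Fin p) (b : Fin X.n → Fin p)
    (b' : Fin Y.n → Fin p) :
    entry p F (OneCob.arrow K) (Fin.append a a') (Fin.append b' b) =
      if a = b ∧ a' = b' then 1 else 0 := by
  classical
  obtain ⟨h, h₀, h₁⟩ := hK
  rw [entry_arrow_of_cylinder hp h (Sum.elim (fun i => (i, false))
    (fun i => ((finAddFlip (m := X.n) (n := Y.n)).symm i, true)))]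
  · refine if_congr ⟨?_, ?_⟩ rfl rfl
    · rintro ⟨c, hc⟩
      constructor
      · ext i
        have h1 : c (Fin.castAdd Y.n i) = Fin.append a a' (Fin.castAdd Y.n i) :=
          hc (Sum.inl (Fin.castAdd Y.n i))
        have h2 : c (finAddFlip.symm (Fin.natAdd Y.n i)) = Fin.append b' b (Fin.natAdd Y.n i) :=
          hc (Sum.inr (Fin.natAdd Y.n i))
        rw [Fin.append_left] at h1
        rw [Fin.append_right] at h2
        rw [← h1, ← h2, ← finAddFlip_apply_castAdd, Equiv.symm_apply_apply]
      · ext i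
        have h1 : c (Fin.natAdd X.n i) = Fin.append a a' (Fin.natAdd X.n i) :=
          hc (Sum.inl (Fin.natAdd X.n i))
        have h2 : c (finAddFlip.symm (Fin.castAdd X.n i)) = Fin.append b' b (Fin.castAdd X.n i) :=
          hc (Sum.inr (Fin.castAdd X.n i))
        rw [Fin.append_right] at h1
        rw [Fin.append_left] at h2
        rw [← h1, ← h2, ← finAddFlip_apply_natAdd, Equiv.symm_apply_apply]
    · rintro ⟨rfl, rfl⟩
      refine ⟨Fin.append a a', ?_⟩
      rintro (i | i)
      · rfl
      · change Fin.append a a' (finAddFlip.symm i) = Fin.append a' a i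
        obtain ⟨i, rfl⟩ := (finAddFlip (m := X.n) (n := Y.n)).surjective i
        rw [Equiv.symm_apply_apply]
        refine Fin.addCases (fun i => ?_) (fun i => ?_) i <;> simp
  · rintro (i | i)
    · simpa [Cylinder.endpoint, Cobordism.point] using h₀ i
    · obtain ⟨i, rfl⟩ := (finAddFlip (m := X.n) (n := Y.n)).surjective i
      refine Eq.trans ?_ (h₁ i)
      simp [Cylinder.endpoint]
  · exact fun i => ⟨Sum.inl i, rfl⟩

theorem entry_arrow_of_isUnit (hp : 0 < p) {K : Cobordism 1 OneCob.sphere} (hK : K.IsUnit)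
    (a : Fin 0 → Fin p) (b : Fin 2 → Fin p) :
    entry p F (OneCob.arrow K) a b = if b 0 = b 1 then 1 else 0 := by
  classical
  obtain ⟨h, h₀, h₁⟩ := hK
  refine (entry_arrow_of_cylinder hp (Cobordism.cylinderHomeomorphDisc.trans h)
    (Sum.elim (Fin.elim0 : Fin 0 → _) Cobordism.discEnds) ?_ ?_ a b).trans ?_
  rotate_left 2
  · refine if_congr ⟨?_, ?_⟩ rfl rfl
    · rintro ⟨c, hc⟩
      exact (hc (Sum.inr (0 : Fin 2))).symm.trans (hc (Sum.inr (1 : Fin 2)))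
    · intro hb
      refine ⟨fun _ => b 0, ?_⟩
      rintro (i | i)
      · exact i.elim0
      · revert i
        exact Fin.forall_fin_two.2 ⟨rfl, hb⟩
  · rintro (i | i)
    · exact i.elim0
    · revert i
      refine Fin.forall_fin_two.2 ⟨Eq.trans ?_ h₀, Eq.trans ?_ h₁⟩ <;>
      exact congrArg h (Subtype.ext (Cobordism.cylinderHomeomorphDisc_endpoint _))
  · exact fun i => ⟨Sum.inr (0 : Fin 2), Subsingleton.elim _ _⟩

theorem entry_arrow_of_isCounit (hp : 0 < p) {K : Cobordism OneCob.sphere 1} (hK : K.IsCounit)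
    (a : Fin 2 → Fin p) (b : Fin 0 → Fin p) :
    entry p F (OneCob.arrow K) a b = if a 0 = a 1 then 1 else 0 := by
  classical
  obtain ⟨h, h₀, h₁⟩ := hK
  refine (entry_arrow_of_cylinder hp (Cobordism.cylinderHomeomorphDisc.trans h)
    (Sum.elim Cobordism.discEnds (Fin.elim0 : Fin 0 → _)) ?_ ?_ a b).trans ?_
  rotate_left 2
  · refine if_congr ⟨?_, ?_⟩ rfl rfl
    · rintro ⟨c, hc⟩
      exact (hc (Sum.inl (0 : Fin 2))).symm.trans (hc (Sum.inl (1 : Fin 2)))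
    · intro hb
      refine ⟨fun _ => a 0, ?_⟩
      rintro (i | i)
      · revert i
        exact Fin.forall_fin_two.2 ⟨rfl, hb⟩
      · exact i.elim0
  · rintro (i | i)
    · revert i
      refine Fin.forall_fin_two.2 ⟨Eq.trans ?_ h₀, Eq.trans ?_ h₁⟩ <;>
      exact congrArg h (Subtype.ext (Cobordism.cylinderHomeomorphDisc_endpoint _))
    · exact i.elim0
  · exact fun i => ⟨Sum.inl (0 : Fin 2), Subsingleton.elim _ _⟩

theorem Fin.forall_fin_four {P : Fin 4 → Prop} : (∀ i, P i) ↔ P 0 ∧ P 1 ∧ P 2 ∧ P 3 := by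
  simp [Fin.forall_fin_succ]

theorem pants_apply_endpoint {N : Type*} [TopologicalSpace N] (h : Cobordism.Pants ≃ₜ N)
    (b : Fin 3 × Bool) {x : ℝ} (hx : x ∈ Cobordism.Pants) {y : N} (hy : h ⟨x, hx⟩ = y)
    (hb : 2 * ((b.1 : ℕ) : ℝ) + (if b.2 then 1 else 0) = x) :
    Cobordism.cylinderHomeomorphPants.trans h (Cylinder.endpoint b) = y :=
  (congrArg h (Subtype.ext ((Cobordism.cylinderHomeomorphPants_endpoint _ _).trans hb))).trans hy

/-- The outer intervals carry over the first index of the left factor and the last index of the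
right one, while the middle interval forces the two inner indices to agree, as in a product of
matrix units. -/
theorem entry_arrow_of_isMultiplication (hp : 0 < p)
    {K : Cobordism (OneCob.sphere * OneCob.sphere) OneCob.sphere} (hK : K.IsMultiplication)
    (a : Fin 4 → Fin p) (b : Fin 2 → Fin p) :
    entry p F (OneCob.arrow K) a b = if a 0 = b 0 ∧ a 1 = a 2 ∧ a 3 = b 1 then 1 else 0 := by
  classical
  obtain ⟨h, h₀, h₁, h₂, h₃, h₄, h₅⟩ := hK
  refine (entry_arrow_of_cylinder hp (Cobordism.cylinderHomeomorphPants.trans h)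
    (Sum.elim Cobordism.innerEnds Cobordism.outerEnds) ?_ ?_ a b).trans ?_
  rotate_left 2
  · refine if_congr ⟨?_, ?_⟩ rfl rfl
    · rintro ⟨c, hc⟩
      exact ⟨(hc (Sum.inl (0 : Fin 4))).symm.trans (hc (Sum.inr (0 : Fin 2))),
        (hc (Sum.inl (1 : Fin 4))).symm.trans (hc (Sum.inl (2 : Fin 4))),
        (hc (Sum.inl (3 : Fin 4))).symm.trans (hc (Sum.inr (1 : Fin 2)))⟩
    · rintro ⟨hb0, hb1, hb2⟩
      refine ⟨![a 0, a 1, a 3], Sum.forall.2 ⟨?_, ?_⟩⟩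
      · exact Fin.forall_fin_four.2 ⟨rfl, rfl, hb1, rfl⟩
      · exact Fin.forall_fin_two.2 ⟨hb0, hb2⟩
  · refine Sum.forall.2 ⟨Fin.forall_fin_four.2 ⟨?_, ?_, ?_, ?_⟩, Fin.forall_fin_two.2 ⟨?_, ?_⟩⟩
    · exact pants_apply_endpoint h (0, true) _ h₂ (by norm_num)
    · exact pants_apply_endpoint h (1, false) _ h₃ (by norm_num)
    · exact pants_apply_endpoint h (1, true) _ h₄ (by norm_num)
    · exact pants_apply_endpoint h (2, false) _ h₅ (by norm_num)
    · exact pants_apply_endpoint h (0, false) _ h₀ (by norm_num)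
    · exact pants_apply_endpoint h (2, true) _ h₁ (by norm_num)
  · exact show ∀ i : Fin 3, ∃ s : Fin 4 ⊕ Fin 2,
      (Sum.elim Cobordism.innerEnds Cobordism.outerEnds s).1 = i by decide

theorem entry_arrow_of_isComultiplication (hp : 0 < p)
    {K : Cobordism OneCob.sphere (OneCob.sphere * OneCob.sphere)} (hK : K.IsComultiplication)
    (a : Fin 2 → Fin p) (b : Fin 4 → Fin p) :
    entry p F (OneCob.arrow K) a b = if a 0 = b 0 ∧ b 1 = b 2 ∧ a 1 = b 3 then 1 else 0 := by
  classical
  obtain ⟨h, h₀, h₁, h₂, h₃, h₄, h₅⟩ := hK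
  refine (entry_arrow_of_cylinder hp (Cobordism.cylinderHomeomorphPants.trans h)
    (Sum.elim Cobordism.outerEnds Cobordism.innerEnds) ?_ ?_ a b).trans ?_
  rotate_left 2
  · refine if_congr ⟨?_, ?_⟩ rfl rfl
    · rintro ⟨c, hc⟩
      exact ⟨(hc (Sum.inl (0 : Fin 2))).symm.trans (hc (Sum.inr (0 : Fin 4))),
        (hc (Sum.inr (1 : Fin 4))).symm.trans (hc (Sum.inr (2 : Fin 4))),
        (hc (Sum.inl (1 : Fin 2))).symm.trans (hc (Sum.inr (3 : Fin 4)))⟩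
    · rintro ⟨hb0, hb1, hb2⟩
      refine ⟨![a 0, b 1, a 1], Sum.forall.2 ⟨?_, ?_⟩⟩
      · exact Fin.forall_fin_two.2 ⟨rfl, rfl⟩
      · exact Fin.forall_fin_four.2 ⟨hb0, rfl, hb1, hb2⟩
  · refine Sum.forall.2 ⟨Fin.forall_fin_two.2 ⟨?_, ?_⟩, Fin.forall_fin_four.2 ⟨?_, ?_, ?_, ?_⟩⟩
    · exact pants_apply_endpoint h (0, false) _ h₀ (by norm_num)
    · exact pants_apply_endpoint h (2, true) _ h₁ (by norm_num)
    · exact pants_apply_endpoint h (0, true) _ h₂ (by norm_num)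
    · exact pants_apply_endpoint h (1, false) _ h₃ (by norm_num)
    · exact pants_apply_endpoint h (1, true) _ h₄ (by norm_num)
    · exact pants_apply_endpoint h (2, false) _ h₅ (by norm_num)
  · exact show ∀ i : Fin 3, ∃ s : Fin 2 ⊕ Fin 4,
      (Sum.elim Cobordism.outerEnds Cobordism.innerEnds s).1 = i by decide

end Generators

/-! ### Matrices as a symmetric strict monoidal category -/

section Matrices

namespace MatCat

variable {F : Type u} [Field F]

/-- The Kronecker product of matrices with rows and columns numbered by initial segments. -/
def kronecker {m n m' n' : ℕ} (A : Matrix (Fin m) (Fin n) F) (B : Matrix (Fin m') (Fin n') F) :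
    Matrix (Fin (m * m')) (Fin (n * n')) F :=
  Matrix.reindex finProdFinEquiv finProdFinEquiv (Matrix.kroneckerMap (· * ·) A B)

/-- The matrix sending the basis vector `j` to the basis vector `σ j`. -/
def ofFun (F : Type u) [Field F] {m n : ℕ} (σ : Fin n → Fin m) : Matrix (Fin m) (Fin n) F :=
  Matrix.of fun i j => if i = σ j then 1 else 0

/-- The number of `(j, i)` as a function of the number of `(i, j)`. -/
def flip (n m : ℕ) : Fin (n * m) ≃ Fin (m * n) :=
  finProdFinEquiv.symm.trans ((Equiv.prodComm _ _).trans finProdFinEquiv)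

theorem kronecker_apply {m n m' n' : ℕ} (A : Matrix (Fin m) (Fin n) F)
    (B : Matrix (Fin m') (Fin n') F) (i : Fin m) (k : Fin m') (j : Fin n) (l : Fin n') :
    kronecker A B (finProdFinEquiv (i, k)) (finProdFinEquiv (j, l)) = A i j * B k l := by
  simp [kronecker, Matrix.kroneckerMap_apply]

@[simp]
theorem flip_apply {n m : ℕ} (i : Fin n) (j : Fin m) :
    flip n m (finProdFinEquiv (i, j)) = finProdFinEquiv (j, i) := by
  simp [flip]

theorem flip_symm (n m : ℕ) : (flip n m).symm = flip m n := rfl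

theorem ext_prod {R : Type*} {m n m' n' : ℕ} {A B : Matrix (Fin (m * m')) (Fin (n * n')) R}
    (h : ∀ i k j l, A (finProdFinEquiv (i, k)) (finProdFinEquiv (j, l)) =
      B (finProdFinEquiv (i, k)) (finProdFinEquiv (j, l))) : A = B := by
  ext a b
  obtain ⟨⟨i, k⟩, rfl⟩ := finProdFinEquiv.surjective a
  obtain ⟨⟨j, l⟩, rfl⟩ := finProdFinEquiv.surjective b
  exact h i k j l

theorem symm_eq (X Y : MatCat F) : (ops F).symm X Y = ofFun F (flip X.dim Y.dim) := by
  refine ext_prod fun i k j l => ?_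
  rw [ofFun, Matrix.of_apply, flip_apply]
  simp [ops]

theorem ofFun_id (n : ℕ) : ofFun F (id : Fin n → Fin n) = 1 := by
  ext i j
  simp [ofFun, Matrix.one_apply]

theorem mul_ofFun {m n k : ℕ} (A : Matrix (Fin m) (Fin n) F) (σ : Fin k → Fin n) (i : Fin m)
    (j : Fin k) : (A * ofFun F σ) i j = A i (σ j) := by
  simp [Matrix.mul_apply, ofFun]

theorem ofFun_mul_apply {m n k : ℕ} (σ : Fin n ≃ Fin m) (A : Matrix (Fin n) (Fin k) F) (i : Fin n)
    (j : Fin k) : (ofFun F σ * A) (σ i) j = A i j := by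
  simp [Matrix.mul_apply, ofFun]

theorem ofFun_mul_ofFun {m n k : ℕ} (σ : Fin n → Fin m) (τ : Fin k → Fin n) :
    ofFun F σ * ofFun F τ = ofFun F (σ ∘ τ) := by
  ext i j
  rw [mul_ofFun]
  rfl

theorem kronecker_ofFun {m n m' n' : ℕ} (σ : Fin n → Fin m) (τ : Fin n' → Fin m') :
    kronecker (ofFun F σ) (ofFun F τ) =
      ofFun F (finProdFinEquiv ∘ Prod.map σ τ ∘ finProdFinEquiv.symm) := by
  refine ext_prod fun i k j l => ?_
  rw [kronecker_apply]
  simp only [ofFun, Matrix.of_apply, Function.comp_apply, Equiv.symm_apply_apply, Prod.map_apply,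
    EmbeddingLike.apply_eq_iff_eq, Prod.mk.injEq, ite_and, ite_mul, one_mul, zero_mul]

theorem kronecker_mul {m n l m' n' l' : ℕ} (A : Matrix (Fin m) (Fin n) F)
    (B : Matrix (Fin n) (Fin l) F) (A' : Matrix (Fin m') (Fin n') F)
    (B' : Matrix (Fin n') (Fin l') F) :
    kronecker (A * B) (A' * B') = kronecker A A' * kronecker B B' := by
  unfold kronecker
  rw [show Matrix.kroneckerMap (· * ·) (A * B) (A' * B') = _ from
    Matrix.mul_kronecker_mul A B A' B']
  exact (Matrix.reindexLinearEquiv_mul F F finProdFinEquiv finProdFinEquiv finProdFinEquiv _ _).symm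

theorem matrix_heq {R : Type*} {m n m' n' : ℕ} (hm : m = m') (hn : n = n')
    {A : Matrix (Fin m) (Fin n) R} {B : Matrix (Fin m') (Fin n') R}
    (h : ∀ i j, A i j = B (Fin.cast hm i) (Fin.cast hn j)) :
    HEq A B := by
  subst hm hn
  exact heq_of_eq (Matrix.ext h)

/-- Strictness holds because both bracketings number a triple (i, j, k) in the same lexicographic
way. -/
theorem kronecker_assoc {m n m' n' m'' n'' : ℕ} (A : Matrix (Fin m) (Fin n) F)
    (B : Matrix (Fin m') (Fin n') F) (C : Matrix (Fin m'') (Fin n'') F) :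
    HEq (kronecker (kronecker A B) C) (kronecker A (kronecker B C)) := by
  refine matrix_heq (mul_assoc _ _ _) (mul_assoc _ _ _) fun a b => ?_
  obtain ⟨⟨i, k⟩, rfl⟩ := finProdFinEquiv.surjective a
  obtain ⟨⟨i, j⟩, rfl⟩ := finProdFinEquiv.surjective i
  obtain ⟨⟨i', k'⟩, rfl⟩ := finProdFinEquiv.surjective b
  obtain ⟨⟨i', j'⟩, rfl⟩ := finProdFinEquiv.surjective i'
  have h : ∀ {a b c : ℕ} (i : Fin a) (j : Fin b) (k : Fin c) (h : a * b * c = a * (b * c)),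
      Fin.cast h (finProdFinEquiv (finProdFinEquiv (i, j), k)) =
        finProdFinEquiv (i, finProdFinEquiv (j, k)) := by
    intro a b c i j k h
    ext
    simp only [Fin.val_cast, finProdFinEquiv_apply_val]
    ring
  rw [h, h]
  simp only [kronecker_apply]
  ring

theorem one_kronecker {m n : ℕ} (A : Matrix (Fin m) (Fin n) F) :
    HEq (kronecker (1 : Matrix (Fin 1) (Fin 1) F) A) A := by
  refine matrix_heq (one_mul _) (one_mul _) fun a b => ?_
  obtain ⟨⟨i, k⟩, rfl⟩ := finProdFinEquiv.surjective a
  obtain ⟨⟨i', k'⟩, rfl⟩ := finProdFinEquiv.surjective b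
  have h : ∀ {a : ℕ} (i : Fin 1) (k : Fin a) (h : 1 * a = a),
      Fin.cast h (finProdFinEquiv (i, k)) = k := by
    intro a i k h
    ext
    simp
  rw [h, h, kronecker_apply, Subsingleton.elim i i', Matrix.one_apply_eq, one_mul]

theorem kronecker_one {m n : ℕ} (A : Matrix (Fin m) (Fin n) F) :
    HEq (kronecker A (1 : Matrix (Fin 1) (Fin 1) F)) A := by
  refine matrix_heq (mul_one _) (mul_one _) fun a b => ?_
  obtain ⟨⟨k, i⟩, rfl⟩ := finProdFinEquiv.surjective a
  obtain ⟨⟨k', i'⟩, rfl⟩ := finProdFinEquiv.surjective b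
  have h : ∀ {a : ℕ} (i : Fin 1) (k : Fin a) (h : a * 1 = a),
      Fin.cast h (finProdFinEquiv (k, i)) = k := by
    intro a i k h
    ext
    simp
  rw [h, h, kronecker_apply, Subsingleton.elim i i', Matrix.one_apply_eq, mul_one]

/-- Both products have the entry A i j * B k l at corresponding places; they differ only in the
order of the factors. -/
theorem ofFun_flip_natural {m n m' n' : ℕ} (A : Matrix (Fin m) (Fin n) F)
    (B : Matrix (Fin m') (Fin n') F) :
    ofFun F (flip m m') * kronecker A B = kronecker B A * ofFun F (flip n n') := by
  refine ext_prod fun i k j l => ?_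
  rw [mul_ofFun, flip_apply, kronecker_apply, ← flip_apply k i, ofFun_mul_apply, kronecker_apply,
    mul_comm]

theorem cast_ofFun {X X' Y Y' : MatCat F} (hX : X = X') (hY : Y = Y')
    (σ : Fin X.dim → Fin Y.dim) :
    Quiver.Hom.cast hX hY (ofFun F σ : X ⟶ Y) =
      ofFun F (Fin.cast (congrArg dim hY) ∘ σ ∘ Fin.cast (congrArg dim hX.symm)) := by
  subst hX hY
  rfl

/-- All matrices in the hexagon are permutation matrices, so it is an identity between maps of
indices. The casts reflect rebracketings that leave the number of a triple unchanged. -/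
theorem flip_hexagon (a b c : ℕ) (h₁ : a * b * c = a * (b * c)) (h₂ : a * (c * b) = a * c * b)
    (h₃ : c * a * b = c * (a * b)) :
    (flip (a * b) c : Fin (a * b * c) → Fin (c * (a * b))) =
      (Fin.cast h₃ ∘ finProdFinEquiv ∘ Prod.map (flip a c) id ∘ finProdFinEquiv.symm) ∘
        (Fin.cast h₂ ∘ (finProdFinEquiv ∘ Prod.map id (flip b c) ∘ finProdFinEquiv.symm) ∘
          Fin.cast h₁) := by
  ext x
  obtain ⟨⟨x, k⟩, rfl⟩ := finProdFinEquiv.surjective x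
  obtain ⟨⟨i, j⟩, rfl⟩ := finProdFinEquiv.surjective x
  have e₁ : Fin.cast h₁ (finProdFinEquiv (finProdFinEquiv (i, j), k)) =
      finProdFinEquiv (i, finProdFinEquiv (j, k)) := by
    ext
    simp only [Fin.val_cast, finProdFinEquiv_apply_val]
    ring
  have e₂ : Fin.cast h₂ (finProdFinEquiv (i, finProdFinEquiv (k, j))) =
      finProdFinEquiv (finProdFinEquiv (i, k), j) := by
    ext
    simp only [Fin.val_cast, finProdFinEquiv_apply_val]
    ring
  simp only [Function.comp_apply, e₁, Equiv.symm_apply_apply, Prod.map_apply, id, flip_apply, e₂,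
    Fin.val_cast, finProdFinEquiv_apply_val]
  ring

theorem isSymmetricStrictMonoidal (F : Type u) [Field F] :
    (ops F).IsSymmetricStrictMonoidal where
  id_comp f := Category.id_comp f
  comp_id f := Category.comp_id f
  comp_assoc f g h := Category.assoc f g h
  tensor_id X Y := by
    change kronecker (1 : Matrix (Fin X.dim) (Fin X.dim) F) (1 : Matrix (Fin Y.dim) (Fin Y.dim) F) =
      (1 : Matrix (Fin (X.dim * Y.dim)) (Fin (X.dim * Y.dim)) F)
    rw [← ofFun_id, ← ofFun_id, kronecker_ofFun, ← ofFun_id]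
    congr 1
    ext x
    simp [Nat.mod_add_div]
  tensor_comp f g f' g' := kronecker_mul _ _ _ _
  tensor_assoc f f' f'' := kronecker_assoc _ _ _
  one_tensor f := one_kronecker _
  tensor_one f := kronecker_one _
  symm_natural {X Y X' Y'} f g := by
    rw [symm_eq, symm_eq]
    exact ofFun_flip_natural _ _
  symm_symm X Y := by
    rw [symm_eq, symm_eq]
    change ofFun F (flip Y.dim X.dim) * ofFun F (flip X.dim Y.dim) =
      (1 : Matrix (Fin (X.dim * Y.dim)) (Fin (X.dim * Y.dim)) F)
    rw [ofFun_mul_ofFun, ← flip_symm, Equiv.symm_comp_self, ofFun_id]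
  hexagon X Y Z := by
    have h₁ : (ops F).tensor ((ops F).id X) ((ops F).symm Y Z) =
        ofFun F (finProdFinEquiv ∘ Prod.map id (flip Y.dim Z.dim) ∘ finProdFinEquiv.symm) := by
      rw [symm_eq]
      change kronecker (1 : Matrix (Fin X.dim) (Fin X.dim) F) (ofFun F (flip Y.dim Z.dim)) = _
      rw [← ofFun_id, kronecker_ofFun]
    have h₂ : (ops F).tensor ((ops F).symm X Z) ((ops F).id Y) =
        ofFun F (finProdFinEquiv ∘ Prod.map (flip X.dim Z.dim) id ∘ finProdFinEquiv.symm) := by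
      rw [symm_eq]
      change kronecker (ofFun F (flip X.dim Z.dim)) (1 : Matrix (Fin Y.dim) (Fin Y.dim) F) = _
      rw [← ofFun_id, kronecker_ofFun]
    rw [h₁, h₂, symm_eq, cast_ofFun, cast_ofFun]
    refine Eq.trans (congrArg (ofFun F) ?_) (ofFun_mul_ofFun _ _).symm
    exact flip_hexagon X.dim Y.dim Z.dim _ _ _

/-- The functor sending `n` to the space of vectors of length `n`. -/
noncomputable def toFGModuleCat (F : Type u) [Field F] : MatCat F ⥤ FGModuleCat.{u} F where
  obj X := FGModuleCat.of F (Fin X.dim → F)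
  map {X Y} f := FGModuleCat.ofHom (Matrix.toLin' (f : Matrix (Fin Y.dim) (Fin X.dim) F))
  map_id X := by
    refine FGModuleCat.hom_ext ?_
    exact Matrix.toLin'_one
  map_comp f g := by
    refine FGModuleCat.hom_ext ?_
    exact Matrix.toLin'_mul _ _

instance : (toFGModuleCat F).Faithful where
  map_injective {X Y f g} h := by
    have h' : Matrix.toLin' (f : Matrix (Fin Y.dim) (Fin X.dim) F) =
        Matrix.toLin' (g : Matrix (Fin Y.dim) (Fin X.dim) F) :=
      congrArg (fun k => k.hom.hom) h
    exact Matrix.toLin'.injective h'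

instance : (toFGModuleCat F).Full where
  map_surjective {X Y} f := by
    refine ⟨LinearMap.toMatrix' (f.hom.hom : (Fin X.dim → F) →ₗ[F] (Fin Y.dim → F)), ?_⟩
    refine FGModuleCat.hom_ext ?_
    exact Matrix.toLin'_toMatrix' _

instance : (toFGModuleCat F).EssSurj where
  mem_essImage V := by
    let e := (Module.finBasis F V).equivFun
    exact ⟨⟨Module.finrank F V⟩, ⟨e.symm.toFGModuleCatIso⟩⟩

theorem nonempty_equivalence (F : Type u) [Field F] :
    Nonempty (MatCat F ≌ FGModuleCat.{u} F) :=
  have : (toFGModuleCat F).IsEquivalence := {}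
  ⟨(toFGModuleCat F).asEquivalence⟩

end MatCat

end Matrices

/-! ### Faithful functors reflect laws, functors preserve Frobenius objects -/

section MonoidalFunctors

section

variable {C : Type u₁} [Quiver.{v₁} C] {C' : Type u₂} [Quiver.{v₂} C']

theorem Prefunctor.map_heq (T : C ⥤q C') {X X' Y Y' : C} (hX : X = X') (hY : Y = Y') {f : X ⟶ Y}
    {f' : X' ⟶ Y'} (hf : HEq f f') : HEq (T.map f) (T.map f') := by
  subst hX hY hf; rfl

/-- Injectivity on parallel arrows suffices for heterogeneous equalities, provided the objects are
already known to be equal. -/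
theorem Prefunctor.heq_of_map_heq {T : C ⥤q C'}
    (hT : ∀ X Y : C, Function.Injective fun f : X ⟶ Y => T.map f)
    {X X' Y Y' : C} (hX : X = X') (hY : Y = Y') {f : X ⟶ Y} {f' : X' ⟶ Y'}
    (hf : HEq (T.map f) (T.map f')) : HEq f f' := by
  subst hX hY
  exact heq_of_eq (hT _ _ (eq_of_heq hf))

theorem Prefunctor.map_cast_heq {T : C ⥤q C'} {X X' Y Y' : C} (hX : X = X') (hY : Y = Y')
    {f : X ⟶ Y} {Z W : C'} {g : Z ⟶ W} (hf : HEq (T.map f) g) {Z' W' : C'} (hZ : Z = Z')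
    (hW : W = W') :
    HEq (T.map (f.cast hX hY)) (g.cast hZ hW) := by
  subst hX hY hZ hW
  exact hf

end

namespace MonoidalOps

section Congruence

variable {C : Type u} [Quiver.{v} C] [Monoid C] (D : MonoidalOps C) {X X' Y Y' Z Z' W W' : C}

theorem id_heq (hX : X = X') : HEq (D.id X) (D.id X') := by
  subst hX; rfl

theorem symm_heq (hX : X = X') (hY : Y = Y') : HEq (D.symm X Y) (D.symm X' Y') := by
  subst hX hY; rfl

theorem comp_heq (hX : X = X') (hY : Y = Y') (hZ : Z = Z') {f : X ⟶ Y} {f' : X' ⟶ Y'} {g : Y ⟶ Z}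
    {g' : Y' ⟶ Z'} (hf : HEq f f') (hg : HEq g g') : HEq (D.comp f g) (D.comp f' g') := by
  subst hX hY hZ hf hg; rfl

theorem tensor_heq (hX : X = X') (hY : Y = Y') (hZ : Z = Z') (hW : W = W') {f : X ⟶ Y}
    {f' : X' ⟶ Y'} {g : Z ⟶ W} {g' : Z' ⟶ W'} (hf : HEq f f') (hg : HEq g g') :
    HEq (D.tensor f g) (D.tensor f' g') := by
  subst hX hY hZ hW hf hg; rfl

end Congruence

variable {C : Type u₁} [Quiver.{v₁} C] [Monoid C] {C' : Type u₂} [Quiver.{v₂} C'] [Monoid C']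
  {D : MonoidalOps C} {D' : MonoidalOps C'} {T : C ⥤q C'}

namespace IsSymmetricMonoidalFunctor

/-- The target arrows have their own objects, related to the images only by equalities. This is what
nested tensors require, since their images match only after several uses of `obj_mul`. -/
theorem map_tensor_heq (h : IsSymmetricMonoidalFunctor D D' T)
    {X Y Z W : C} {X' Y' Z' W' : C'} {f : X ⟶ Y} {g : Z ⟶ W} {f' : X' ⟶ Y'}
    {g' : Z' ⟶ W'} (hX : T.obj X = X') (hY : T.obj Y = Y') (hZ : T.obj Z = Z')
    (hW : T.obj W = W') (hf : HEq (T.map f) f') (hg : HEq (T.map g) g') :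
    HEq (T.map (D.tensor f g)) (D'.tensor f' g') :=
  (h.map_tensor f g).trans (D'.tensor_heq hX hY hZ hW hf hg)

theorem map_comp_heq (h : IsSymmetricMonoidalFunctor D D' T)
    {X Y Z : C} {X' Y' Z' : C'} {f : X ⟶ Y} {g : Y ⟶ Z} {f' : X' ⟶ Y'}
    {g' : Y' ⟶ Z'} (hX : T.obj X = X') (hY : T.obj Y = Y') (hZ : T.obj Z = Z')
    (hf : HEq (T.map f) f') (hg : HEq (T.map g) g') :
    HEq (T.map (D.comp f g)) (D'.comp f' g') :=
  (heq_of_eq (h.map_comp f g)).trans (D'.comp_heq hX hY hZ hf hg)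

theorem map_id_heq (h : IsSymmetricMonoidalFunctor D D' T)
    {X : C} {X' : C'} (hX : T.obj X = X') :
    HEq (T.map (D.id X)) (D'.id X') :=
  (heq_of_eq (h.map_id X)).trans (D'.id_heq hX)

theorem map_symm_heq (h : IsSymmetricMonoidalFunctor D D' T)
    {X Y : C} {X' Y' : C'} (hX : T.obj X = X') (hY : T.obj Y = Y') :
    HEq (T.map (D.symm X Y)) (D'.symm X' Y') :=
  (h.map_symm X Y).trans (D'.symm_heq hX hY)

/-- Laws are reflected by faithful symmetric monoidal functors. -/
theorem isSymmetricStrictMonoidal (h : IsSymmetricMonoidalFunctor D D' T)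
    (hT : ∀ X Y : C, Function.Injective fun f : X ⟶ Y => T.map f)
    (hD : D'.IsSymmetricStrictMonoidal) : D.IsSymmetricStrictMonoidal where
  id_comp f := hT _ _ <| by
    simp only [h.map_comp, h.map_id, hD.id_comp]
  comp_id f := hT _ _ <| by
    simp only [h.map_comp, h.map_id, hD.comp_id]
  comp_assoc f g k := hT _ _ <| by
    simp only [h.map_comp, hD.comp_assoc]
  tensor_id X Y := hT _ _ <| eq_of_heq <|
    (h.map_tensor_heq rfl rfl rfl rfl (h.map_id_heq rfl) (h.map_id_heq rfl)).trans <|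
      (heq_of_eq (hD.tensor_id _ _)).trans (h.map_id_heq (h.obj_mul X Y)).symm
  tensor_comp f g f' g' := hT _ _ <| eq_of_heq <|
    (h.map_tensor_heq rfl rfl rfl rfl (heq_of_eq (h.map_comp f g))
      (heq_of_eq (h.map_comp f' g'))).trans <|
      (heq_of_eq (hD.tensor_comp _ _ _ _)).trans
        (h.map_comp_heq (h.obj_mul _ _) (h.obj_mul _ _) (h.obj_mul _ _) (h.map_tensor _ _)
          (h.map_tensor _ _)).symm
  tensor_assoc f f' f'' := Prefunctor.heq_of_map_heq hT (_root_.mul_assoc _ _ _)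
      (_root_.mul_assoc _ _ _) <|
    (h.map_tensor_heq (h.obj_mul _ _) (h.obj_mul _ _) rfl rfl (h.map_tensor _ _) HEq.rfl).trans <|
      (hD.tensor_assoc _ _ _).trans
      (h.map_tensor_heq rfl rfl (h.obj_mul _ _) (h.obj_mul _ _) HEq.rfl (h.map_tensor _ _)).symm
  one_tensor f := Prefunctor.heq_of_map_heq hT (_root_.one_mul _) (_root_.one_mul _) <|
    (h.map_tensor_heq h.obj_one h.obj_one rfl rfl (h.map_id_heq h.obj_one) HEq.rfl).trans
      (hD.one_tensor _)
  tensor_one f := Prefunctor.heq_of_map_heq hT (_root_.mul_one _) (_root_.mul_one _) <|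
    (h.map_tensor_heq rfl rfl h.obj_one h.obj_one HEq.rfl (h.map_id_heq h.obj_one)).trans
      (hD.tensor_one _)
  symm_natural f g := hT _ _ <| eq_of_heq <|
    (h.map_comp_heq (h.obj_mul _ _) (h.obj_mul _ _) (h.obj_mul _ _) (h.map_tensor _ _)
      (h.map_symm _ _)).trans <| (heq_of_eq (hD.symm_natural _ _)).trans
      (h.map_comp_heq (h.obj_mul _ _) (h.obj_mul _ _) (h.obj_mul _ _) (h.map_symm _ _)
        (h.map_tensor _ _)).symm
  symm_symm X Y := hT _ _ <| eq_of_heq <|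
    (h.map_comp_heq (h.obj_mul _ _) (h.obj_mul _ _) (h.obj_mul _ _) (h.map_symm _ _)
      (h.map_symm _ _)).trans <| (heq_of_eq (hD.symm_symm _ _)).trans
      (h.map_id_heq (h.obj_mul _ _)).symm
  hexagon X Y Z := hT _ _ <| eq_of_heq <| by
    have hXY := h.obj_mul X Y
    refine (h.map_symm_heq hXY rfl).trans <| (heq_of_eq (hD.hexagon _ _ _)).trans
      (h.map_comp_heq ?_ ?_ ?_
        (Prefunctor.map_cast_heq _ _ (h.map_tensor_heq rfl rfl (h.obj_mul _ _)
        (h.obj_mul _ _) (h.map_id _).heq (h.map_symm _ _)) _ _)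
        (Prefunctor.map_cast_heq _ _ (h.map_tensor_heq (h.obj_mul _ _) (h.obj_mul _ _) rfl rfl
          (h.map_symm _ _) (h.map_id _).heq) _ _)).symm
    all_goals simp only [h.obj_mul]

/-- Symmetric Frobenius objects are preserved by symmetric monoidal functors. -/
theorem isSymmetricFrobenius (h : IsSymmetricMonoidalFunctor D D' T)
    {M : C} {μ : M * M ⟶ M} {η : 1 ⟶ M} {δ : M ⟶ M * M} {ε : M ⟶ 1}
    (hM : D.IsSymmetricFrobenius M μ η δ ε) {μ' : T.obj M * T.obj M ⟶ T.obj M}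
    {η' : 1 ⟶ T.obj M} {δ' : T.obj M ⟶ T.obj M * T.obj M} {ε' : T.obj M ⟶ 1}
    (hμ : HEq (T.map μ) μ') (hη : HEq (T.map η) η') (hδ : HEq (T.map δ) δ')
    (hε : HEq (T.map ε) ε') : D'.IsSymmetricFrobenius (T.obj M) μ' η' δ' ε' := by
  have h1 := h.obj_one
  have h2 := h.obj_mul M M
  have h3 : T.obj (M * M * M) = T.obj M * T.obj M * T.obj M := by simp only [h.obj_mul]
  have h3' : T.obj (M * (M * M)) = T.obj M * (T.obj M * T.obj M) := by simp only [h.obj_mul]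
  have h4 : T.obj (1 * M) = 1 * T.obj M := by rw [h.obj_mul, h1]
  have h4' : T.obj (M * 1) = T.obj M * 1 := by rw [h.obj_mul, h1]
  have hid := (h.map_id M).heq
  exact {
    mul_assoc :=
      (h.map_comp_heq h3 h2 rfl (h.map_tensor_heq h2 rfl rfl rfl hμ hid) hμ).symm.trans <|
        (Prefunctor.map_heq T (_root_.mul_assoc M M M) rfl hM.mul_assoc).trans
        (h.map_comp_heq h3' h2 rfl (h.map_tensor_heq rfl rfl h2 rfl hid hμ) hμ)
    unit_mul :=
      (h.map_comp_heq h4 h2 rfl (h.map_tensor_heq h1 rfl rfl rfl hη hid) hμ).symm.trans <|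
        (Prefunctor.map_heq T (_root_.one_mul M) rfl hM.unit_mul).trans hid
    mul_unit :=
      (h.map_comp_heq h4' h2 rfl (h.map_tensor_heq rfl rfl h1 rfl hid hη) hμ).symm.trans <|
        (Prefunctor.map_heq T (_root_.mul_one M) rfl hM.mul_unit).trans hid
    comul_assoc :=
      (h.map_comp_heq rfl h2 h3 hδ (h.map_tensor_heq rfl h2 rfl rfl hδ hid)).symm.trans <|
        (Prefunctor.map_heq T rfl (_root_.mul_assoc M M M) hM.comul_assoc).trans
        (h.map_comp_heq rfl h2 h3' hδ (h.map_tensor_heq rfl rfl rfl h2 hid hδ))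
    counit_comul :=
      (h.map_comp_heq rfl h2 h4 hδ (h.map_tensor_heq rfl h1 rfl rfl hε hid)).symm.trans <|
        (Prefunctor.map_heq T rfl (_root_.one_mul M) hM.counit_comul).trans hid
    comul_counit :=
      (h.map_comp_heq rfl h2 h4' hδ (h.map_tensor_heq rfl rfl rfl h1 hid hε)).symm.trans <|
        (Prefunctor.map_heq T rfl (_root_.mul_one M) hM.comul_counit).trans hid
    frobenius_left := eq_of_heq <|
      (h.map_comp_heq h2 h3' h2
        (Prefunctor.map_cast_heq _ _ (h.map_tensor_heq rfl h2 rfl rfl hδ hid) _ _)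
        (h.map_tensor_heq rfl rfl h2 rfl hid hμ)).symm.trans <|
        (Prefunctor.map_heq T rfl rfl hM.frobenius_left.heq).trans (h.map_comp_heq h2 rfl h2 hμ hδ)
    frobenius_right := eq_of_heq <|
      (h.map_comp_heq h2 h3 h2
        (Prefunctor.map_cast_heq _ _ (h.map_tensor_heq rfl rfl rfl h2 hid hδ) _ _)
        (h.map_tensor_heq h2 rfl rfl rfl hμ hid)).symm.trans <|
        (Prefunctor.map_heq T rfl rfl hM.frobenius_right.heq).trans (h.map_comp_heq h2 rfl h2 hμ hδ)
    symmetric := eq_of_heq <|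
      (h.map_comp_heq h2 h2 h1 (h.map_symm M M) (h.map_comp_heq h2 rfl h1 hμ hε)).symm.trans <|
        (Prefunctor.map_heq T rfl rfl hM.symmetric.heq).trans (h.map_comp_heq h2 rfl h1 hμ hε)
    cosymmetric := eq_of_heq <|
      (h.map_comp_heq h1 h2 h2 (h.map_comp_heq h1 rfl h2 hη hδ) (h.map_symm M M)).symm.trans <|
        (Prefunctor.map_heq T rfl rfl hM.cosymmetric.heq).trans (h.map_comp_heq h1 rfl h2 hη hδ) }

end IsSymmetricMonoidalFunctor

end MonoidalOps

end MonoidalFunctors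

/-! ### The category of cobordisms and the Brauer functor -/

section CobordismCategory

/-- The digits of a number with `n + m` digits are those of the quotient and of the remainder of
its division by `p ^ m`. -/
theorem cast_digitEquiv_symm_append {p n m : ℕ} (a : Fin n → Fin p) (b : Fin m → Fin p)
    (h : p ^ (n + m) = p ^ n * p ^ m) :
    Fin.cast h ((digitEquiv p (n + m)).symm (Fin.append a b)) =
      finProdFinEquiv ((digitEquiv p n).symm a, (digitEquiv p m).symm b) := by
  obtain ⟨a, rfl⟩ := (digitEquiv p n).surjective a
  obtain ⟨b, rfl⟩ := (digitEquiv p m).surjective b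
  rw [Equiv.symm_apply_apply, Equiv.symm_apply_apply]
  suffices (digitEquiv p (n + m)).symm (Fin.append (digitEquiv p n a) (digitEquiv p m b)) =
      Fin.cast h.symm (finProdFinEquiv (a, b)) by
    rw [this]; rfl
  rw [Equiv.symm_apply_eq]
  symm
  ext i
  rw [digitEquiv_apply, digit, Fin.val_cast, finProdFinEquiv_apply_val]
  simp only
  refine Fin.addCases (fun i => ?_) (fun i => ?_) i
  -- The digits of the first block lie above the lowest m places; division by p ^ m removes the
  -- second block.
  · rw [Fin.append_left, digitEquiv_apply, digit, Fin.val_castAdd,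
      show n + m - 1 - (i : ℕ) = m + (n - 1 - i) by omega, pow_add, ← Nat.div_div_eq_div_mul,
      Nat.add_mul_div_left _ _ (by have := b.2; omega), Nat.div_eq_of_lt b.2, zero_add]
  · have hp : 0 < p := (digitEquiv p m b i).pos
    rw [Fin.append_right, digitEquiv_apply, digit, Fin.val_natAdd,
      show n + m - 1 - (n + (i : ℕ)) = m - 1 - i by omega]
    -- With this factorization the contribution of the first block remains divisible by p after
    -- division by p ^ (m - 1 - i), so it does not affect the digit.
    have hm : p ^ m = p ^ (m - 1 - i) * (p * p ^ (i : ℕ)) := by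
      rw [← pow_succ', ← pow_add]
      congr 1
      omega
    generalize (b : ℕ) = b
    rw [hm, mul_assoc, Nat.add_mul_div_left _ _ (pow_pos hp _), mul_assoc,
      Nat.add_mul_mod_self_left]

namespace OneCob

/-- The operations of the category of one-dimensional cobordisms. -/
noncomputable def ops : MonoidalOps OneCob where
  id X := arrow (Cobordism.exists_isIdentity X).choose
  comp f g := arrow (Cobordism.exists_isComposite f.out g.out).choose
  tensor f g := arrow (Cobordism.exists_isSideBySide f.out g.out).choose
  symm X Y := arrow (Cobordism.exists_isSymmetry X Y).choose

end OneCob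

theorem arrow_out {X Y : OneCob} (f : X ⟶ Y) : OneCob.arrow (Quotient.out f) = f :=
  Quotient.out_eq f

section Entries

variable {p : ℕ} {F : Type u} [Field F] {X Y Z X' Y' : OneCob}

theorem entry_id (hp : 0 < p) (a b : Fin X.n → Fin p) :
    entry p F (OneCob.ops.id X) a b = if a = b then 1 else 0 :=
  entry_arrow_of_isIdentity hp (Cobordism.exists_isIdentity X).choose_spec a b

theorem entry_comp (hp : 0 < p) (f : X ⟶ Y) (g : Y ⟶ Z) (a : Fin X.n → Fin p)
    (c : Fin Z.n → Fin p) :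
    entry p F (OneCob.ops.comp f g) a c = ∑ b, entry p F f a b * entry p F g b c := by
  refine (entry_arrow_of_isComposite hp
    (Cobordism.exists_isComposite f.out g.out).choose_spec a c).trans ?_
  rw [arrow_out, arrow_out]

theorem entry_tensor (hp : 0 < p) (f : X ⟶ Y) (g : X' ⟶ Y') (a : Fin X.n → Fin p)
    (b : Fin Y.n → Fin p) (a' : Fin X'.n → Fin p) (b' : Fin Y'.n → Fin p) :
    entry p F (OneCob.ops.tensor f g) (Fin.append a a') (Fin.append b b') =
      entry p F f a b * entry p F g a' b' := by
  refine (entry_arrow_of_isSideBySide hp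
    (Cobordism.exists_isSideBySide f.out g.out).choose_spec a b a' b').trans ?_
  rw [arrow_out, arrow_out]

theorem entry_symm (hp : 0 < p) (a : Fin X.n → Fin p) (a' : Fin Y.n → Fin p)
    (b : Fin X.n → Fin p) (b' : Fin Y.n → Fin p) :
    entry p F (OneCob.ops.symm X Y) (Fin.append a a') (Fin.append b' b) =
      if a = b ∧ a' = b' then 1 else 0 :=
  entry_arrow_of_isSymmetry hp (Cobordism.exists_isSymmetry X Y).choose_spec a a' b b'

theorem exists_append_eq {n m : ℕ} {T : Type*} (a : Fin (n + m) → T) :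
    ∃ a₁ a₂, Fin.append a₁ a₂ = a :=
  ⟨fun i => a (Fin.castAdd m i), fun i => a (Fin.natAdd n i), Fin.append_castAdd_natAdd⟩

end Entries

/-- The operations were defined through arbitrary representatives. The entries of any admissible
result depend only on the arrows involved, so faithfulness, used with p = 2 over the rationals,
identifies all results. -/
theorem isCobordismOps : OneCob.IsCobordismOps OneCob.ops where
  id X := ⟨Cobordism.exists_isIdentity X, fun K hK =>
    eq_of_entry_eq (F := ℚ) le_rfl fun a b => by
      rw [entry_id two_pos, entry_arrow_of_isIdentity two_pos hK]⟩
  comp K L := ⟨Cobordism.exists_isComposite K L, fun N hN =>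
    eq_of_entry_eq (F := ℚ) le_rfl fun a b => by
      rw [entry_comp two_pos, entry_arrow_of_isComposite two_pos hN]⟩
  tensor {X Y X' Y'} K L := ⟨Cobordism.exists_isSideBySide K L, fun N hN =>
    eq_of_entry_eq (F := ℚ) le_rfl fun a b => by
      obtain ⟨a, a', rfl⟩ := exists_append_eq (n := X.n) (m := X'.n) a
      obtain ⟨b, b', rfl⟩ := exists_append_eq (n := Y.n) (m := Y'.n) b
      exact (entry_arrow_of_isSideBySide two_pos hN a b a' b').trans
        (entry_tensor two_pos _ _ a b a' b').symm⟩
  symm X Y := ⟨Cobordism.exists_isSymmetry X Y, fun K hK =>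
    eq_of_entry_eq (F := ℚ) le_rfl fun a b => by
      obtain ⟨a, a', rfl⟩ := exists_append_eq (n := X.n) (m := Y.n) a
      obtain ⟨b', b, rfl⟩ := exists_append_eq (n := Y.n) (m := X.n) b
      exact (entry_arrow_of_isSymmetry two_pos hK a a' b b').trans
        (entry_symm two_pos a a' b b').symm⟩

/-- The two matrices have sizes p ^ (n + m) and p ^ n * p ^ m, which are equal but not
definitionally so. Concatenated digits correspond to pairs under both numberings. -/
theorem map_heq_of_entry {p : ℕ} {F : Type u} [Field F] {X X' Y Y' : OneCob}
    {f : X * X' ⟶ Y * Y'}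
    {A : Matrix (Fin (p ^ Y.n * p ^ Y'.n)) (Fin (p ^ X.n * p ^ X'.n)) F}
    (h : ∀ (a : Fin X.n → Fin p) (a' : Fin X'.n → Fin p) (b : Fin Y.n → Fin p)
      (b' : Fin Y'.n → Fin p), entry p F f (Fin.append a a') (Fin.append b b') =
        A (finProdFinEquiv ((digitEquiv p Y.n).symm b, (digitEquiv p Y'.n).symm b'))
          (finProdFinEquiv ((digitEquiv p X.n).symm a, (digitEquiv p X'.n).symm a'))) :
    HEq ((brauer p F).map f : Matrix (Fin (p ^ (Y.n + Y'.n))) (Fin (p ^ (X.n + X'.n))) F) A := by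
  refine MatCat.matrix_heq (pow_add _ _ _) (pow_add _ _ _) fun i j => ?_
  obtain ⟨b, rfl⟩ := (digitEquiv p (Y.n + Y'.n)).symm.surjective i
  obtain ⟨a, rfl⟩ := (digitEquiv p (X.n + X'.n)).symm.surjective j
  obtain ⟨a, a', rfl⟩ := exists_append_eq a
  obtain ⟨b, b', rfl⟩ := exists_append_eq b
  rw [cast_digitEquiv_symm_append, cast_digitEquiv_symm_append]
  exact h a a' b b'

/-- The formulas for entries in terms of digits are transported along `digitEquiv`. Diagrammatic
composition is the matrix product in reverse order, which is harmless because the field is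
commutative. -/
theorem isSymmetricMonoidalFunctor_brauer {p : ℕ} (hp : 0 < p) (F : Type u) [Field F] :
    MonoidalOps.IsSymmetricMonoidalFunctor OneCob.ops (MatCat.ops F) (brauer p F) where
  map_id X := by
    refine Matrix.ext fun i j => ?_
    obtain ⟨b, rfl⟩ := (digitEquiv p X.n).symm.surjective i
    obtain ⟨a, rfl⟩ := (digitEquiv p X.n).symm.surjective j
    refine (entry_id hp a b).trans ?_
    change _ = (1 : Matrix (Fin (p ^ X.n)) (Fin (p ^ X.n)) F) _ _
    simp [Matrix.one_apply, eq_comm]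
  map_comp {X Y Z} f g := by
    refine Matrix.ext fun i j => ?_
    obtain ⟨c, rfl⟩ := (digitEquiv p Z.n).symm.surjective i
    obtain ⟨a, rfl⟩ := (digitEquiv p X.n).symm.surjective j
    refine (entry_comp hp f g a c).trans ?_
    refine Eq.trans ?_ ((digitEquiv p Y.n).symm.sum_comp fun k =>
      ((brauer p F).map g : Matrix (Fin (p ^ Z.n)) (Fin (p ^ Y.n)) F)
        ((digitEquiv p Z.n).symm c) k *
      ((brauer p F).map f : Matrix (Fin (p ^ Y.n)) (Fin (p ^ X.n)) F) k ((digitEquiv p X.n).symm a))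
    exact Finset.sum_congr rfl fun b _ => mul_comm _ _
  obj_one := brauer_obj_one p F
  obj_mul := brauer_obj_mul p F
  map_tensor f g := map_heq_of_entry fun a a' b b' =>
    (entry_tensor hp f g a b a' b').trans (MatCat.kronecker_apply _ _ _ _ _ _).symm
  map_symm X Y := by
    rw [MatCat.symm_eq]
    refine map_heq_of_entry (X := X) (X' := Y) (Y := Y) (Y' := X) fun a a' b b' => ?_
    refine (entry_symm hp a a' b' b).trans ?_
    change _ = if _ = MatCat.flip (p ^ X.n) (p ^ Y.n) _ then _ else _
    rw [MatCat.flip_apply]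
    simp only [EmbeddingLike.apply_eq_iff_eq, Prod.mk.injEq]
    exact if_congr ⟨fun h => ⟨h.2.symm, h.1.symm⟩, fun h => ⟨h.2.symm, h.1.symm⟩⟩ rfl rfl

end CobordismCategory

/-! ### Frobenius identities for matrix units and their lift to cobordisms -/

section Frobenius

variable {p : ℕ} {F : Type u} [Field F]

/-- The structure constants of the algebra of matrices in the basis of matrix units. -/
def mulCoeff (F : Type u) [Field F] (u v w : Fin 2 → Fin p) : F :=
  if u 0 = w 0 ∧ u 1 = v 0 ∧ v 1 = w 1 then 1 else 0

/-- The traces of the matrix units. -/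
def traceCoeff (F : Type u) [Field F] (u : Fin 2 → Fin p) : F := if u 0 = u 1 then 1 else 0

theorem ite_ite_zero (P Q : Prop) [Decidable P] [Decidable Q] :
    (if P then (if Q then (1 : F) else 0) else 0) = if P ∧ Q then 1 else 0 := by
  split_ifs <;> tauto

theorem eq_vec_iff (u : Fin 2 → Fin p) (i j : Fin p) : u = ![i, j] ↔ u 0 = i ∧ u 1 = j := by
  simp [funext_iff, Fin.forall_fin_two]

/-- A product of two matrix units is a matrix unit or zero, so at most one summand survives. The two
companions solve in the same way for the left or the right factor. -/
theorem sum_mulCoeff_mul (u v : Fin 2 → Fin p) (φ : (Fin 2 → Fin p) → F) :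
    ∑ w, mulCoeff F u v w * φ w = if u 1 = v 0 then φ ![u 0, v 1] else 0 := by
  rw [Finset.sum_eq_single ![u 0, v 1]]
  · simp [mulCoeff]
  · intro w _ hw
    rw [Ne, eq_vec_iff] at hw
    rw [mulCoeff, if_neg fun h => hw ⟨h.1.symm, h.2.2.symm⟩, zero_mul]
  · simp

theorem sum_mulCoeff_left (v w : Fin 2 → Fin p) (φ : (Fin 2 → Fin p) → F) :
    ∑ u, mulCoeff F u v w * φ u = if v 1 = w 1 then φ ![w 0, v 0] else 0 := by
  rw [Finset.sum_eq_single ![w 0, v 0]]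
  · simp [mulCoeff]
  · intro u _ hu
    rw [Ne, eq_vec_iff] at hu
    rw [mulCoeff, if_neg fun h => hu ⟨h.1, h.2.1⟩, zero_mul]
  · simp

theorem sum_mulCoeff_right (u w : Fin 2 → Fin p) (φ : (Fin 2 → Fin p) → F) :
    ∑ v, mulCoeff F u v w * φ v = if u 0 = w 0 then φ ![u 1, w 1] else 0 := by
  rw [Finset.sum_eq_single ![u 1, w 1]]
  · simp [mulCoeff]
  · intro v _ hv
    rw [Ne, eq_vec_iff] at hv
    rw [mulCoeff, if_neg fun h => hv ⟨h.2.1.symm, h.2.2⟩, zero_mul]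
  · simp

/-- Each side is the indicator that consecutive inner indices of u, v, w agree and the outer ones
are those of c. -/
theorem sum_mulCoeff_assoc (u v w c : Fin 2 → Fin p) :
    ∑ x, mulCoeff F u v x * mulCoeff F x w c = ∑ x, mulCoeff F v w x * mulCoeff F u x c := by
  rw [sum_mulCoeff_mul, sum_mulCoeff_mul]
  unfold mulCoeff
  rw [ite_ite_zero, ite_ite_zero]
  refine if_congr ?_ rfl rfl
  simp only [Matrix.cons_val_zero, Matrix.cons_val_one]
  grind

/-- Each side is the indicator of the equations a 1 = b 0, a 0 = c 0, b 1 = d 1 and c 1 = d 0: both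
composites have the same four strands. -/
theorem sum_mulCoeff_frobenius (a b c d : Fin 2 → Fin p) :
    ∑ x, mulCoeff F c x a * mulCoeff F x b d = ∑ x, mulCoeff F a b x * mulCoeff F c d x := by
  rw [sum_mulCoeff_mul, sum_mulCoeff_right]
  unfold mulCoeff
  rw [ite_ite_zero, ite_ite_zero]
  refine if_congr ?_ rfl rfl
  simp only [Matrix.cons_val_zero, Matrix.cons_val_one]
  grind

theorem sum_mulCoeff_frobenius' (a b c d : Fin 2 → Fin p) :
    ∑ x, mulCoeff F x d b * mulCoeff F a x c = ∑ x, mulCoeff F a b x * mulCoeff F c d x := by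
  rw [sum_mulCoeff_mul, sum_mulCoeff_left]
  unfold mulCoeff
  rw [ite_ite_zero, ite_ite_zero]
  refine if_congr ?_ rfl rfl
  simp only [Matrix.cons_val_zero, Matrix.cons_val_one]
  grind

theorem sum_mulCoeff_unit (u c : Fin 2 → Fin p) :
    ∑ x, mulCoeff F x u c * traceCoeff F x = if u = c then 1 else 0 := by
  rw [sum_mulCoeff_left]
  unfold traceCoeff
  rw [ite_ite_zero]
  refine if_congr ?_ rfl rfl
  simp only [Matrix.cons_val_zero, Matrix.cons_val_one, funext_iff, Fin.forall_fin_two]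
  grind

theorem sum_mulCoeff_unit' (u c : Fin 2 → Fin p) :
    ∑ x, mulCoeff F u x c * traceCoeff F x = if u = c then 1 else 0 := by
  rw [sum_mulCoeff_right]
  unfold traceCoeff
  rw [ite_ite_zero]
  refine if_congr ?_ rfl rfl
  simp only [Matrix.cons_val_zero, Matrix.cons_val_one, funext_iff, Fin.forall_fin_two]

/-- The trace of a product of two matrix units is nonzero exactly when each ends where the other
begins, a symmetric condition. -/
theorem sum_mulCoeff_trace_comm (a b : Fin 2 → Fin p) :
    ∑ x, mulCoeff F a b x * traceCoeff F x = ∑ x, mulCoeff F b a x * traceCoeff F x := by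
  rw [sum_mulCoeff_mul, sum_mulCoeff_mul]
  unfold traceCoeff
  rw [ite_ite_zero, ite_ite_zero]
  refine if_congr ?_ rfl rfl
  simp only [Matrix.cons_val_zero, Matrix.cons_val_one, and_comm, eq_comm]

section EntryHEq

variable {p : ℕ} {F : Type u} [Field F] {X X' Y Y' Z W : OneCob}

theorem entry_cast (hX : X = X') (hY : Y = Y') (f : X ⟶ Y) (a : Fin X'.n → Fin p)
    (b : Fin Y'.n → Fin p) :
    entry p F (f.cast hX hY) a b = entry p F f (a ∘ Fin.cast (congrArg OneCob.n hX))
      (b ∘ Fin.cast (congrArg OneCob.n hY)) := by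
  subst hX hY
  rfl

theorem heq_of_entry_eq [CharZero F] (hp : 2 ≤ p) (hX : X = X') (hY : Y = Y') {f : X ⟶ Y}
    {g : X' ⟶ Y'} (h : ∀ a b, entry p F f (a ∘ Fin.cast (congrArg OneCob.n hX))
      (b ∘ Fin.cast (congrArg OneCob.n hY)) = entry p F g a b) : HEq f g := by
  subst hX hY
  exact heq_of_eq (eq_of_entry_eq hp h)

/-- Associativity of the objects is a cast between labellings, and concatenation of labellings is
associative up to this cast. The variants below treat targets and units alike. -/
theorem heq_of_entry_assoc_source [CharZero F] (hp : 2 ≤ p) {f : X * Y * Z ⟶ W}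
    {g : X * (Y * Z) ⟶ W} (h : ∀ (u : Fin X.n → Fin p) (v : Fin Y.n → Fin p) (w : Fin Z.n → Fin p)
      (c : Fin W.n → Fin p), entry p F f (Fin.append (Fin.append u v) w) c =
        entry p F g (Fin.append u (Fin.append v w)) c) : HEq f g := by
  refine heq_of_entry_eq (F := F) hp (mul_assoc X Y Z) rfl fun a c => ?_
  obtain ⟨u, a, rfl⟩ := exists_append_eq (n := X.n) (m := Y.n + Z.n) a
  obtain ⟨v, w, rfl⟩ := exists_append_eq (n := Y.n) (m := Z.n) a
  rw [← h]
  exact congrArg (fun a => entry p F f a c) (Fin.append_assoc u v w).symm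

theorem heq_of_entry_assoc_target [CharZero F] (hp : 2 ≤ p) {f : W ⟶ X * Y * Z}
    {g : W ⟶ X * (Y * Z)} (h : ∀ (u : Fin X.n → Fin p) (v : Fin Y.n → Fin p) (w : Fin Z.n → Fin p)
      (c : Fin W.n → Fin p), entry p F f c (Fin.append (Fin.append u v) w) =
        entry p F g c (Fin.append u (Fin.append v w))) : HEq f g := by
  refine heq_of_entry_eq (F := F) hp rfl (mul_assoc X Y Z) fun c a => ?_
  obtain ⟨u, a, rfl⟩ := exists_append_eq (n := X.n) (m := Y.n + Z.n) a
  obtain ⟨v, w, rfl⟩ := exists_append_eq (n := Y.n) (m := Z.n) a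
  rw [← h]
  exact congrArg (fun a => entry p F f c a) (Fin.append_assoc u v w).symm

theorem heq_of_entry_one_mul_source [CharZero F] (hp : 2 ≤ p) {f : 1 * X ⟶ W} {g : X ⟶ W}
    (h : ∀ (e : Fin 0 → Fin p) (u : Fin X.n → Fin p) (c : Fin W.n → Fin p),
      entry p F f (Fin.append e u) c = entry p F g u c) : HEq f g := by
  refine heq_of_entry_eq (F := F) hp (one_mul X) rfl fun a c => ?_
  rw [← h Fin.elim0]
  exact congrArg (fun a => entry p F f a c) (Fin.elim0_append a).symm

theorem heq_of_entry_mul_one_source [CharZero F] (hp : 2 ≤ p) {f : X * 1 ⟶ W} {g : X ⟶ W}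
    (h : ∀ (e : Fin 0 → Fin p) (u : Fin X.n → Fin p) (c : Fin W.n → Fin p),
      entry p F f (Fin.append u e) c = entry p F g u c) : HEq f g := by
  refine heq_of_entry_eq (F := F) hp (mul_one X) rfl fun a c => ?_
  rw [← h Fin.elim0]
  exact congrArg (fun a => entry p F f a c) (Fin.append_elim0 a).symm

theorem heq_of_entry_one_mul_target [CharZero F] (hp : 2 ≤ p) {f : W ⟶ 1 * X} {g : W ⟶ X}
    (h : ∀ (e : Fin 0 → Fin p) (u : Fin X.n → Fin p) (c : Fin W.n → Fin p),
      entry p F f c (Fin.append e u) = entry p F g c u) : HEq f g := by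
  refine heq_of_entry_eq (F := F) hp rfl (one_mul X) fun c a => ?_
  rw [← h Fin.elim0]
  exact congrArg (fun a => entry p F f c a) (Fin.elim0_append a).symm

theorem heq_of_entry_mul_one_target [CharZero F] (hp : 2 ≤ p) {f : W ⟶ X * 1} {g : W ⟶ X}
    (h : ∀ (e : Fin 0 → Fin p) (u : Fin X.n → Fin p) (c : Fin W.n → Fin p),
      entry p F f c (Fin.append u e) = entry p F g c u) : HEq f g := by
  refine heq_of_entry_eq (F := F) hp rfl (mul_one X) fun c a => ?_
  rw [← h Fin.elim0]
  exact congrArg (fun a => entry p F f c a) (Fin.append_elim0 a).symm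

theorem sum_append {n m : ℕ} (φ : (Fin (n + m) → Fin p) → F) :
    ∑ a, φ a = ∑ u, ∑ v, φ (Fin.append u v) := by
  rw [← (Fin.appendEquiv n m).sum_comp, Fintype.sum_prod_type]
  rfl

/-- When the intermediate object is a tensor product, its labellings are concatenations and the sum
splits into one over each block. -/
theorem entry_comp_mul (hp : 0 < p) {f : X ⟶ Y * Y'} {g : Y * Y' ⟶ Z} {a : Fin X.n → Fin p}
    {c : Fin Z.n → Fin p} {φ ψ : (Fin Y.n → Fin p) → (Fin Y'.n → Fin p) → F}
    (hf : ∀ u v, entry p F f a (Fin.append u v) = φ u v)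
    (hg : ∀ u v, entry p F g (Fin.append u v) c = ψ u v) :
    entry p F (OneCob.ops.comp f g) a c = ∑ u, ∑ v, φ u v * ψ u v := by
  refine (entry_comp hp f g a c).trans ((sum_append (n := Y.n) (m := Y'.n) _).trans ?_)
  exact Finset.sum_congr rfl fun u _ => Finset.sum_congr rfl fun v _ => by rw [← hf, ← hg]

theorem entry_comp_of (hp : 0 < p) {f : X ⟶ Y} {g : Y ⟶ Z} {a : Fin X.n → Fin p}
    {c : Fin Z.n → Fin p} {φ ψ : (Fin Y.n → Fin p) → F}
    (hf : ∀ u, entry p F f a u = φ u) (hg : ∀ u, entry p F g u c = ψ u) :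
    entry p F (OneCob.ops.comp f g) a c = ∑ u, φ u * ψ u := by
  rw [entry_comp hp]
  exact Finset.sum_congr rfl fun u _ => by rw [hf, hg]

end EntryHEq

/-- A symmetric Frobenius object is given by coefficients satisfying the corresponding
identities. -/
theorem isSymmetricFrobenius_of_entry {p : ℕ} {F : Type u} [Field F] [CharZero F] (hp : 2 ≤ p)
    {M : OneCob} {μ : M * M ⟶ M} {η : 1 ⟶ M} {δ : M ⟶ M * M} {ε : M ⟶ 1}
    {m : (Fin M.n → Fin p) → (Fin M.n → Fin p) → (Fin M.n → Fin p) → F}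
    {t : (Fin M.n → Fin p) → F}
    (hμ : ∀ u v w, entry p F μ (Fin.append u v) w = m u v w)
    (hη : ∀ e w, entry p F η e w = t w)
    (hδ : ∀ u v w, entry p F δ w (Fin.append u v) = m u v w)
    (hε : ∀ e w, entry p F ε w e = t w)
    (assoc : ∀ u v w c, ∑ x, m u v x * m x w c = ∑ x, m v w x * m u x c)
    (frob : ∀ a b c d, ∑ x, m c x a * m x b d = ∑ x, m a b x * m c d x)
    (frob' : ∀ a b c d, ∑ x, m x d b * m a x c = ∑ x, m a b x * m c d x)
    (unit : ∀ u c, ∑ x, m x u c * t x = if u = c then 1 else 0)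
    (unit' : ∀ u c, ∑ x, m u x c * t x = if u = c then 1 else 0)
    (comm : ∀ a b, ∑ x, m a b x * t x = ∑ x, m b a x * t x) :
    OneCob.ops.IsSymmetricFrobenius M μ η δ ε := by
  have hp0 : 0 < p := by omega
  have hid : ∀ u v : Fin M.n → Fin p, entry p F (OneCob.ops.id M) u v =
      if u = v then 1 else 0 := fun u v => entry_id hp0 u v
  constructor
  -- Here and in the other laws with an identity factor, that factor contributes a Kronecker delta,
  -- which removes one summation and leaves one of the assumed identities.
  · refine heq_of_entry_assoc_source (F := F) hp fun u v w c => ?_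
    refine (entry_comp_mul (φ := fun x y => m u v x * if w = y then 1 else 0)
      (ψ := fun x y => m x y c) hp0 (fun x y => ?_) fun x y => hμ x y c).trans
      (Eq.trans ?_ (entry_comp_mul (φ := fun x y => (if u = x then 1 else 0) * m v w y)
      (ψ := fun x y => m x y c) hp0 (fun x y => ?_) fun x y => hμ x y c).symm)
    · exact (entry_tensor hp0 _ _ _ _ _ _).trans (by rw [← hμ, ← hid])
    · simpa using assoc u v w c
    · exact (entry_tensor hp0 _ _ _ _ _ _).trans (by rw [← hμ, ← hid])
  · refine heq_of_entry_one_mul_source (F := F) hp fun e u c => ?_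
    refine (entry_comp_mul (φ := fun x y => t x * if u = y then 1 else 0)
      (ψ := fun x y => m x y c) hp0 (fun x y => ?_) fun x y => hμ x y c).trans ?_
    · exact (entry_tensor hp0 _ _ _ _ _ _).trans (by rw [← hη, ← hid])
    · rw [hid, ← unit]
      simp [mul_comm]
  · refine heq_of_entry_mul_one_source (F := F) hp fun e u c => ?_
    refine (entry_comp_mul (φ := fun x y => (if u = x then 1 else 0) * t y)
      (ψ := fun x y => m x y c) hp0 (fun x y => ?_) fun x y => hμ x y c).trans ?_
    · exact (entry_tensor hp0 _ _ _ _ _ _).trans (by rw [← hη, ← hid])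
    · rw [hid, ← unit']
      simp [mul_comm]
  -- The comultiplication has the coefficients of the multiplication with source and target
  -- exchanged, so coassociativity is again `assoc`.
  · refine heq_of_entry_assoc_target (F := F) hp fun u v w c => ?_
    refine (entry_comp_mul (ψ := fun x y => m u v x * if y = w then 1 else 0)
      (φ := fun x y => m x y c) hp0 (fun x y => hδ x y c) fun x y => ?_).trans
      (Eq.trans ?_ (entry_comp_mul (ψ := fun x y => (if x = u then 1 else 0) * m v w y)
      (φ := fun x y => m x y c) hp0 (fun x y => hδ x y c) fun x y => ?_).symm)
    · exact (entry_tensor hp0 _ _ _ _ _ _).trans (by rw [← hδ, ← hid])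
    · simpa [mul_comm] using assoc u v w c
    · exact (entry_tensor hp0 _ _ _ _ _ _).trans (by rw [← hδ, ← hid])
  · refine heq_of_entry_one_mul_target (F := F) hp fun e u c => ?_
    refine (entry_comp_mul (ψ := fun x y => t x * if y = u then 1 else 0)
      (φ := fun x y => m x y c) hp0 (fun x y => hδ x y c) fun x y => ?_).trans ?_
    · exact (entry_tensor hp0 _ _ _ _ _ _).trans (by rw [← hε, ← hid])
    · rw [hid, ← if_congr (eq_comm (a := u) (b := c)) rfl rfl, ← unit]
      simp
  · refine heq_of_entry_mul_one_target (F := F) hp fun e u c => ?_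
    refine (entry_comp_mul (ψ := fun x y => (if x = u then 1 else 0) * t y)
      (φ := fun x y => m x y c) hp0 (fun x y => hδ x y c) fun x y => ?_).trans ?_
    · exact (entry_tensor hp0 _ _ _ _ _ _).trans (by rw [← hε, ← hid])
    · rw [hid, ← if_congr (eq_comm (a := u) (b := c)) rfl rfl, ← unit']
      simp
  · refine eq_of_entry_eq (F := F) hp fun a c => ?_
    obtain ⟨a, b, rfl⟩ := exists_append_eq (n := M.n) (m := M.n) a
    obtain ⟨c, d, rfl⟩ := exists_append_eq (n := M.n) (m := M.n) c
    -- The intermediate labelling is split as one block followed by two. The first factor, cast from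
    -- the other bracketing, reads the last two blocks separately.
    refine (entry_comp_mul (Y := M) (Y' := M * M)
      (φ := fun x yz => m x (fun i => yz (Fin.castAdd M.n i)) a *
        if b = (fun i => yz (Fin.natAdd M.n i)) then 1 else 0)
      (ψ := fun x yz => (if x = c then 1 else 0) * entry p F μ yz d) hp0
      (fun x yz => ?_) fun x yz => ?_).trans ?_
    · obtain ⟨y, z, rfl⟩ := exists_append_eq (n := M.n) (m := M.n) yz
      refine (entry_cast _ _ _ _ _).trans ?_
      refine (congrArg (entry p F _ _) (Fin.append_assoc x y z).symm).trans ?_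
      exact (entry_tensor hp0 _ _ _ _ _ _).trans
        (by simp only [Fin.append_left, Fin.append_right, hδ, hid])
    · exact (entry_tensor hp0 _ _ _ _ _ _).trans (by rw [← hid])
    · rw [entry_comp_of hp0 (fun x => hμ a b x) (fun x => hδ c d x), ← frob]
      trans ∑ x, ∑ y, ∑ z, (m x y a * if b = z then 1 else 0) *
        ((if x = c then 1 else 0) * m y z d)
      · refine Finset.sum_congr rfl fun x _ => (sum_append (n := M.n) (m := M.n) _).trans ?_
        refine Finset.sum_congr rfl fun y _ => Finset.sum_congr rfl fun z _ => ?_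
        simp only [Fin.append_left, Fin.append_right, hμ]
      · rw [Finset.sum_comm]
        simp
  · refine eq_of_entry_eq (F := F) hp fun a c => ?_
    obtain ⟨a, b, rfl⟩ := exists_append_eq (n := M.n) (m := M.n) a
    obtain ⟨c, d, rfl⟩ := exists_append_eq (n := M.n) (m := M.n) c
    refine (entry_comp_mul (Y := M * M) (Y' := M)
      (φ := fun xy z => (if a = (fun i => xy (Fin.castAdd M.n i)) then 1 else 0) *
        m (fun i => xy (Fin.natAdd M.n i)) z b)
      (ψ := fun xy z => entry p F μ xy c * if z = d then 1 else 0) hp0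
      (fun xy z => ?_) fun xy z => ?_).trans ?_
    · obtain ⟨x, y, rfl⟩ := exists_append_eq (n := M.n) (m := M.n) xy
      refine (entry_cast _ _ _ _ _).trans ?_
      have : (Fin.append (Fin.append x y) z ∘ Fin.cast (Nat.add_assoc M.n M.n M.n).symm) =
          Fin.append x (Fin.append y z) := by
        rw [Fin.append_assoc]; rfl
      refine (congrArg (entry p F _ _) this).trans ?_
      exact (entry_tensor hp0 _ _ _ _ _ _).trans
        (by simp only [Fin.append_left, Fin.append_right, hδ, hid])
    · exact (entry_tensor hp0 _ _ _ _ _ _).trans (by rw [← hid])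
    · rw [entry_comp_of hp0 (fun x => hμ a b x) (fun x => hδ c d x), ← frob']
      trans ∑ x, ∑ y, ∑ z, ((if a = x then 1 else 0) * m y z b) *
        (m x y c * if z = d then 1 else 0)
      · refine (sum_append (n := M.n) (m := M.n) _).trans ?_
        refine Finset.sum_congr rfl fun x _ => Finset.sum_congr rfl fun y _ =>
          Finset.sum_congr rfl fun z _ => ?_
        simp only [Fin.append_left, Fin.append_right, hμ]
      · simp
  · refine eq_of_entry_eq (F := F) hp fun a e => ?_
    obtain ⟨a, b, rfl⟩ := exists_append_eq (n := M.n) (m := M.n) a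
    have hμε : ∀ u v, entry p F (OneCob.ops.comp μ ε) (Fin.append u v) e =
        ∑ x, m u v x * t x := fun u v =>
      entry_comp_of hp0 (fun x => hμ u v x) (fun x => hε e x)
    refine (entry_comp_mul (φ := fun x y => if a = y ∧ b = x then 1 else 0)
      (ψ := fun x y => ∑ z, m x y z * t z) hp0 (fun x y => ?_) fun x y => hμε x y).trans ?_
    · exact entry_symm hp0 a b y x
    · rw [hμε, comm]
      simp [ite_and]
  · refine eq_of_entry_eq (F := F) hp fun e a => ?_
    obtain ⟨a, b, rfl⟩ := exists_append_eq (n := M.n) (m := M.n) a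
    have hηδ : ∀ u v, entry p F (OneCob.ops.comp η δ) e (Fin.append u v) =
        ∑ x, m u v x * t x := fun u v =>
      (entry_comp_of hp0 (fun x => hη e x) (fun x => hδ u v x)).trans (by simp only [mul_comm])
    refine (entry_comp_mul (ψ := fun x y => if x = b ∧ y = a then 1 else 0)
      (φ := fun x y => ∑ z, m x y z * t z) hp0 (fun x y => hηδ x y) fun x y => ?_).trans ?_
    · exact entry_symm hp0 x y b a
    · rw [hηδ, comm]
      simp [ite_and]

end Frobenius

/-! ### Identification with the algebra of matrices -/

section MatrixAlgebra

variable {p : ℕ} {F : Type u} [Field F]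

/-- This links the numbering of matrix entries by i * p + j to the base p digits that index the
entries of B. -/
theorem pairIndex_digits (h : p * p = p ^ 2) (u : Fin 2 → Fin p) :
    pairIndex h (u 0, u 1) = (digitEquiv p 2).symm u := by
  rw [Equiv.eq_symm_apply]
  funext i
  have hp : 0 < p := (u 0).pos
  refine Fin.ext ((digitEquiv_apply _ _).trans ?_)
  have hval : ((pairIndex h (u 0, u 1) : Fin (p ^ 2)) : ℕ) = u 1 + p * u 0 := by
    simp [pairIndex]
  rw [digit, hval]
  revert i
  refine Fin.forall_fin_two.2 ⟨?_, ?_⟩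
  · rw [show 2 - 1 - ((0 : Fin 2) : ℕ) = 1 from rfl, pow_one, Nat.add_mul_div_left _ _ hp,
      Nat.div_eq_of_lt (u 1).2, zero_add, Nat.mod_eq_of_lt (u 0).2]
  · rw [show 2 - 1 - ((1 : Fin 2) : ℕ) = 0 from rfl, pow_zero, Nat.div_one,
      Nat.add_mul_mod_self_left, Nat.mod_eq_of_lt (u 1).2]

theorem pairIndex_append (h : p ^ 2 * p ^ 2 = p ^ 4) (u v : Fin 2 → Fin p) :
    pairIndex h ((digitEquiv p 2).symm u, (digitEquiv p 2).symm v) =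
      (digitEquiv p 4).symm (Fin.append u v) := by
  have := cast_digitEquiv_symm_append u v (pow_add p 2 2)
  rw [pairIndex, Equiv.trans_apply, ← this]
  rfl

theorem vecToMatrix_symm_apply {n N : ℕ} (h : n * n = N) (A : Matrix (Fin n) (Fin n) F)
    (i j : Fin n) : (vecToMatrix F h).symm A (pairIndex h (i, j)) = A i j := by
  change A ((pairIndex h).symm (pairIndex h (i, j))).1
    ((pairIndex h).symm (pairIndex h (i, j))).2 = _
  rw [Equiv.symm_apply_apply]

theorem matrixH_apply (x : Fin (p ^ 2) → F) (u : Fin 2 → Fin p) :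
    matrixH p F x (u 0) (u 1) = x ((digitEquiv p 2).symm u) := by
  rw [← pairIndex_digits (by ring)]
  rfl

theorem matrixH_symm_apply (A : Matrix (Fin p) (Fin p) F) (u : Fin 2 → Fin p) :
    (matrixH p F).symm A ((digitEquiv p 2).symm u) = A (u 0) (u 1) := by
  rw [← pairIndex_digits (by ring)]
  exact vecToMatrix_symm_apply _ A _ _

theorem matrixH₂_symm_apply (A : Matrix (Fin (p ^ 2)) (Fin (p ^ 2)) F) (u v : Fin 2 → Fin p) :
    (matrixH₂ p F).symm A ((digitEquiv p 4).symm (Fin.append u v)) =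
      A ((digitEquiv p 2).symm u) ((digitEquiv p 2).symm v) := by
  rw [← pairIndex_append (by ring)]
  exact vecToMatrix_symm_apply _ A _ _

theorem kron_apply (A C : Matrix (Fin p) (Fin p) F) (u v : Fin 2 → Fin p) :
    kron A C ((digitEquiv p 2).symm u) ((digitEquiv p 2).symm v) =
      A (u 0) (v 0) * C (u 1) (v 1) := by
  rw [← pairIndex_digits (by ring), ← pairIndex_digits (by ring)]
  simp [kron]

theorem sum_two (φ : (Fin 2 → Fin p) → F) : ∑ u, φ u = ∑ i, ∑ j, φ ![i, j] := by
  rw [← (finTwoArrowEquiv (Fin p)).symm.sum_comp, Fintype.sum_prod_type]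
  rfl

/-- The multiplication only reads the entries of x at (i, k) followed by (k, j). There the Kronecker
product of matrices and the tensor product of vectors both equal A i k * C k j, although they differ
elsewhere in general; so one lemma serves both descriptions. -/
theorem matrixH_mulVec_eq_mul {B : Matrix (Fin (p ^ 2)) (Fin (p ^ 4)) F}
    (hB : ∀ u v w : Fin 2 → Fin p, B ((digitEquiv p 2).symm w)
      ((digitEquiv p 4).symm (Fin.append u v)) = mulCoeff F u v w)
    {A C : Matrix (Fin p) (Fin p) F} {x : Fin (p ^ 4) → F}
    (hx : ∀ i j k, x ((digitEquiv p 4).symm (Fin.append ![i, k] ![k, j])) = A i k * C k j) :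
    matrixH p F (B.mulVec x) = A * C := by
  ext i j
  refine (matrixH_apply _ ![i, j]).trans ?_
  rw [Matrix.mulVec, dotProduct, ← (digitEquiv p 4).symm.sum_comp, Matrix.mul_apply]
  refine (sum_append (n := 2) (m := 2) _).trans ?_
  simp only [hB, sum_mulCoeff_right]
  rw [sum_two, Finset.sum_comm]
  refine Finset.sum_congr rfl fun k _ => ?_
  change ∑ q, (if q = i then x ((digitEquiv p 4).symm (Fin.append ![q, k] ![k, j])) else 0) = _
  rw [Finset.sum_ite_eq', if_pos (Finset.mem_univ _), hx]

theorem representsMul {B : Matrix (Fin (p ^ 2)) (Fin (p ^ 4)) F}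
    (hB : ∀ u v w : Fin 2 → Fin p, B ((digitEquiv p 2).symm w)
      ((digitEquiv p 4).symm (Fin.append u v)) = mulCoeff F u v w) : RepresentsMul B := by
  intro A C
  refine ⟨matrixH_mulVec_eq_mul hB fun i j k => ?_, matrixH_mulVec_eq_mul hB fun i j k => ?_⟩
  · rw [matrixH₂_symm_apply, kron_apply]
    rfl
  · rw [vecTensor, matrixH₂_symm_apply, Matrix.vecMulVec_apply, matrixH_symm_apply,
      matrixH_symm_apply]
    rfl

theorem representsOne {B : Matrix (Fin (p ^ 2)) (Fin (p ^ 0)) F}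
    (hB : ∀ (e : Fin 0 → Fin p) (w : Fin 2 → Fin p),
      B ((digitEquiv p 2).symm w) ((digitEquiv p 0).symm e) = traceCoeff F w) :
    RepresentsOne B := by
  unfold RepresentsOne
  ext i j
  refine (matrixH_apply _ ![i, j]).trans ?_
  rw [Matrix.mulVec, dotProduct, ← (digitEquiv p 0).symm.sum_comp, Fintype.sum_unique, hB, mul_one,
    Matrix.one_apply, traceCoeff]
  rfl

theorem representsTrace {B : Matrix (Fin (p ^ 0)) (Fin (p ^ 2)) F}
    (hB : ∀ (e : Fin 0 → Fin p) (w : Fin 2 → Fin p),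
      B ((digitEquiv p 0).symm e) ((digitEquiv p 2).symm w) = traceCoeff F w) :
    RepresentsTrace B := by
  intro A
  funext e
  obtain ⟨e, rfl⟩ := (digitEquiv p 0).symm.surjective e
  rw [Matrix.mulVec, dotProduct, ← (digitEquiv p 2).symm.sum_comp, sum_two, Matrix.trace]
  refine Finset.sum_congr rfl fun i _ => ?_
  simp only [hB, matrixH_symm_apply]
  change ∑ j, (if i = j then (1 : F) else 0) * A i j = A i i
  simp

theorem append_two_two (u v : Fin 2 → Fin p) :
    (Fin.append u v : Fin 4 → Fin p) 0 = u 0 ∧ (Fin.append u v : Fin 4 → Fin p) 1 = u 1 ∧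
      (Fin.append u v : Fin 4 → Fin p) 2 = v 0 ∧ (Fin.append u v : Fin 4 → Fin p) 3 = v 1 :=
  ⟨rfl, rfl, rfl, rfl⟩

theorem entry_multiplication (hp : 0 < p)
    {K : Cobordism (OneCob.sphere * OneCob.sphere) OneCob.sphere} (hK : K.IsMultiplication)
    (u v w : Fin 2 → Fin p) :
    entry p F (OneCob.arrow K) (Fin.append u v) w = mulCoeff F u v w :=
  entry_arrow_of_isMultiplication hp hK (Fin.append u v) w

theorem entry_comultiplication (hp : 0 < p)
    {K : Cobordism OneCob.sphere (OneCob.sphere * OneCob.sphere)} (hK : K.IsComultiplication)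
    (u v w : Fin 2 → Fin p) :
    entry p F (OneCob.arrow K) w (Fin.append u v) = mulCoeff F u v w := by
  refine (entry_arrow_of_isComultiplication hp hK w (Fin.append u v)).trans ?_
  refine if_congr ?_ rfl rfl
  obtain ⟨h0, h1, h2, h3⟩ := append_two_two u v
  rw [h0, h1, h2, h3]
  exact and_congr eq_comm (and_congr Iff.rfl eq_comm)

end MatrixAlgebra

/-! ### The main theorem -/

/-- A description of a manifold that determines its entries determines its arrow, by faithfulness
for p = 2 over the rationals. -/
theorem isArrowOf_of_entry {X Y : OneCob} {P : Cobordism X Y → Prop} {K : Cobordism X Y} (hK : P K)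
    (h : ∀ L, P L → ∀ a b, entry 2 ℚ (OneCob.arrow L) a b = entry 2 ℚ (OneCob.arrow K) a b) :
    OneCob.IsArrowOf P (OneCob.arrow K) :=
  ⟨⟨K, hK⟩, fun L hL => eq_of_entry_eq (F := ℚ) le_rfl (h L hL)⟩

theorem mainTheorem6 (F : Type u) [Field F] [CharZero F] (p : ℕ) (hp : 2 ≤ p) :
    ∃ D : MonoidalOps OneCob,
      -- one-dimensional cobordisms form a symmetric strict monoidal category
      OneCob.IsCobordismOps D ∧ D.IsSymmetricStrictMonoidal ∧
      -- so do matrices, and they are equivalent to finite-dimensional vector spaces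
      (MatCat.ops F).IsSymmetricStrictMonoidal ∧ Nonempty (MatCat F ≌ FGModuleCat.{u} F) ∧
      -- the Brauer representation is a faithful symmetric monoidal functor
      MonoidalOps.IsSymmetricMonoidalFunctor D (MatCat.ops F) (brauer p F) ∧
      (∀ X Y : OneCob, Function.Injective fun f : X ⟶ Y => (brauer p F).map f) ∧
      -- it sends the symmetric Frobenius object given by the sphere to the matrix algebra
      ∃ (μ : OneCob.sphere * OneCob.sphere ⟶ OneCob.sphere) (η : 1 ⟶ OneCob.sphere)
        (δ : OneCob.sphere ⟶ OneCob.sphere * OneCob.sphere) (ε : OneCob.sphere ⟶ 1),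
        OneCob.IsArrowOf Cobordism.IsMultiplication μ ∧ OneCob.IsArrowOf Cobordism.IsUnit η ∧
        OneCob.IsArrowOf Cobordism.IsComultiplication δ ∧
        OneCob.IsArrowOf Cobordism.IsCounit ε ∧
        D.IsSymmetricFrobenius OneCob.sphere μ η δ ε ∧
        (MatCat.ops F).IsSymmetricFrobenius ((brauer p F).obj OneCob.sphere)
          (((brauer p F).map μ).cast (brauer_obj_mul p F _ _) rfl)
          (((brauer p F).map η).cast (brauer_obj_one p F) rfl)
          (((brauer p F).map δ).cast rfl (brauer_obj_mul p F _ _))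
          (((brauer p F).map ε).cast rfl (brauer_obj_one p F)) ∧
        RepresentsMul ((brauer p F).map μ : Matrix (Fin (p ^ 2)) (Fin (p ^ 4)) F) ∧
        RepresentsOne ((brauer p F).map η : Matrix (Fin (p ^ 2)) (Fin (p ^ 0)) F) ∧
        RepresentsTrace ((brauer p F).map ε : Matrix (Fin (p ^ 0)) (Fin (p ^ 2)) F) := by
  have hp0 : 0 < p := by omega
  have hB := isSymmetricMonoidalFunctor_brauer hp0 F
  have hT := brauer_map_injective (F := F) hp
  have hMat := MatCat.isSymmetricStrictMonoidal F
  obtain ⟨μ, hμ⟩ := Cobordism.exists_isMultiplication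
  obtain ⟨η, hη⟩ := Cobordism.exists_isUnit
  obtain ⟨δ, hδ⟩ := Cobordism.exists_isComultiplication
  obtain ⟨ε, hε⟩ := Cobordism.exists_isCounit
  -- The axioms are verified in the category of cobordisms, through entries over F; the statement
  -- about matrices is then their image under the functor.
  have hfrob : OneCob.ops.IsSymmetricFrobenius OneCob.sphere (OneCob.arrow μ) (OneCob.arrow η)
      (OneCob.arrow δ) (OneCob.arrow ε) :=
    isSymmetricFrobenius_of_entry (F := F) hp (m := mulCoeff F) (t := traceCoeff F)
      (entry_multiplication hp0 hμ) (entry_arrow_of_isUnit hp0 hη) (entry_comultiplication hp0 hδ)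
      (fun e w => entry_arrow_of_isCounit hp0 hε w e) sum_mulCoeff_assoc sum_mulCoeff_frobenius
      sum_mulCoeff_frobenius' sum_mulCoeff_unit sum_mulCoeff_unit' sum_mulCoeff_trace_comm
  refine ⟨OneCob.ops, isCobordismOps, hB.isSymmetricStrictMonoidal hT hMat, hMat,
    MatCat.nonempty_equivalence F, hB, hT, OneCob.arrow μ, OneCob.arrow η, OneCob.arrow δ,
    OneCob.arrow ε, ?_, ?_, ?_, ?_, hfrob, ?_, ?_, ?_, ?_⟩
  · exact isArrowOf_of_entry hμ fun L hL a b =>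
      (entry_arrow_of_isMultiplication two_pos hL a b).trans
        (entry_arrow_of_isMultiplication two_pos hμ a b).symm
  · exact isArrowOf_of_entry hη fun L hL a b =>
      (entry_arrow_of_isUnit two_pos hL a b).trans (entry_arrow_of_isUnit two_pos hη a b).symm
  · exact isArrowOf_of_entry hδ fun L hL a b =>
      (entry_arrow_of_isComultiplication two_pos hL a b).trans
        (entry_arrow_of_isComultiplication two_pos hδ a b).symm
  · exact isArrowOf_of_entry hε fun L hL a b =>
      (entry_arrow_of_isCounit two_pos hL a b).trans (entry_arrow_of_isCounit two_pos hε a b).symm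
  · exact hB.isSymmetricFrobenius hfrob (Quiver.Hom.cast_heq _ _ _).symm
      (Quiver.Hom.cast_heq _ _ _).symm (Quiver.Hom.cast_heq _ _ _).symm
      (Quiver.Hom.cast_heq _ _ _).symm
  · exact representsMul (entry_multiplication hp0 hμ)
  · exact representsOne (entry_arrow_of_isUnit hp0 hη)
  · exact representsTrace fun e w => entry_arrow_of_isCounit hp0 hε w e
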